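/- Let $K$ be the function field of a smooth, projective, geometrically connected curve over the finite field $\mathbb{F}_q$; equivalently, $K$ is a finitely generated field extension of $\mathbb{F}_q$ of transcendence degree $1$ in which $\mathbb{F}_q$ is algebraically closed. A place of $K$ is a discrete valuation ring containing $\mathbb{F}_q$ with fraction field $K$ (equivalently, a closed point of the curve); its degree is the degree of its residue field over $\mathbb{F}_q$, and $v_P$ denotes the normalized valuation of the place $P$. Let $g$ be the genus of $K$, i.e. the maximum of $\deg D+1-\dim_{\mathbb{F}_q} L(D)$ over all divisors $D$, where $L(D)=\{f\in K : f=0 \text{ or } \operatorname{div}(f)+D\ge 0\}$. Let $h_K$ be the class number of $K$, i.e. the number of divisor classes of degree $0$, and let $$\zeta_K(s)=\sum_{D\ge 0} q^{-s\deg D}\qquad (s>1),$$ the sum being over all effective divisors of $K$. For a point $x=[x_0:\dots:x_n]\in\mathbb{P}^n(K)$ define its height by $$\mathrm{ht}(x)=-\sum_{P}\deg(P)\,\min_i v_P(x_i),$$ the sum being over all places $P$ of $K$, with $v_P(0)=+\infty$. Fix a place $\infty$ of $K$, of degree $d_\infty$, and an integer $n\ge 1$. Then the height is well defined on $\mathbb{P}^n(K)$,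 there are only finitely many points of each height, $h_K$ is finite, the series for $\zeta_K(n+1)$ converges, and for all integers $r\ge 1$ $$\#\{x\in\mathbb{P}^n(K) : \mathrm{ht}(x)=r\}=\kappa\, q^{(n+1)r}+\begin{cases}O\left(q^r\log(q^r)\right) & \text{if } n=d_\infty=1,\\ O\left(q^{r(n+1-1/d_\infty)}\right) & \text{otherwise,}\end{cases}$$ where $$\kappa=\frac{h_K\,q^{(n+1)(1-g)}}{\zeta_K(n+1)\,(q-1)},$$ and the implied constant depends only on $K$, $\infty$ and $n$. -/

import Mathlib

open IntermediateField in
/-- `K` is a function field of one variable over `F` with full constant field `F`. For a finite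
field `F` these are the function fields of the smooth, projective, geometrically connected curves
over `F`. -/
structure IsFunctionFieldOfCurve (F K : Type*) [Field F] [Field K] [Algebra F K] : Prop where
  exists_transcendental : ∃ x : K, Transcendental F x ∧ FiniteDimensional F⟮x⟯ K
  full_constants : ∀ y : K, IsAlgebraic F y → y ∈ (algebraMap F K).range

/-- A place of `K / F` (a closed point of the curve): a discrete valuation ring with fraction
field `K` that contains `F`. -/
structure Place (F K : Type*) [Field F] [Field K] [Algebra F K] where
  ring : ValuationSubring K
  algebraMap_mem : ∀ a : F, algebraMap F K a ∈ ring
  isDVR : IsDiscreteValuationRing ring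

noncomputable section

namespace Place

variable {F K : Type*} [Field F] [Field K] [Algebra F K]

instance (P : Place F K) : IsDiscreteValuationRing P.ring := P.isDVR

instance (P : Place F K) : Algebra F P.ring :=
  ((algebraMap F K).codRestrict P.ring.toSubring P.algebraMap_mem).toAlgebra

/-- The degree of a place: the degree over `F` of its residue field. -/
def degree (P : Place F K) : ℕ :=
  Module.finrank F (IsLocalRing.ResidueField P.ring)

/-- The normalized valuation of a place, written multiplicatively. -/
def valuation (P : Place F K) : Valuation K (WithZero (Multiplicative ℤ)) :=
  (IsDiscreteValuationRing.maximalIdeal P.ring).valuation K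

/-- The order of vanishing of `f ≠ 0` at `P` (a uniformizer has order `1`). -/
def ord (P : Place F K) (f : K) : ℤ := -WithZero.log (P.valuation f)

/-- The least order at `P` of the coordinates of `x ≠ 0`; a coordinate `0` has order `+∞` and does
not contribute. -/
def minOrd {ι : Type*} (P : Place F K) (x : ι → K) : ℤ := ⨅ i : {i // x i ≠ 0}, P.ord (x i)

end Place

/-- Divisors: finite integral combinations of places. -/
abbrev Divisor (F K : Type*) [Field F] [Field K] [Algebra F K] : Type _ := Place F K →₀ ℤ

namespace Divisor

variable {F K : Type*} [Field F] [Field K] [Algebra F K]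

/-- The degree homomorphism on divisors. -/
def degree : Divisor F K →+ ℤ :=
  Finsupp.liftAddHom fun P => AddMonoidHom.mulRight (P.degree : ℤ)

variable (F K) in
/-- The group of principal divisors. -/
def principal : AddSubgroup (Divisor F K) where
  carrier := {D | ∃ f : K, f ≠ 0 ∧ ∀ P, D P = P.ord f}
  zero_mem' := ⟨1, one_ne_zero, fun P => by simp [Place.ord]⟩
  add_mem' := by
    rintro D E ⟨f, hf, hD⟩ ⟨g, hg, hE⟩
    refine ⟨f * g, mul_ne_zero hf hg, fun P => ?_⟩
    have h1 : P.valuation f ≠ 0 := (Valuation.ne_zero_iff _).2 hf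
    have h2 : P.valuation g ≠ 0 := (Valuation.ne_zero_iff _).2 hg
    rw [Finsupp.add_apply, hD, hE, Place.ord, Place.ord, Place.ord, map_mul,
      WithZero.log_mul h1 h2]
    ring
  neg_mem' := by
    rintro D ⟨f, hf, hD⟩
    refine ⟨f⁻¹, inv_ne_zero hf, fun P => ?_⟩
    rw [Finsupp.neg_apply, hD, Place.ord, Place.ord, map_inv₀, WithZero.log_inv]

/-- The Riemann-Roch space `L(D) = {f : f = 0 or div f + D ≥ 0}`; the condition at `P` is written
with the multiplicative valuation, so that it holds for `f = 0`. -/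
def rrSpace (D : Divisor F K) : Submodule F K where
  carrier := {f | ∀ P : Place F K, P.valuation f ≤ WithZero.exp (D P)}
  zero_mem' := fun P => by simp
  add_mem' := fun hf hg P => (Valuation.map_add _ _ _).trans (max_le (hf P) (hg P))
  smul_mem' := fun a f hf P => by
    have ha : P.valuation (algebraMap F K a) ≤ 1 :=
      IsDedekindDomain.HeightOneSpectrum.valuation_le_one
        (IsDiscreteValuationRing.maximalIdeal P.ring) ⟨algebraMap F K a, P.algebraMap_mem a⟩
    rw [Algebra.smul_def, map_mul]
    exact (mul_le_of_le_one_left zero_le ha).trans (hf P)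

/-- The divisor class group of degree zero. -/
abbrev Pic0 (F K : Type*) [Field F] [Field K] [Algebra F K] : Type _ :=
  (degree (F := F) (K := K)).ker ⧸ (principal F K).addSubgroupOf (degree (F := F) (K := K)).ker

end Divisor

section Invariants

variable (F K : Type*) [Field F] [Field K] [Algebra F K]

/-- The genus: the maximum over all divisors `D` of `deg D + 1 - dim L(D)`. -/
def genus : ℤ :=
  sSup (Set.range fun D : Divisor F K => D.degree + 1 - (Module.finrank F D.rrSpace : ℤ))

/-- The class number `h_K`, the number of divisor classes of degree zero. -/
def classNumber : ℕ := Nat.card (Divisor.Pic0 F K)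

/-- The term `q ^ (-s * deg D)` of the zeta function, for an effective divisor `D`. -/
def zetaTerm (s : ℝ) (D : {D : Divisor F K // 0 ≤ D}) : ℝ :=
  (Nat.card F : ℝ) ^ (-s * (D.1.degree : ℝ))

/-- The zeta function of `K` at real `s > 1`, as a sum over the effective divisors. -/
def zeta (s : ℝ) : ℝ := ∑' D, zetaTerm F K s D

variable {K} in
/-- The height `ht(x) = -deg (inf_i div x_i)` of a coordinate vector `x ≠ 0`. -/
def vecHeight {ι : Type*} (x : ι → K) : ℤ :=
  -∑ᶠ P : Place F K, P.minOrd x * (P.degree : ℤ)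

/-- The points of `ℙⁿ(K)` of height `r`. -/
def pointsOfHeight (n : ℕ) (r : ℤ) : Set (Projectivization K (Fin (n + 1) → K)) :=
  {p | vecHeight F p.rep = r}

/-- The leading coefficient `κ = h_K q ^ ((n + 1) (1 - g)) / (ζ_K (n + 1) (q - 1))`. -/
def leadingCoeff (n : ℕ) : ℝ :=
  (classNumber F K : ℝ) * (Nat.card F : ℝ) ^ (((n : ℤ) + 1) * (1 - genus F K)) /
    (zeta F K ((n : ℝ) + 1) * ((Nat.card F : ℝ) - 1))

end Invariants

end

section

namespace Place

variable {F K : Type*} [Field F] [Field K] [Algebra F K]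

/-! ### The valuation of a place -/

/-! Write q = |F|, h for the class number and l(D) for dim L(D). Normalizing coordinates turns
points of height r into vectors x whose divisor inf_i div(x_i) is exactly -D, where D runs over
representatives of the divisor classes of degree r. The representative D is determined by the point,
and the vector is determined up to F^×, because functions with trivial divisor are constants
(`Divisor.exists_bijective_primitiveVec`). A nonzero x lies in L(D)^(n+1) exactly when its divisor
plus D is effective, so equality is cut out by Möbius inversion over reduced effective divisors S
(`Divisor.ncard_primitiveVec`): the count for D is the sum of (-1)^|S| (q^((n+1) l(D-S)) - 1), and
only deg S ≤ r contributes.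

Riemann's theorem replaces each bracket by q^((n+1)(r - deg S + 1 - g)) with an error bounded
uniformly in D - S (`Divisor.exists_abs_pow_finrank_sub_le`), and there are O(q^r) such S.
Completing the sum over S costs q^((n+1)r) times the tail of a geometric series of ratio q^(-n),
which is again O(q^r). The completed sum of (-1)^|S| q^(-(n+1) deg S) is 1/ζ_K(n+1)
(`Divisor.tsum_pow_mul_tsum_eq_one`). Summing over the h classes and dividing by q - 1 gives κ with
error O(q^r) in every case. This is at least as strong as both error terms claimed, since log(q^r) ≥
log 2 and n + 1 - 1/d_∞ ≥ 1. The place ∞ enters only through d_∞ ≥ 1.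

The theory of divisors is built from valuation rings. The inequality `Place.sum_ord_mul_degree_le`
bounds the degree of zeros by [K : F(x)]; the growth of L(rB) for the pole divisor B of x gives
equality, hence `Divisor.degree_ofFun`, and then Riemann's inequality and theorem.

Every degree must carry exactly h classes, which requires a divisor of degree one
(`IsFunctionFieldOfCurve.exists_degree_eq_one`). If some d > 1 divided all degrees, then over the
constant extension of degree d every place would have two places above it. Pairs of effective
divisors of K would then inject into the effective divisors of the extension, producing more than
the O(q^(dm)) of degree m that exist. -/

theorem ext_ring {P Q : Place F K} (h : P.ring = Q.ring) : P = Q := by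
  cases P; cases Q; cases h; rfl

theorem valuation_le_one_iff (P : Place F K) {f : K} : P.valuation f ≤ 1 ↔ f ∈ P.ring := by
  constructor
  · intro h
    obtain ⟨a, ha⟩ := IsDiscreteValuationRing.exists_lift_of_le_one h
    rw [← ha]
    exact a.2
  · intro h
    exact IsDedekindDomain.HeightOneSpectrum.valuation_le_one
        (IsDiscreteValuationRing.maximalIdeal P.ring) ⟨f, h⟩

theorem valuation_lt_one_iff_residue (P : Place F K) (f : P.ring) :
    P.valuation (f : K) < 1 ↔ IsLocalRing.residue P.ring f = 0 := by
  rw [IsLocalRing.residue_eq_zero_iff]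
  exact IsDedekindDomain.HeightOneSpectrum.valuation_lt_one_iff_mem _ f

theorem exists_valuation_eq_exp_neg_one (P : Place F K) :
    ∃ π : K, P.valuation π = WithZero.exp (-1 : ℤ) :=
  IsDedekindDomain.HeightOneSpectrum.valuation_exists_uniformizer K _

theorem valuation_eq_exp (P : Place F K) {f : K} (hf : f ≠ 0) :
    P.valuation f = WithZero.exp (-P.ord f) := by
  rw [ord, neg_neg, WithZero.exp_log ((Valuation.ne_zero_iff _).2 hf)]

theorem valuation_le_exp_iff (P : Place F K) {f : K} (hf : f ≠ 0) {k : ℤ} :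
    P.valuation f ≤ WithZero.exp k ↔ -k ≤ P.ord f := by
  rw [P.valuation_eq_exp hf, WithZero.exp_le_exp, neg_le]

@[simp] theorem ord_zero (P : Place F K) : P.ord 0 = 0 := by simp [ord]

theorem ord_mul (P : Place F K) {f g : K} (hf : f ≠ 0) (hg : g ≠ 0) :
    P.ord (f * g) = P.ord f + P.ord g := by
  rw [ord, map_mul, WithZero.log_mul ((Valuation.ne_zero_iff _).2 hf)
    ((Valuation.ne_zero_iff _).2 hg), neg_add, ord, ord]

theorem ord_inv (P : Place F K) (f : K) : P.ord f⁻¹ = -P.ord f := by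
  rw [ord, map_inv₀, WithZero.log_inv, ord]

theorem ord_pow (P : Place F K) (f : K) (k : ℕ) : P.ord (f ^ k) = k * P.ord f := by
  rw [ord, map_pow, WithZero.log_pow, ord]
  simp

theorem ord_nonneg_iff (P : Place F K) {f : K} (hf : f ≠ 0) : 0 ≤ P.ord f ↔ f ∈ P.ring := by
  rw [← P.valuation_le_one_iff, ← WithZero.exp_zero, P.valuation_le_exp_iff hf, neg_zero]

theorem valuation_algebraMap_le_one (P : Place F K) (a : F) :
    P.valuation (algebraMap F K a) ≤ 1 :=
  P.valuation_le_one_iff.2 (P.algebraMap_mem a)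

theorem mem_ring_of_isAlgebraic (P : Place F K) {f : K} (hf : IsAlgebraic F f) : f ∈ P.ring := by
  have h : IsIntegral P.ring f := by
    obtain ⟨p, hp, he⟩ := hf.isIntegral
    refine ⟨p.map (algebraMap F P.ring), hp.map _, ?_⟩
    rw [Polynomial.eval₂_map]
    exact he
  obtain ⟨y, hy⟩ := IsIntegrallyClosed.isIntegral_iff.1 h
  rw [← hy]
  exact y.2

theorem ord_eq_zero_of_isAlgebraic (P : Place F K) {f : K} (hf : IsAlgebraic F f) :
    P.ord f = 0 := by
  by_cases h0 : f = 0
  · simp [h0]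
  have h1 := (P.ord_nonneg_iff h0).2 (P.mem_ring_of_isAlgebraic hf)
  have h2 := (P.ord_nonneg_iff (inv_ne_zero h0)).2 (P.mem_ring_of_isAlgebraic hf.inv)
  rw [ord_inv] at h2
  omega

theorem valuation_eq_one_of_isAlgebraic (P : Place F K) {f : K} (hf : IsAlgebraic F f)
    (h0 : f ≠ 0) : P.valuation f = 1 := by
  rw [P.valuation_eq_exp h0, P.ord_eq_zero_of_isAlgebraic hf]
  simp

theorem transcendental_of_ord_ne_zero (P : Place F K) {f : K} (hf : P.ord f ≠ 0) :
    Transcendental F f := fun h => hf (P.ord_eq_zero_of_isAlgebraic h)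

/-! ### Independence of places -/

theorem exists_pow_mul_le {a : WithZero (Multiplicative ℤ)} (ha : a < 1)
    (b : WithZero (Multiplicative ℤ)) (N : ℤ) :
    ∃ k₀ : ℕ, ∀ k ≥ k₀, a ^ k * b ≤ WithZero.exp N := by
  by_cases hb : b = 0
  · exact ⟨0, fun k _ => by simp [hb]⟩
  by_cases ha0 : a = 0
  · exact ⟨1, fun k hk => by simp [ha0, zero_pow (by omega : k ≠ 0)]⟩
  have hl : WithZero.log a < 0 := by
    rw [WithZero.log_lt_iff_lt_exp ha0]
    simpa using ha
  refine ⟨(WithZero.log b - N).toNat, fun k hk => ?_⟩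
  have h1 : a ^ k * b ≠ 0 := mul_ne_zero (pow_ne_zero _ ha0) hb
  rw [← WithZero.log_le_iff_le_exp h1, WithZero.log_mul (pow_ne_zero _ ha0) hb, WithZero.log_pow]
  have h2 : WithZero.log b - N ≤ k := by
    have := Int.self_le_toNat (WithZero.log b - N)
    omega
  have h3 : (k : ℤ) * WithZero.log a ≤ (k : ℤ) * (-1) :=
    mul_le_mul_of_nonneg_left (by omega) (by omega)
  simp only [nsmul_eq_mul]
  omega

/-- Rank one makes these rings maximal. If f lies in the ring of Q but not of P, then f⁻¹ has
positive order at P, so f^(-k) π⁻¹ lies in the ring of P, hence of Q, for large k. Multiplying by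
f^k puts π⁻¹ in the ring of Q, impossible for π a uniformizer at Q. -/
theorem eq_of_ring_le {P Q : Place F K} (h : P.ring ≤ Q.ring) : P = Q := by
  refine ext_ring (le_antisymm h fun f hf => ?_)
  by_contra hfP
  have h1 : P.valuation f⁻¹ < 1 := by
    rw [← P.valuation_le_one_iff, not_le] at hfP
    rw [map_inv₀]
    exact inv_lt_one_of_one_lt₀ hfP
  obtain ⟨π, hπ⟩ := Q.exists_valuation_eq_exp_neg_one
  have hf0 : f ≠ 0 := by rintro rfl; exact hfP P.ring.zero_mem
  obtain ⟨k, hk⟩ := exists_pow_mul_le h1 (P.valuation π⁻¹) 0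
  have h2 := hk k le_rfl
  rw [WithZero.exp_zero, ← map_pow, ← map_mul, P.valuation_le_one_iff] at h2
  have h3 : π⁻¹ ∈ Q.ring := by
    have : π⁻¹ = f ^ k * (f⁻¹ ^ k * π⁻¹) := by
      rw [← mul_assoc, ← mul_pow, mul_inv_cancel₀ hf0, one_pow, one_mul]
    rw [this]
    exact mul_mem (pow_mem hf k) (h h2)
  rw [← Q.valuation_le_one_iff, map_inv₀, hπ, ← WithZero.exp_neg, ← WithZero.exp_zero,
    WithZero.exp_le_exp] at h3
  omega

theorem exists_one_lt_lt_one {P Q : Place F K} (h : P ≠ Q) :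
    ∃ z : K, 1 < P.valuation z ∧ Q.valuation z < 1 := by
  obtain ⟨a, haQ, haP⟩ := SetLike.not_le_iff_exists.1 fun h' => h (eq_of_ring_le (P := Q) h').symm
  obtain ⟨b, hbP, hbQ⟩ := SetLike.not_le_iff_exists.1 fun h' => h (eq_of_ring_le h')
  rw [← valuation_le_one_iff] at haQ haP hbP hbQ
  rw [not_le] at haP hbQ
  have hb0 : b ≠ 0 := by rintro rfl; simp at hbQ
  refine ⟨a * b⁻¹, ?_, ?_⟩
  · rw [map_mul, map_inv₀]
    exact lt_mul_of_lt_of_one_le haP ((one_le_inv₀ ((Valuation.pos_iff _).2 hb0)).2 hbP)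
  · rw [map_mul, map_inv₀]
    exact mul_lt_one_of_nonneg_of_lt_one_right haQ zero_le (inv_lt_one_of_one_lt₀ hbQ)

theorem valuation_one_add_of_one_lt (P : Place F K) {w : K} (hw : 1 < P.valuation w) :
    P.valuation (1 + w) = P.valuation w := by
  rw [Valuation.map_add_eq_of_lt_right _ (by rwa [map_one])]

theorem valuation_one_add_of_lt_one (P : Place F K) {w : K} (hw : P.valuation w < 1) :
    P.valuation (1 + w) = 1 := by
  rw [Valuation.map_add_eq_of_lt_left _ (by rwa [map_one]), map_one]

/-- Artin–Whaples induction. Let w work for T and let z separate P from the new place Q. According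
to whether w has value below, equal to or above 1 at Q, the new element is w, w^k z, or w^k (1 +
w^k)⁻¹ z. The factor w^k (1 + w^k)⁻¹ does not change the valuation of z where w is large, and is
small where w is small. -/
theorem exists_one_lt_forall_lt_one (P : Place F K) (T : Finset (Place F K)) (hP : P ∉ T) :
    ∃ w : K, 1 < P.valuation w ∧ ∀ Q ∈ T, Q.valuation w < 1 := by
  classical
  induction T using Finset.induction_on with
  | empty =>
    obtain ⟨π, hπ⟩ := P.exists_valuation_eq_exp_neg_one
    refine ⟨π⁻¹, ?_, by simp⟩
    rw [map_inv₀, hπ, ← WithZero.exp_neg, ← WithZero.exp_zero, WithZero.exp_lt_exp]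
    omega
  | insert Q T hQ ih =>
    rw [Finset.mem_insert, not_or] at hP
    obtain ⟨w, hw, hwT⟩ := ih hP.2
    obtain ⟨z, hz, hzQ⟩ := exists_one_lt_lt_one hP.1
    have key : ∃ k : ℕ, 1 ≤ k ∧ ∀ R ∈ T, R.valuation w ^ k * R.valuation z < 1 := by
      have : ∀ R ∈ T, ∃ k₀ : ℕ, ∀ k ≥ k₀, R.valuation w ^ k * R.valuation z ≤
          WithZero.exp (-1) := fun R hR => exists_pow_mul_le (hwT R hR) _ _
      choose! k₀ hk₀ using this
      refine ⟨max 1 (T.sup k₀), le_max_left _ _, fun R hR => lt_of_le_of_lt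
        (hk₀ R hR _ ((Finset.le_sup hR).trans (le_max_right _ _))) ?_⟩
      rw [← WithZero.exp_zero, WithZero.exp_lt_exp]
      omega
    obtain ⟨k, hk1, hk⟩ := key
    have hk0 : k ≠ 0 := by omega
    rcases lt_trichotomy (Q.valuation w) 1 with h | h | h
    · exact ⟨w, hw, fun R hR => by
        rcases Finset.mem_insert.1 hR with rfl | hR
        · exact h
        · exact hwT R hR⟩
    · refine ⟨w ^ k * z, ?_, fun R hR => ?_⟩
      · rw [map_mul, map_pow]
        exact one_lt_mul_of_le_of_lt (one_le_pow₀ hw.le) hz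
      · rcases Finset.mem_insert.1 hR with rfl | hR
        · rw [map_mul, map_pow, h, one_pow, one_mul]
          exact hzQ
        · rw [map_mul, map_pow]
          exact hk R hR
    · refine ⟨w ^ k * (1 + w ^ k)⁻¹ * z, ?_, fun R hR => ?_⟩
      · have h1 : 1 < P.valuation (w ^ k) := by
          rw [map_pow]
          exact one_lt_pow₀ hw hk0
        rw [map_mul, map_mul, map_inv₀, P.valuation_one_add_of_one_lt h1,
          mul_inv_cancel₀ (by rintro h0; rw [h0] at h1; simp at h1), one_mul]
        exact hz
      · rcases Finset.mem_insert.1 hR with rfl | hR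
        · have h1 : 1 < R.valuation (w ^ k) := by
            rw [map_pow]
            exact one_lt_pow₀ h hk0
          rw [map_mul, map_mul, map_inv₀, R.valuation_one_add_of_one_lt h1,
            mul_inv_cancel₀ (by rintro h0; rw [h0] at h1; simp at h1), one_mul]
          exact hzQ
        · have h1 : R.valuation (w ^ k) < 1 := by
            rw [map_pow]
            exact pow_lt_one₀ zero_le (hwT R hR) hk0
          rw [map_mul, map_mul, map_inv₀, R.valuation_one_add_of_lt_one h1, inv_one, mul_one,
            map_pow]
          exact hk R hR

/-- As k grows, w^k (1 + w^k)⁻¹ tends to 1 where w has value above 1 and to 0 where it has value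
below 1. -/
theorem exists_approx_one (P : Place F K) (T : Finset (Place F K)) (hP : P ∉ T) (N : ℤ) :
    ∃ e : K, P.valuation (e - 1) ≤ WithZero.exp N ∧ ∀ Q ∈ T, Q.valuation e ≤ WithZero.exp N := by
  obtain ⟨w, hw, hwT⟩ := P.exists_one_lt_forall_lt_one T hP
  have hw0 : w ≠ 0 := by rintro rfl; simp at hw
  have hwP : P.valuation w⁻¹ < 1 := by
    rw [map_inv₀]
    exact inv_lt_one_of_one_lt₀ hw
  obtain ⟨k₁, hk₁⟩ := exists_pow_mul_le hwP 1 N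
  have : ∀ R ∈ T, ∃ k₀ : ℕ, ∀ k ≥ k₀, R.valuation w ^ k * 1 ≤ WithZero.exp N :=
    fun R hR => exists_pow_mul_le (hwT R hR) _ _
  choose! k₀ hk₀ using this
  set k := max 1 (max k₁ (T.sup k₀)) with hk
  have hk0 : k ≠ 0 := by
    have : 1 ≤ k := le_max_left _ _
    omega
  refine ⟨w ^ k * (1 + w ^ k)⁻¹, ?_, fun R hR => ?_⟩
  · have h1 : 1 < P.valuation (w ^ k) := by
      rw [map_pow]
      exact one_lt_pow₀ hw hk0
    have h2 := P.valuation_one_add_of_one_lt h1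
    have h3 : 1 + w ^ k ≠ 0 := by
      intro h0
      rw [h0, map_zero] at h2
      rw [← h2] at h1
      simp at h1
    have h4 : w ^ k * (1 + w ^ k)⁻¹ - 1 = -(1 + w ^ k)⁻¹ := by
      field_simp
      ring
    rw [h4, Valuation.map_neg, map_inv₀, h2, ← map_inv₀, ← inv_pow, map_pow]
    simpa using hk₁ k ((le_max_left _ _).trans (le_max_right _ _))
  · have h1 : R.valuation (w ^ k) < 1 := by
      rw [map_pow]
      exact pow_lt_one₀ zero_le (hwT R hR) hk0
    rw [map_mul, map_inv₀, R.valuation_one_add_of_lt_one h1, inv_one, map_pow]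
    exact hk₀ R hR k ((Finset.le_sup hR).trans ((le_max_right _ _).trans (le_max_right _ _)))

/-- Weak approximation at finitely many places. -/
theorem exists_approx (T : Finset (Place F K)) (a : Place F K → K) (N : ℤ) :
    ∃ z : K, ∀ P ∈ T, P.valuation (z - a P) ≤ WithZero.exp N := by
  classical
  obtain ⟨B, hB⟩ : ∃ B : ℤ, ∀ Q ∈ T, ∀ P ∈ T, Q.valuation (a P) ≤ WithZero.exp B := by
    obtain ⟨B, hB⟩ := ((T ×ˢ T).image fun x => WithZero.log (x.1.valuation (a x.2))).bddAbove
    refine ⟨B, fun Q hQ P hP => WithZero.le_exp_of_log_le (hB ?_)⟩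
    exact Finset.mem_coe.2 (Finset.mem_image.2 ⟨(Q, P), Finset.mem_product.2 ⟨hQ, hP⟩, rfl⟩)
  -- Multiplication by `a P` can lose a factor exp B, so the approximate idempotents `e P` are taken
  -- to precision N - B.
  have : ∀ P : Place F K, ∃ e : K, P.valuation (e - 1) ≤ WithZero.exp (N - B) ∧
      ∀ Q ∈ T.erase P, Q.valuation e ≤ WithZero.exp (N - B) :=
    fun P => P.exists_approx_one _ (Finset.notMem_erase P T) _
  choose e he1 he2 using this
  have hexp : WithZero.exp (N - B) * WithZero.exp B = WithZero.exp N := by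
    rw [← WithZero.exp_add, sub_add_cancel]
  refine ⟨∑ P ∈ T, e P * a P, fun P hP => ?_⟩
  rw [← Finset.add_sum_erase _ _ hP, add_sub_right_comm]
  refine (Valuation.map_add _ _ _).trans (max_le ?_ ?_)
  · rw [← sub_one_mul, map_mul, ← hexp]
    exact mul_le_mul' (he1 P) (hB P hP P hP)
  · refine Valuation.map_sum_le _ fun Q hQ => ?_
    rw [map_mul, ← hexp]
    exact mul_le_mul' (he2 Q P (Finset.mem_erase.2 ⟨(Finset.ne_of_mem_erase hQ).symm, hP⟩))
      (hB P hP Q (Finset.mem_of_mem_erase hQ))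

end Place

end

section

open IntermediateField Polynomial

variable {F K : Type*} [Field F] [Field K] [Algebra F K]

/-! ### Finiteness over subfields generated by one element -/

/-- Compares two subfields through their images in K, so that no tower of algebras between them has
to be set up. -/
theorem Module.Finite.of_range_algebraMap_le (A B : Type*) {K : Type*} [Field A] [Field B] [Field K]
    [Algebra A K] [Algebra B K] (h : (algebraMap A K).range ≤ (algebraMap B K).range)
    [Module.Finite A K] : Module.Finite B K := by
  obtain ⟨s, hs⟩ := Module.finite_def.1 ‹Module.Finite A K›
  refine ⟨s, eq_top_iff.2 fun v _ => ?_⟩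
  have hv : v ∈ Submodule.span A (s : Set K) := by rw [hs]; trivial
  induction hv using Submodule.span_induction with
  | mem x hx => exact Submodule.subset_span hx
  | zero => exact zero_mem _
  | add x y _ _ hx hy => exact add_mem (hx trivial) (hy trivial)
  | smul a x _ hx =>
    obtain ⟨b, hb⟩ := h ⟨a, rfl⟩
    rw [Algebra.smul_def, ← hb, ← Algebra.smul_def]
    exact Submodule.smul_mem _ _ (hx trivial)

variable (F K) in
/-- `K` is a function field of one variable over `F`; the field of constants may be larger
than `F`. -/
def IsFunctionFieldOneVar : Prop :=
  ∃ x : K, Transcendental F x ∧ FiniteDimensional F⟮x⟯ K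

/-- Exchange: y is algebraic over F(x) and transcendental over F, so x is algebraic over F(y). Then
F(y)(x) is finite over F(y), and K is finite over it because it contains F(x). -/
theorem IsFunctionFieldOneVar.finiteDimensional_adjoin (hK : IsFunctionFieldOneVar F K) {y : K}
    (hy : Transcendental F y) : FiniteDimensional F⟮y⟯ K := by
  obtain ⟨x, hx, hfin⟩ := hK
  have h1 : IsAlgebraic (Algebra.adjoin F {x}) y := by
    have := Algebra.IsAlgebraic.isAlgebraic (R := F⟮x⟯) y
    open scoped IntermediateField.algebraAdjoinAdjoin in
    exact (IsFractionRing.isAlgebraic_iff (Algebra.adjoin F {x}) F⟮x⟯ K).2 this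
  have h2 : IsAlgebraic F⟮y⟯ x := by
    have h3 := _root_.IsAlgebraic.adjoin_singleton hx hy h1
    open scoped IntermediateField.algebraAdjoinAdjoin in
    exact (IsFractionRing.isAlgebraic_iff (Algebra.adjoin F {y}) F⟮y⟯ K).1 h3
  have h4 : FiniteDimensional F⟮y⟯ F⟮y⟯⟮x⟯ := adjoin.finiteDimensional h2.isIntegral
  have h5 : FiniteDimensional F⟮y⟯⟮x⟯ K := by
    refine Module.Finite.of_range_algebraMap_le F⟮x⟯ F⟮y⟯⟮x⟯ ?_
    rintro _ ⟨a, rfl⟩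
    have h6 : F⟮x⟯ ≤ (F⟮y⟯⟮x⟯).restrictScalars F := by
      rw [adjoin_simple_le_iff]
      exact mem_adjoin_simple_self F⟮y⟯ x
    exact ⟨⟨a, h6 a.2⟩, rfl⟩
  exact FiniteDimensional.trans F⟮y⟯ F⟮y⟯⟮x⟯ K

/-- Modulo x M only the constant terms of the p i survive, so they vanish by `hind`. The relation
can then be divided by x, and the degree drops. -/
theorem eq_zero_of_sum_aeval_mul_eq_zero {x : K} (hx : x ≠ 0) (M : Submodule F K)
    (hM : ∀ m ∈ M, x * m ∈ M) {ι : Type*} [Fintype ι] {u : ι → K} (hu : ∀ i, u i ∈ M)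
    (hind : ∀ a : ι → F, (∃ m ∈ M, ∑ i, a i • u i = x * m) → a = 0) (d : ℕ) (p : ι → F[X])
    (hd : ∀ i, (p i).natDegree ≤ d) (hp : ∑ i, aeval x (p i) * u i = 0) : p = 0 := by
  have hMp : ∀ (q : F[X]), ∀ m ∈ M, aeval x q * m ∈ M := by
    intro q
    induction q using Polynomial.induction_on' with
    | add q r hq hr =>
      intro m hm
      rw [map_add, add_mul]
      exact M.add_mem (hq m hm) (hr m hm)
    | monomial k a =>
      intro m hm
      rw [aeval_monomial, mul_assoc, ← Algebra.smul_def]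
      refine M.smul_mem _ ?_
      induction k with
      | zero => simpa using hm
      | succ k ih =>
        rw [pow_succ', mul_assoc]
        exact hM _ ih
  have step : ∀ q : ι → F[X], ∑ i, aeval x (q i) * u i = 0 →
      (∀ i, (q i).coeff 0 = 0) ∧ ∑ i, aeval x (q i).divX * u i = 0 := by
    intro q hq
    have h1 : ∑ i, (q i).coeff 0 • u i + x * ∑ i, aeval x (q i).divX * u i = 0 := by
      rw [← hq, Finset.mul_sum, ← Finset.sum_add_distrib]
      refine Finset.sum_congr rfl fun i _ => ?_
      conv_rhs => rw [← divX_mul_X_add (q i)]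
      rw [map_add, map_mul, aeval_X, aeval_C, Algebra.smul_def]
      ring
    have h2 : (fun i => (q i).coeff 0) = 0 := by
      refine hind _ ⟨-∑ i, aeval x (q i).divX * u i,
        M.neg_mem (M.sum_mem fun i _ => hMp _ _ (hu i)), ?_⟩
      rw [mul_neg]
      exact eq_neg_of_add_eq_zero_left h1
    refine ⟨fun i => congrFun h2 i, ?_⟩
    have h3 : ∑ i, (q i).coeff 0 • u i = 0 :=
      Finset.sum_eq_zero fun i _ => by rw [congrFun h2 i]; simp
    rw [h3, zero_add] at h1
    exact (mul_eq_zero.1 h1).resolve_left hx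
  induction d generalizing p with
  | zero =>
    funext i
    rw [eq_C_of_natDegree_le_zero (hd i), (step p hp).1 i]
    simp
  | succ d ih =>
    have h := ih (fun i => (p i).divX)
      (fun i => by rw [natDegree_divX_eq_natDegree_tsub_one]; have := hd i; omega) (step p hp).2
    funext i
    rw [← divX_mul_X_add (p i), (step p hp).1 i, congrFun h i]
    simp

/-- Elements of an `x`-stable subspace `M` which are linearly independent over `F` modulo `x M` are
linearly independent over `F(x)`. -/
theorem card_le_finrank_adjoin {x : K} (hx : x ≠ 0) [FiniteDimensional F⟮x⟯ K] (M : Submodule F K)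
    (hM : ∀ m ∈ M, x * m ∈ M) {ι : Type*} [Fintype ι] {u : ι → K} (hu : ∀ i, u i ∈ M)
    (hind : ∀ a : ι → F, (∃ m ∈ M, ∑ i, a i • u i = x * m) → a = 0) :
    Fintype.card ι ≤ Module.finrank F⟮x⟯ K := by
  have h : LinearIndependent F⟮x⟯ u := by
    open scoped IntermediateField.algebraAdjoinAdjoin in
    rw [← LinearIndependent.iff_fractionRing (Algebra.adjoin F {x}), Fintype.linearIndependent_iff]
    intro g hg
    have hg' : ∀ i, ∃ p : F[X], aeval x p = (g i : K) := by
      intro i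
      have h1 : ∀ z ∈ Algebra.adjoin F {x}, ∃ p : F[X], aeval x p = z := fun z hz => by
        rwa [Algebra.adjoin_singleton_eq_range_aeval] at hz
      exact h1 _ (g i).2
    choose p hp using hg'
    have h1 : ∑ i, aeval x (p i) * u i = 0 := by
      rw [← hg]
      refine Finset.sum_congr rfl fun i _ => ?_
      rw [hp, Algebra.smul_def]
      rfl
    have h2 := eq_zero_of_sum_aeval_mul_eq_zero hx M hM hu hind (Finset.univ.sup fun i =>
      (p i).natDegree) p (fun i => Finset.le_sup (f := fun i => (p i).natDegree)
        (Finset.mem_univ i)) h1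
    intro i
    apply Subtype.ext
    rw [← hp i, congrFun h2 i]
    simp
  exact h.fintype_card_le_finrank

/-! ### Valuation rings of a function field are discrete -/

section ValuationRing

variable (V : ValuationSubring K) (hV : ∀ a : F, algebraMap F K a ∈ V)

/-- The algebra structure on a valuation ring containing the constants. -/
abbrev ValuationSubring.algebraOfMem : Algebra F V :=
  ((algebraMap F K).codRestrict V.toSubring hV).toAlgebra

/-- Lifts of classes independent over F modulo x are independent over F(x), so the dimension is at
most [K : F(x)]. -/
theorem ValuationSubring.finite_quotient_span (x : V) (hx : (x : K) ≠ 0)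
    [FiniteDimensional F⟮(x : K)⟯ K] :
    letI := V.algebraOfMem hV
    Module.Finite F (V ⧸ Ideal.span {x}) := by
  let := V.algebraOfMem hV
  have hrank : Module.rank F (V ⧸ Ideal.span {x}) ≤ Module.finrank F⟮(x : K)⟯ K := by
    refine rank_le fun s hs => ?_
    rw [← Fintype.card_coe]
    choose u hu using fun i : s => Ideal.Quotient.mk_surjective (i : V ⧸ Ideal.span {x})
    let M : Submodule F K :=
      { carrier := V
        add_mem' := V.add_mem _ _
        zero_mem' := V.zero_mem
        smul_mem' := fun a m hm => by
          rw [Algebra.smul_def]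
          exact V.mul_mem _ _ (hV a) hm }
    refine card_le_finrank_adjoin hx M (fun m hm => V.mul_mem _ _ x.2 hm)
      (u := fun i => (u i : K)) (fun i => (u i).2) ?_
    rintro a ⟨m, hm, ham⟩
    have h1 : ∑ i, a i • u i = x * ⟨m, hm⟩ := by
      apply Subtype.ext
      rw [V.toSubring.coe_mul, ← ham]
      refine (map_sum V.subtype _ _).trans (Finset.sum_congr rfl fun i _ => ?_)
      rw [Algebra.smul_def, map_mul, Algebra.smul_def]
      rfl
    have h2 : ∑ i, a i • (i : V ⧸ Ideal.span {x}) = 0 := by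
      have : Ideal.Quotient.mk (Ideal.span {x}) (∑ i, a i • u i) = 0 := by
        rw [h1, Ideal.Quotient.eq_zero_iff_mem]
        exact Ideal.mul_mem_right _ _ (Ideal.mem_span_singleton_self x)
      rw [← this, map_sum]
      refine Finset.sum_congr rfl fun i _ => ?_
      rw [← hu i]
      rfl
    funext i
    exact Fintype.linearIndependent_iff.1 hs a h2 i
  exact Module.rank_lt_aleph0_iff.1 (hrank.trans_lt (Cardinal.natCast_lt_aleph0))

theorem ValuationSubring.mem_of_isAlgebraic (hV : ∀ a : F, algebraMap F K a ∈ V) {x : K}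
    (hx : IsAlgebraic F x) : x ∈ V := by
  let := V.algebraOfMem hV
  have h : IsIntegral V x := by
    obtain ⟨p, hp, he⟩ := hx.isIntegral
    refine ⟨p.map (algebraMap F V), hp.map _, ?_⟩
    rw [Polynomial.eval₂_map]
    exact he
  obtain ⟨y, hy⟩ := IsIntegrallyClosed.isIntegral_iff.1 h
  rw [← hy]
  exact y.2

/-- A nonzero proper ideal I contains a nonzero nonunit x, which is transcendental because V
contains all algebraic elements. As V/(x) is finite over F, the image of I there is finitely
generated, and so is I. A Noetherian valuation ring that is not a field is discrete. -/
theorem ValuationSubring.isDiscreteValuationRing (hK : IsFunctionFieldOneVar F K)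
    (hV : ∀ a : F, algebraMap F K a ∈ V) (hVtop : V ≠ ⊤) : IsDiscreteValuationRing V := by
  let := V.algebraOfMem hV
  have htr : ∀ x : V, x ≠ 0 → x ∈ IsLocalRing.maximalIdeal V → Transcendental F (x : K) := by
    intro x hx0 hx halg
    have h1 := V.mem_of_isAlgebraic hV halg.inv
    refine (IsLocalRing.mem_maximalIdeal _).1 hx (IsUnit.of_mul_eq_one ⟨_, h1⟩ ?_)
    apply Subtype.ext
    exact mul_inv_cancel₀ (fun h => hx0 (Subtype.ext h))
  have hnoeth : IsNoetherianRing V := by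
    rw [isNoetherianRing_iff_ideal_fg]
    intro I
    by_cases hbot : I = ⊥
    · rw [hbot]
      exact Submodule.fg_bot
    by_cases htop : I = ⊤
    · rw [htop]
      exact Ideal.fg_top V
    obtain ⟨x, hxI, hx0⟩ := Submodule.exists_mem_ne_zero_of_ne_bot hbot
    have hxt := htr x hx0 (IsLocalRing.le_maximalIdeal htop hxI)
    have := hK.finiteDimensional_adjoin hxt
    have hfin := V.finite_quotient_span hV x (fun h => hx0 (Subtype.ext h))
    have hN : IsNoetherian V (V ⧸ Ideal.span {x}) := isNoetherian_of_tower F inferInstance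
    refine Submodule.fg_of_fg_map_of_fg_inf_ker (Ideal.span {x}).mkQ (hN.noetherian _) ?_
    rw [Submodule.ker_mkQ, inf_eq_right.2 ((Ideal.span_singleton_le_iff_mem _).2 hxI)]
    exact ⟨{x}, by simp [Ideal.span]⟩
  have hfield : ¬ IsField V := by
    intro hf
    refine hVtop (_root_.eq_top_iff.2 fun x _ => ?_)
    rcases V.mem_or_inv_mem x with h | h
    · exact h
    by_cases h0 : x = 0
    · rw [h0]; exact V.zero_mem
    obtain ⟨y, hy⟩ := hf.mul_inv_cancel (a := ⟨x⁻¹, h⟩) (by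
      intro h'
      exact inv_ne_zero h0 (congrArg Subtype.val h'))
    have : (y : K) = x := by
      have := congrArg Subtype.val hy
      change x⁻¹ * (y : K) = 1 at this
      field_simp at this
      exact this
    rw [← this]
    exact y.2
  have hval : ValuationRing V := inferInstance
  exact ((IsDiscreteValuationRing.TFAE V hfield).out 1 0).1 hval

end ValuationRing

/-! ### Existence of zeros -/

namespace Place

/-- A transcendental element has a zero. -/
theorem exists_valuation_lt_one (hK : IsFunctionFieldOneVar F K) {x : K}
    (hx : Transcendental F x) : ∃ P : Place F K, P.valuation x < 1 := by
  let A : Subring K := (Algebra.adjoin F {x}).toSubring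
  let y : A := ⟨x, Algebra.self_mem_adjoin_singleton F x⟩
  have hI : Ideal.span {y} ≠ ⊤ := by
    rw [Ne, Ideal.span_singleton_eq_top]
    intro hu
    obtain ⟨z, hz⟩ := hu.exists_right_inv
    have hzm : (z : K) ∈ Algebra.adjoin F {x} := z.2
    rw [Algebra.adjoin_singleton_eq_range_aeval] at hzm
    obtain ⟨p, hp⟩ := hzm
    have h1 : aeval x (X * p - 1) = 0 := by
      have h2 : x * (z : K) = 1 := congrArg Subtype.val hz
      rw [map_sub, map_mul, aeval_X, map_one, show aeval x p = (z : K) from hp, h2, sub_self]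
    have h3 : (X * p - 1 : F[X]) = 0 := by
      by_contra hne
      exact hx ⟨_, hne, h1⟩
    have h4 := congrArg (Polynomial.coeff · 0) h3
    simp at h4
  -- Since x is not a unit of F[x], Chevalley's extension theorem yields a valuation ring containing
  -- F[x] in which x is a nonunit.
  obtain ⟨V, hAV, hV⟩ := Ideal.image_subset_nonunits_valuationSubring _ hI
  have hVF : ∀ a : F, algebraMap F K a ∈ V := fun a => hAV ((Algebra.adjoin F {x}).algebraMap_mem a)
  have hxV : x ∈ V.nonunits := hV ⟨y, Ideal.mem_span_singleton_self y, rfl⟩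
  have hx0 : x ≠ 0 := by
    rintro rfl
    exact hx isAlgebraic_zero
  have hinv : x⁻¹ ∉ V := by
    rw [ValuationSubring.mem_nonunits_iff] at hxV
    rw [← ValuationSubring.valuation_le_one_iff, map_inv₀, not_le]
    exact one_lt_inv_iff₀.2 ⟨(Valuation.pos_iff _).2 hx0, hxV⟩
  have hdvr : IsDiscreteValuationRing V := V.isDiscreteValuationRing hK hVF (by
    rintro rfl
    exact hinv trivial)
  refine ⟨⟨V, hVF, hdvr⟩, ?_⟩
  rw [← not_le]
  intro h
  refine hinv ?_
  rw [← valuation_le_one_iff ⟨V, hVF, hdvr⟩, map_inv₀]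
  exact inv_le_one_of_one_le₀ h

/-! ### Residue fields and the number of zeros -/

instance (P : Place F K) : IsScalarTower F P.ring K :=
  IsScalarTower.of_algebraMap_eq fun _ => rfl

theorem exists_ord_eq_one (P : Place F K) : ∃ π : K, π ≠ 0 ∧ P.ord π = 1 := by
  obtain ⟨π, hπ⟩ := P.exists_valuation_eq_exp_neg_one
  refine ⟨π, ?_, by simp [ord, hπ]⟩
  rintro rfl
  rw [map_zero] at hπ
  exact WithZero.exp_ne_zero hπ.symm

theorem finite_residueField (hK : IsFunctionFieldOneVar F K) (P : Place F K) :
    Module.Finite F (IsLocalRing.ResidueField P.ring) := by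
  obtain ⟨π, h0, hπ⟩ := P.exists_ord_eq_one
  have hmem : π ∈ P.ring := (P.ord_nonneg_iff h0).1 (by omega)
  have := hK.finiteDimensional_adjoin (P.transcendental_of_ord_ne_zero (f := π) (by omega))
  have hfin := P.ring.finite_quotient_span P.algebraMap_mem ⟨π, hmem⟩ h0
  have hle : Ideal.span {(⟨π, hmem⟩ : P.ring)} ≤ IsLocalRing.maximalIdeal P.ring := by
    rw [Ideal.span_singleton_le_iff_mem, ← IsLocalRing.residue_eq_zero_iff,
      ← P.valuation_lt_one_iff_residue]
    rw [P.valuation_eq_exp h0, hπ, ← WithZero.exp_zero, WithZero.exp_lt_exp]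
    omega
  exact Module.Finite.of_surjective (Ideal.Quotient.factorₐ F hle).toLinearMap
    (Ideal.Quotient.factor_surjective hle)

theorem degree_pos (hK : IsFunctionFieldOneVar F K) (P : Place F K) : 0 < P.degree := by
  have := P.finite_residueField hK
  exact Module.finrank_pos

/-- Reduction to the residue field kills the coefficients of π^0, because the residues of the s j
are independent. What remains is divisible by π, and induction on e applies. -/
theorem eq_zero_of_valuation_sum_le (P : Place F K) {d : ℕ} (s : Fin d → P.ring)
    (hs : LinearIndependent F fun j => IsLocalRing.residue P.ring (s j)) {π : K} (h0 : π ≠ 0)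
    (hπ : P.ord π = 1) (e : ℕ) (a : Fin e × Fin d → F)
    (ha : P.valuation (∑ kj : Fin e × Fin d, a kj • (π ^ (kj.1 : ℕ) * (s kj.2 : K))) ≤
      WithZero.exp (-(e : ℤ))) : a = 0 := by
  have hvπ : P.valuation π = WithZero.exp (-1 : ℤ) := by rw [P.valuation_eq_exp h0, hπ]
  induction e with
  | zero =>
    funext kj
    exact kj.1.elim0
  | succ e ih =>
    set b : Fin e × Fin d → F := fun kj => a (kj.1.succ, kj.2) with hb
    set B : K := ∑ kj : Fin e × Fin d, b kj • (π ^ (kj.1 : ℕ) * (s kj.2 : K)) with hB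
    set A : P.ring := ∑ j, a (0, j) • s j with hA
    have hsplit : ∑ kj : Fin (e + 1) × Fin d, a kj • (π ^ (kj.1 : ℕ) * (s kj.2 : K)) =
        (A : K) + π * B := by
      rw [Fintype.sum_prod_type, Fin.sum_univ_succ, hB, Fintype.sum_prod_type, Finset.mul_sum]
      congr 1
      · rw [hA]
        refine Eq.trans ?_ (map_sum P.ring.subtype _ _).symm
        refine Finset.sum_congr rfl fun j _ => ?_
        rw [Algebra.smul_def, Algebra.smul_def, map_mul, Fin.val_zero, pow_zero, one_mul]
        rfl
      · refine Finset.sum_congr rfl fun k _ => ?_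
        rw [Finset.mul_sum]
        refine Finset.sum_congr rfl fun j _ => ?_
        rw [mul_smul_comm, ← mul_assoc, Fin.val_succ, pow_succ']
    rw [hsplit] at ha
    have hBle : P.valuation B ≤ 1 := by
      refine Valuation.map_sum_le _ fun kj _ => ?_
      rw [Algebra.smul_def, P.valuation_le_one_iff]
      refine mul_mem (P.algebraMap_mem _) (mul_mem (pow_mem ?_ _) (s kj.2).2)
      exact (P.ord_nonneg_iff h0).1 (by omega)
    have hA1 : P.valuation (A : K) < 1 := by
      have : (A : K) = ((A : K) + π * B) - π * B := by ring
      rw [this]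
      refine (Valuation.map_sub _ _ _).trans_lt (max_lt (ha.trans_lt ?_) ?_)
      · rw [← WithZero.exp_zero, WithZero.exp_lt_exp]
        omega
      · rw [map_mul, hvπ]
        refine (mul_le_of_le_one_right zero_le hBle).trans_lt ?_
        rw [← WithZero.exp_zero, WithZero.exp_lt_exp]
        omega
    have ha0 : ∀ j, a (0, j) = 0 := by
      rw [P.valuation_lt_one_iff_residue, hA, map_sum] at hA1
      refine Fintype.linearIndependent_iff.1 hs _ ?_
      rw [← hA1]
      exact Finset.sum_congr rfl fun j _ => rfl
    have hA0 : A = 0 := by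
      rw [hA]
      exact Finset.sum_eq_zero fun j _ => by rw [ha0, zero_smul]
    have hb0 : b = 0 := by
      refine ih b ?_
      rw [← hB]
      rw [hA0, ZeroMemClass.coe_zero, zero_add, map_mul, hvπ] at ha
      have h1 : WithZero.exp (-((e + 1 : ℕ) : ℤ)) =
          WithZero.exp (-1 : ℤ) * WithZero.exp (-(e : ℤ)) := by
        rw [← WithZero.exp_add]
        congr 1
        push_cast
        ring
      rw [h1] at ha
      exact le_of_mul_le_mul_left ha WithZero.exp_pos
    funext ⟨k, j⟩
    refine Fin.cases (ha0 j) (fun k => congrFun hb0 (k, j)) k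

/-- At each P in S the elements π^k s_j with k < ord_P x and j < deg P are independent modulo x.
Weak approximation gives elements of K that are close to one of these at its own place and close to
0 at the others. Together they are independent modulo x in the ring of functions regular on S, so
their number is at most [K : F(x)]. -/
theorem sum_ord_mul_degree_le (hK : IsFunctionFieldOneVar F K) {x : K} (hx : Transcendental F x)
    (S : Finset (Place F K)) (hS : ∀ P ∈ S, 0 < P.ord x) :
    ∑ P ∈ S, P.ord x * (P.degree : ℤ) ≤ Module.finrank F⟮x⟯ K := by
  classical
  have hx0 : x ≠ 0 := by
    rintro rfl
    exact hx isAlgebraic_zero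
  have := hK.finiteDimensional_adjoin hx
  choose π hπ0 hπ using fun P : Place F K => P.exists_ord_eq_one
  have hbasis : ∀ P : Place F K, ∃ s : Fin P.degree → P.ring,
      LinearIndependent F fun j => IsLocalRing.residue P.ring (s j) := by
    intro P
    have := P.finite_residueField hK
    choose s hs using fun j : Fin P.degree =>
      IsLocalRing.residue_surjective (R := P.ring)
        (Module.finBasis F (IsLocalRing.ResidueField P.ring) j)
    refine ⟨s, ?_⟩
    simp_rw [hs]
    exact (Module.finBasis F (IsLocalRing.ResidueField P.ring)).linearIndependent
  choose s hs using hbasis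
  let e : Place F K → ℕ := fun P => (P.ord x).toNat
  have he : ∀ P ∈ S, ((e P : ℕ) : ℤ) = P.ord x := fun P hP =>
    Int.toNat_of_nonneg (hS P hP).le
  have hvx : ∀ P ∈ S, P.valuation x = WithZero.exp (-(e P : ℤ)) := fun P hP => by
    rw [P.valuation_eq_exp hx0, he P hP]
  let ι := Σ P : S, Fin (e P) × Fin (P : Place F K).degree
  -- The bound N ≤ -e P puts the approximation errors into x times the local ring at P; N ≤ 0 keeps
  -- the approximants regular on S.
  obtain ⟨N, hN0, hN⟩ : ∃ N : ℤ, N ≤ 0 ∧ ∀ P ∈ S, N ≤ -(e P : ℤ) := by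
    refine ⟨-((S.sup e : ℕ) : ℤ), by omega, fun P hP => ?_⟩
    have : e P ≤ S.sup e := Finset.le_sup hP
    omega
  have happ : ∀ i : ι, ∃ z : K, ∀ Q ∈ S, Q.valuation (z - if Q = i.1 then
      π i.1 ^ (i.2.1 : ℕ) * (s i.1 i.2.2 : K) else 0) ≤ WithZero.exp N :=
    fun i => exists_approx S _ N
  choose u hu using happ
  let M : Submodule F K :=
    { carrier := {f | ∀ P ∈ S, f ∈ P.ring}
      add_mem' := fun hf hg P hP => add_mem (hf P hP) (hg P hP)
      zero_mem' := fun P _ => P.ring.zero_mem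
      smul_mem' := fun a f hf P hP => by
        rw [Algebra.smul_def]
        exact mul_mem (P.algebraMap_mem a) (hf P hP) }
  have hcard : Fintype.card ι ≤ Module.finrank F⟮x⟯ K := by
    refine card_le_finrank_adjoin hx0 M (fun m hm P hP => mul_mem
      ((P.ord_nonneg_iff hx0).1 (hS P hP).le) (hm P hP)) (u := u) (fun i Q hQ => ?_) ?_
    · rw [← sub_add_cancel (u i) (if Q = i.1 then π i.1 ^ (i.2.1 : ℕ) * (s i.1 i.2.2 : K) else 0)]
      refine add_mem ?_ ?_
      · rw [← Q.valuation_le_one_iff]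
        refine (hu i Q hQ).trans ?_
        rwa [← WithZero.exp_zero, WithZero.exp_le_exp]
      · split_ifs with h
        · subst h
          exact mul_mem (pow_mem ((Place.ord_nonneg_iff _ (hπ0 _)).1 (by rw [hπ]; omega)) _)
            (s i.1 i.2.2).2
        · exact zero_mem _
    · rintro a ⟨m, hm, ham⟩
      suffices h : ∀ P : S, (fun kj => a ⟨P, kj⟩) = 0 by
        funext ⟨P, kj⟩
        exact congrFun (h P) kj
      intro P
      refine P.1.eq_zero_of_valuation_sum_le (s P) (hs P) (hπ0 P) (hπ P) _ _ ?_
      have h1 : ∑ kj, a ⟨P, kj⟩ • (π P ^ (kj.1 : ℕ) * (s P kj.2 : K)) =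
          ∑ i : ι, a i • (if (P : Place F K) = i.1 then
            π i.1 ^ (i.2.1 : ℕ) * (s i.1 i.2.2 : K) else 0) := by
        rw [Fintype.sum_sigma, Finset.sum_eq_single P]
        · simp
        · intro Q _ hQ
          refine Finset.sum_eq_zero fun kj _ => ?_
          rw [if_neg (fun h => hQ (Subtype.ext h.symm)), smul_zero]
        · simp
      have h2 : ∑ kj, a ⟨P, kj⟩ • (π P ^ (kj.1 : ℕ) * (s P kj.2 : K)) =
          x * m - ∑ i : ι, a i • (u i - if (P : Place F K) = i.1 then
            π i.1 ^ (i.2.1 : ℕ) * (s i.1 i.2.2 : K) else 0) := by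
        rw [h1, ← ham, ← Finset.sum_sub_distrib]
        refine Finset.sum_congr rfl fun i _ => ?_
        rw [← smul_sub, sub_sub_cancel]
      rw [h2]
      refine (Valuation.map_sub _ _ _).trans (max_le ?_ ?_)
      · rw [map_mul, hvx P P.2]
        exact mul_le_of_le_one_right zero_le ((P.1.valuation_le_one_iff).2 (hm P P.2))
      · refine Valuation.map_sum_le _ fun i _ => ?_
        rw [Algebra.smul_def, map_mul]
        refine (mul_le_of_le_one_left zero_le (P.1.valuation_algebraMap_le_one _)).trans ?_
        refine (hu i P P.2).trans ?_
        rw [WithZero.exp_le_exp]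
        exact hN P P.2
  have hcard' : Fintype.card ι = ∑ P ∈ S, e P * P.degree := by
    rw [Fintype.card_sigma, ← Finset.sum_coe_sort S (fun P => e P * P.degree)]
    simp
  rw [hcard'] at hcard
  calc ∑ P ∈ S, P.ord x * (P.degree : ℤ) = ((∑ P ∈ S, e P * P.degree : ℕ) : ℤ) := by
        push_cast
        exact Finset.sum_congr rfl fun P hP => by rw [he P hP]
    _ ≤ _ := by exact_mod_cast hcard

end Place

end

noncomputable section

open IntermediateField Polynomial

variable {F K : Type*} [Field F] [Field K] [Algebra F K]

/-! ### Degrees of divisors and the divisor of a function -/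

namespace Divisor

theorem degree_eq_sum (D : Divisor F K) : D.degree = D.sum fun P k => k * (P.degree : ℤ) := by
  rw [degree, Finsupp.liftAddHom_apply]
  rfl

@[simp] theorem degree_single (P : Place F K) (k : ℤ) :
    degree (Finsupp.single P k) = k * (P.degree : ℤ) := by
  rw [degree_eq_sum, Finsupp.sum_single_index (by simp)]

theorem degree_nonneg {D : Divisor F K} (hD : 0 ≤ D) : 0 ≤ D.degree := by
  rw [degree_eq_sum]
  exact Finset.sum_nonneg fun P _ => mul_nonneg (hD P) (by positivity)

theorem degree_mono {D E : Divisor F K} (h : D ≤ E) : D.degree ≤ E.degree := by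
  have := degree_nonneg (sub_nonneg.2 h)
  rw [map_sub] at this
  omega

theorem _root_.Place.finite_ord_pos (hK : IsFunctionFieldOneVar F K) {f : K}
    (hf : Transcendental F f) : {P : Place F K | 0 < P.ord f}.Finite := by
  by_contra hinf
  obtain ⟨S, hS, hcard⟩ := Set.Infinite.exists_subset_card_eq hinf (Module.finrank F⟮f⟯ K + 1)
  have h1 := Place.sum_ord_mul_degree_le hK hf S fun P hP => hS hP
  have h2 : ∑ P ∈ S, (1 : ℤ) ≤ ∑ P ∈ S, P.ord f * (P.degree : ℤ) := by
    refine Finset.sum_le_sum fun P hP => ?_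
    have h3 : 0 < P.ord f := hS hP
    have h4 := P.degree_pos hK
    nlinarith
  simp [hcard] at h2
  omega

theorem _root_.Transcendental.inv {f : K} (hf : Transcendental F f) : Transcendental F f⁻¹ :=
  fun h => hf (by simpa using h.inv)

theorem _root_.Place.finite_ord_ne_zero (hK : IsFunctionFieldOneVar F K) (f : K) :
    (Function.support fun P : Place F K => P.ord f).Finite := by
  by_cases hf : IsAlgebraic F f
  · convert Set.finite_empty
    ext P
    simp [P.ord_eq_zero_of_isAlgebraic hf]
  · refine ((Place.finite_ord_pos hK hf).union
      (Place.finite_ord_pos hK (Transcendental.inv hf))).subset fun P hP => ?_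
    simp only [Function.mem_support, Set.mem_union, Set.mem_ofPred_eq, Place.ord_inv] at hP ⊢
    omega

/-- The divisor of a function. -/
def ofFun (hK : IsFunctionFieldOneVar F K) (f : K) : Divisor F K :=
  Finsupp.ofSupportFinite (fun P => P.ord f) (Place.finite_ord_ne_zero hK f)

@[simp] theorem ofFun_apply (hK : IsFunctionFieldOneVar F K) (f : K) (P : Place F K) :
    ofFun hK f P = P.ord f := rfl

theorem ofFun_mul (hK : IsFunctionFieldOneVar F K) {f g : K} (hf : f ≠ 0) (hg : g ≠ 0) :
    ofFun hK (f * g) = ofFun hK f + ofFun hK g := by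
  ext P
  simp [P.ord_mul hf hg]

theorem ofFun_inv (hK : IsFunctionFieldOneVar F K) (f : K) : ofFun hK f⁻¹ = -ofFun hK f := by
  ext P
  simp [P.ord_inv]

theorem mem_principal_iff (hK : IsFunctionFieldOneVar F K) {D : Divisor F K} :
    D ∈ principal F K ↔ ∃ f : K, f ≠ 0 ∧ D = ofFun hK f := by
  constructor
  · rintro ⟨f, hf, h⟩
    exact ⟨f, hf, Finsupp.ext h⟩
  · rintro ⟨f, hf, rfl⟩
    exact ⟨f, hf, fun P => rfl⟩

/-! ### Riemann-Roch spaces -/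

theorem mem_rrSpace_iff {D : Divisor F K} {f : K} (hf : f ≠ 0) :
    f ∈ D.rrSpace ↔ ∀ P, -D P ≤ P.ord f :=
  forall_congr' fun P => P.valuation_le_exp_iff hf

theorem mem_rrSpace_iff_nonneg (hK : IsFunctionFieldOneVar F K) {D : Divisor F K} {f : K}
    (hf : f ≠ 0) : f ∈ D.rrSpace ↔ 0 ≤ D + ofFun hK f := by
  rw [mem_rrSpace_iff hf]
  refine forall_congr' fun P => ?_
  simp only [Finsupp.coe_zero, Pi.zero_apply, Finsupp.add_apply, ofFun_apply]
  omega

theorem rrSpace_mono {D E : Divisor F K} (h : D ≤ E) : D.rrSpace ≤ E.rrSpace :=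
  fun _ hf P => (hf P).trans (WithZero.exp_le_exp.2 (h P))

/-- The leading coefficient at `P` of an element of `L(D + P)`, with respect to an element `t`
whose order at `P` is `D P + 1`. -/
def leadingCoeffMap (D : Divisor F K) (P : Place F K) (t : K) (ht0 : t ≠ 0)
    (ht : P.ord t = D P + 1) :
    (D + Finsupp.single P 1).rrSpace →ₗ[F] IsLocalRing.ResidueField P.ring where
  toFun f := IsLocalRing.residue P.ring ⟨t * f, by
    rw [← P.valuation_le_one_iff, map_mul, P.valuation_eq_exp ht0, ht]
    refine (mul_le_mul_right (f.2 P) _).trans ?_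
    rw [← WithZero.exp_add, ← WithZero.exp_zero, WithZero.exp_le_exp]
    simp⟩
  map_add' f g := by
    rw [← map_add]
    congr 1
    apply Subtype.ext
    exact mul_add t f g
  map_smul' a f := by
    rw [RingHom.id_apply, Algebra.smul_def, IsScalarTower.algebraMap_apply F P.ring
      (IsLocalRing.ResidueField P.ring), IsLocalRing.ResidueField.algebraMap_eq]
    refine Eq.trans ?_ (map_mul (IsLocalRing.residue P.ring) _ _)
    congr 1
    apply Subtype.ext
    change t * (a • (f : K)) = algebraMap F K a * (t * f)
    rw [Algebra.smul_def]
    ring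

theorem ker_leadingCoeffMap (D : Divisor F K) (P : Place F K) (t : K) (ht0 : t ≠ 0)
    (ht : P.ord t = D P + 1) :
    LinearMap.ker (leadingCoeffMap D P t ht0 ht) =
      LinearMap.range (Submodule.inclusion (rrSpace_mono (D := D) (E := D + Finsupp.single P 1)
        (le_add_of_nonneg_right (by simp)))) := by
  classical
  ext f
  rw [LinearMap.mem_ker, LinearMap.mem_range]
  have h1 : leadingCoeffMap D P t ht0 ht f = 0 ↔ P.valuation (t * f) < 1 :=
    (P.valuation_lt_one_iff_residue _).symm
  have h2 : P.valuation (t * f) < 1 ↔ P.valuation (f : K) ≤ WithZero.exp (D P) := by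
    by_cases hf : (f : K) = 0
    · simp [hf]
    · rw [P.valuation_eq_exp (mul_ne_zero ht0 hf), ← WithZero.exp_zero, WithZero.exp_lt_exp,
        P.valuation_le_exp_iff hf, P.ord_mul ht0 hf, ht]
      omega
  rw [h1, h2]
  constructor
  · intro h
    refine ⟨⟨f, fun Q => ?_⟩, Subtype.ext rfl⟩
    by_cases hQ : Q = P
    · rw [hQ]
      exact h
    · refine (f.2 Q).trans_eq ?_
      rw [Finsupp.add_apply, Finsupp.single_eq_of_ne hQ, add_zero]
  · rintro ⟨g, rfl⟩
    exact g.2 P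

/-- The leading coefficient at P maps L(D + P) to the residue field, of dimension deg P, with kernel
L(D). -/
theorem finite_rrSpace_add_single (hK : IsFunctionFieldOneVar F K) (D : Divisor F K)
    (P : Place F K) [Module.Finite F D.rrSpace] :
    Module.Finite F (D + Finsupp.single P 1).rrSpace ∧
      Module.finrank F (D + Finsupp.single P 1).rrSpace ≤
        Module.finrank F D.rrSpace + P.degree := by
  obtain ⟨π, hπ0, hπ⟩ := P.exists_ord_eq_one
  have ht0 : π ^ (D P + 1) ≠ 0 := zpow_ne_zero _ hπ0
  have ht : P.ord (π ^ (D P + 1)) = D P + 1 := by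
    have : P.valuation (π ^ (D P + 1)) = WithZero.exp (-(D P + 1)) := by
      rw [map_zpow₀, P.valuation_eq_exp hπ0, hπ, ← WithZero.exp_zsmul]
      simp
    rw [Place.ord, this]
    simp
  set φ := leadingCoeffMap D P _ ht0 ht with hφ
  have hfin := P.finite_residueField hK
  have hker := ker_leadingCoeffMap D P _ ht0 ht
  rw [← hφ] at hker
  have hkfin : Module.Finite F (LinearMap.ker φ) := by
    rw [hker]
    infer_instance
  have htot : Module.Finite F (D + Finsupp.single P 1).rrSpace := by
    refine Module.finite_def.2 (Submodule.fg_of_fg_map_of_fg_inf_ker φ ?_ ?_)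
    · exact IsNoetherian.noetherian _
    · rw [top_inf_eq]
      exact Module.Finite.iff_fg.1 hkfin
  refine ⟨htot, ?_⟩
  have h1 := LinearMap.finrank_range_add_finrank_ker φ
  have h2 : Module.finrank F (LinearMap.ker φ) = Module.finrank F D.rrSpace := by
    rw [hker]
    exact LinearMap.finrank_range_of_inj (Submodule.inclusion_injective _)
  have h3 : Module.finrank F (LinearMap.range φ) ≤ P.degree := Submodule.finrank_le _
  omega

/-- The divisor with given natural number coefficients. -/
def ofNat : (Place F K →₀ ℕ) →+ Divisor F K :=
  Finsupp.mapRange.addMonoidHom (Nat.castAddMonoidHom ℤ)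

@[simp] theorem ofNat_apply (D : Place F K →₀ ℕ) (P : Place F K) : ofNat D P = D P := rfl

theorem exists_ofNat_eq {D : Divisor F K} (hD : 0 ≤ D) : ∃ E, ofNat E = D := by
  refine ⟨D.mapRange Int.toNat rfl, ?_⟩
  ext P
  simpa using hD P

theorem finite_rrSpace_add (hK : IsFunctionFieldOneVar F K) (E : Place F K →₀ ℕ) :
    ∀ D : Divisor F K, Module.Finite F D.rrSpace → Module.Finite F (D + ofNat E).rrSpace ∧
      (Module.finrank F (D + ofNat E).rrSpace : ℤ) ≤
        Module.finrank F D.rrSpace + (ofNat E).degree := by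
  induction E using Finsupp.induction_linear with
  | zero =>
    intro D hD
    rw [map_zero, add_zero, map_zero, add_zero]
    exact ⟨hD, le_rfl⟩
  | add f g hf hg =>
    intro D hD
    obtain ⟨h1, h2⟩ := hf D hD
    obtain ⟨h3, h4⟩ := hg _ h1
    rw [map_add, ← add_assoc]
    refine ⟨h3, ?_⟩
    rw [map_add]
    omega
  | single P n =>
    have hs : ∀ n : ℕ, ofNat (Finsupp.single P n) = Finsupp.single P (n : ℤ) := fun n =>
      Finsupp.mapRange_single (hf := map_zero _)
    induction n with
    | zero =>
      intro D hD
      rw [Finsupp.single_zero, map_zero, add_zero, map_zero, add_zero]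
      exact ⟨hD, le_rfl⟩
    | succ n ih =>
      intro D hD
      obtain ⟨h1, h2⟩ := ih D hD
      have h3 : D + ofNat (Finsupp.single P (n + 1)) =
          (D + ofNat (Finsupp.single P n)) + Finsupp.single P 1 := by
        rw [hs, hs, add_assoc, ← Finsupp.single_add]
        simp
      obtain ⟨h4, h5⟩ := finite_rrSpace_add_single hK (D + ofNat (Finsupp.single P n)) P
      rw [h3]
      refine ⟨h4, ?_⟩
      have hdeg : ∀ n : ℕ, (ofNat (Finsupp.single P n)).degree = n * (P.degree : ℤ) := fun n => by
        rw [hs, degree_single]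
      rw [hdeg] at h2 ⊢
      push_cast
      zify at h5
      linarith

theorem exists_place (hK : IsFunctionFieldOneVar F K) : Nonempty (Place F K) := by
  obtain ⟨x, hx, -⟩ := id hK
  exact ⟨(Place.exists_valuation_lt_one hK hx).choose⟩

theorem _root_.Place.exists_ord_neg (hK : IsFunctionFieldOneVar F K) {f : K}
    (hf : Transcendental F f) : ∃ P : Place F K, P.ord f < 0 := by
  obtain ⟨P, hP⟩ := Place.exists_valuation_lt_one hK (Transcendental.inv hf)
  refine ⟨P, ?_⟩
  have hf0 : f⁻¹ ≠ 0 := by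
    rintro h
    exact Transcendental.inv hf (h ▸ isAlgebraic_zero)
  rw [P.valuation_eq_exp hf0, ← WithZero.exp_zero, WithZero.exp_lt_exp, P.ord_inv] at hP
  omega

/-- A nonzero f in the space would vanish at P, hence be transcendental and have a pole somewhere,
which D ≤ 0 forbids. -/
theorem rrSpace_eq_bot_of_neg (hK : IsFunctionFieldOneVar F K) {D : Divisor F K} (hD : D ≤ 0)
    {P : Place F K} (hP : D P < 0) : D.rrSpace = ⊥ := by
  rw [eq_bot_iff]
  intro f hf
  by_contra hf0
  have hf0' : f ≠ 0 := hf0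
  rw [mem_rrSpace_iff hf0'] at hf
  have h1 := hf P
  obtain ⟨Q, hQ⟩ := Place.exists_ord_neg hK (P.transcendental_of_ord_ne_zero (f := f) (by omega))
  have h2 := hf Q
  have h3 : D Q ≤ 0 := hD Q
  omega

theorem finite_rrSpace (hK : IsFunctionFieldOneVar F K) (D : Divisor F K) :
    Module.Finite F D.rrSpace := by
  obtain ⟨P⟩ := exists_place hK
  -- Adding this effective divisor to -P, whose space is zero, leads to max(D, 0), whose space
  -- contains L(D).
  obtain ⟨E, hE⟩ := exists_ofNat_eq (D := Finsupp.single P 1 + D ⊔ 0)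
    (add_nonneg (by simp) le_sup_right)
  have h0 : (rrSpace (-Finsupp.single P 1) : Submodule F K) = ⊥ :=
    rrSpace_eq_bot_of_neg hK (by simp) (P := P) (by simp)
  have h1 : Module.Finite F (rrSpace (-Finsupp.single P 1) : Submodule F K) := by
    rw [h0]
    infer_instance
  have h2 := (finite_rrSpace_add hK E _ h1).1
  rw [hE, neg_add_cancel_left] at h2
  exact Submodule.finiteDimensional_of_le (rrSpace_mono (E := D ⊔ 0) le_sup_left)

theorem finrank_rrSpace_le_add (hK : IsFunctionFieldOneVar F K) {D E : Divisor F K} (h : D ≤ E) :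
    (Module.finrank F E.rrSpace : ℤ) ≤ Module.finrank F D.rrSpace + (E.degree - D.degree) := by
  obtain ⟨E', hE⟩ := exists_ofNat_eq (sub_nonneg.2 h)
  have := (finite_rrSpace_add hK E' D (finite_rrSpace hK D)).2
  rw [hE, map_sub] at this
  rwa [add_sub_cancel] at this

/-- The comparison starts from L(-P) = 0, which explains deg P in place of the sharper constant 1.
Only an error independent of D matters later. -/
theorem finrank_rrSpace_le_of_nonneg (hK : IsFunctionFieldOneVar F K) (P : Place F K)
    {D : Divisor F K} (hD : 0 ≤ D) :
    (Module.finrank F D.rrSpace : ℤ) ≤ D.degree + P.degree := by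
  have h0 : (rrSpace (-Finsupp.single P 1) : Submodule F K) = ⊥ :=
    rrSpace_eq_bot_of_neg hK (by simp) (P := P) (by simp)
  have h1 := finrank_rrSpace_le_add hK (D := -Finsupp.single P 1) (E := D)
    (le_trans (by simp) hD)
  rw [h0, finrank_bot, map_neg, degree_single] at h1
  push_cast at h1
  linarith

/-! ### The degree of a principal divisor -/

theorem degree_posPart_ofFun_le (hK : IsFunctionFieldOneVar F K) {x : K}
    (hx : Transcendental F x) : (ofFun hK x ⊔ 0).degree ≤ Module.finrank F⟮x⟯ K := by
  rw [degree_eq_sum]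
  have h1 : ∀ P ∈ (ofFun hK x ⊔ 0).support, 0 < P.ord x := by
    intro P hP
    rw [Finsupp.mem_support_iff, Finsupp.sup_apply, ofFun_apply] at hP
    simp only [Finsupp.coe_zero, Pi.zero_apply] at hP
    by_contra h
    exact hP (sup_eq_right.2 (not_lt.1 h))
  refine le_trans (le_of_eq ?_) (Place.sum_ord_mul_degree_le hK hx _ h1)
  refine Finset.sum_congr rfl fun P hP => ?_
  rw [Finsupp.sup_apply, ofFun_apply]
  simp only [Finsupp.coe_zero, Pi.zero_apply]
  rw [sup_eq_left.2 (h1 P hP).le]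

theorem _root_.Transcendental.linearIndependent_pow {A : Type*} [CommRing A] [Algebra F A] {x : A}
    (hx : Transcendental F x) : LinearIndependent F fun i : ℕ => x ^ i := by
  have h := (Polynomial.basisMonomials F).linearIndependent.map' (aeval x).toLinearMap
    (LinearMap.ker_eq_bot.2 (transcendental_iff_injective.1 hx))
  have h2 : (fun i : ℕ => x ^ i) = (aeval x).toLinearMap ∘ Polynomial.basisMonomials F := by
    ext i
    simp
  rw [h2]
  exact h

/-- If b is a basis of K over F(x), the products x^i b_j with i ≤ r are independent over F. Their
poles are bounded by r times the pole divisor of x plus a divisor C bounding the poles of all b_j.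
-/
theorem exists_mul_le_finrank (hK : IsFunctionFieldOneVar F K) {x : K} (hx : Transcendental F x) :
    ∃ C : Divisor F K, 0 ≤ C ∧ ∀ r : ℕ, Module.finrank F⟮x⟯ K * (r + 1) ≤
      Module.finrank F (r • (ofFun hK x⁻¹ ⊔ 0) + C).rrSpace := by
  have hfin := hK.finiteDimensional_adjoin hx
  have hx0 : x ≠ 0 := by
    rintro rfl
    exact hx isAlgebraic_zero
  set b := Module.finBasis F⟮x⟯ K with hb
  set C : Divisor F K := ∑ j, (ofFun hK (b j)⁻¹ ⊔ 0) with hC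
  have hCj : ∀ j, ofFun hK (b j)⁻¹ ⊔ 0 ≤ C := fun j =>
    Finset.single_le_sum (f := fun j => ofFun hK (b j)⁻¹ ⊔ 0) (fun i _ => le_sup_right)
      (Finset.mem_univ j)
  refine ⟨C, Finset.sum_nonneg fun j _ => le_sup_right, fun r => ?_⟩
  have hind : LinearIndependent F fun p : Fin (r + 1) × Fin (Module.finrank F⟮x⟯ K) =>
      x ^ (p.1 : ℕ) * b p.2 := by
    have hgen : Transcendental F (AdjoinSimple.gen F x) := by
      intro h
      apply hx
      have := h.algebraMap (A := K)
      simpa using this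
    have h1 : LinearIndependent F fun i : Fin (r + 1) => AdjoinSimple.gen F x ^ (i : ℕ) :=
      (Transcendental.linearIndependent_pow hgen).comp _ Fin.val_injective
    have h2 := linearIndependent_smul h1 b.linearIndependent
    convert h2 using 1
    ext p
    rw [Algebra.smul_def, map_pow, AdjoinSimple.algebraMap_gen]
  have hmem : ∀ p : Fin (r + 1) × Fin (Module.finrank F⟮x⟯ K),
      x ^ (p.1 : ℕ) * b p.2 ∈ (r • (ofFun hK x⁻¹ ⊔ 0) + C).rrSpace := by
    intro p
    have hbp := b.ne_zero p.2
    rw [mem_rrSpace_iff (mul_ne_zero (pow_ne_zero _ hx0) hbp)]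
    intro P
    rw [P.ord_mul (pow_ne_zero _ hx0) hbp, P.ord_pow]
    have h1 := hCj p.2 P
    simp only [Finsupp.sup_apply, ofFun_apply, Finsupp.coe_zero, Pi.zero_apply, P.ord_inv] at h1
    simp only [Finsupp.add_apply, Finsupp.smul_apply, Finsupp.sup_apply, ofFun_apply,
      Finsupp.coe_zero, Pi.zero_apply, P.ord_inv, nsmul_eq_mul]
    have h2 : -P.ord (b p.2) ≤ C P := le_trans le_sup_left h1
    have h3 : ((p.1 : ℕ) : ℤ) ≤ r := by have := p.1.2; omega
    have h4 : -P.ord x ≤ -P.ord x ⊔ 0 := le_sup_left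
    have h5 : (0 : ℤ) ≤ -P.ord x ⊔ 0 := le_sup_right
    have h6 : ((p.1 : ℕ) : ℤ) * (-P.ord x) ≤ r * (-P.ord x ⊔ 0) :=
      (mul_le_mul_of_nonneg_left h4 (by omega)).trans (mul_le_mul_of_nonneg_right h3 h5)
    linarith
  have hfinL := finite_rrSpace hK (r • (ofFun hK x⁻¹ ⊔ 0) + C)
  have hind' : LinearIndependent F fun p : Fin (r + 1) × Fin (Module.finrank F⟮x⟯ K) =>
      (⟨_, hmem p⟩ : (r • (ofFun hK x⁻¹ ⊔ 0) + C).rrSpace) :=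
    LinearIndependent.of_comp (Submodule.subtype _) hind
  have := hind'.fintype_card_le_finrank
  simpa [mul_comm] using this

theorem adjoin_inv_eq (x : K) : F⟮x⁻¹⟯ = F⟮x⟯ := by
  refine le_antisymm (adjoin_simple_le_iff.2 ?_) (adjoin_simple_le_iff.2 ?_)
  · exact inv_mem (mem_adjoin_simple_self F x)
  · simpa using inv_mem (mem_adjoin_simple_self F x⁻¹)

/-- One inequality is the bound on zeros, applied to x⁻¹. For the other, with B the pole divisor and
n = [K : F(x)], n (r + 1) ≤ dim L(rB + C) ≤ r deg B + deg C + deg P forces deg B ≥ n for large r. -/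
theorem degree_poles (hK : IsFunctionFieldOneVar F K) {x : K} (hx : Transcendental F x) :
    (ofFun hK x⁻¹ ⊔ 0).degree = Module.finrank F⟮x⟯ K := by
  refine le_antisymm ?_ ?_
  · have := degree_posPart_ofFun_le hK (Transcendental.inv hx)
    rwa [adjoin_inv_eq] at this
  · obtain ⟨C, hC, h⟩ := exists_mul_le_finrank hK hx
    obtain ⟨P⟩ := exists_place hK
    set B := ofFun hK x⁻¹ ⊔ 0 with hB
    set n := Module.finrank F⟮x⟯ K
    by_contra hlt
    rw [not_le] at hlt
    have hdC := degree_nonneg hC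
    have h1 := h (C.degree + P.degree).toNat
    set r := (C.degree + P.degree).toNat with hr
    have h2 := finrank_rrSpace_le_of_nonneg hK P (D := r • B + C)
      (add_nonneg (nsmul_nonneg le_sup_right _) hC)
    rw [map_add, map_nsmul, nsmul_eq_mul] at h2
    have h3 : (n : ℤ) * (r + 1) ≤ r * B.degree + C.degree + P.degree :=
      le_trans (by exact_mod_cast h1) h2
    have h4 : (r : ℤ) = C.degree + P.degree := Int.toNat_of_nonneg (by omega)
    have h5 : (r : ℤ) * B.degree ≤ r * (n - 1) := mul_le_mul_of_nonneg_left (by omega) (by omega)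
    have h6 : 0 ≤ B.degree := degree_nonneg le_sup_right
    nlinarith

/-- Zeros and poles of a transcendental f both have degree [K : F(f)], since F(f) = F(f⁻¹). -/
theorem degree_ofFun (hK : IsFunctionFieldOneVar F K) (f : K) : (ofFun hK f).degree = 0 := by
  by_cases hf : IsAlgebraic F f
  · have : ofFun hK f = 0 := by
      ext P
      simp [P.ord_eq_zero_of_isAlgebraic hf]
    rw [this, map_zero]
  · have h1 := degree_poles hK (x := f) hf
    have h2 := degree_poles hK (Transcendental.inv hf)
    rw [adjoin_inv_eq, inv_inv] at h2
    have h3 : ofFun hK f = (ofFun hK f ⊔ 0) - (ofFun hK f⁻¹ ⊔ 0) := by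
      ext P
      simp only [ofFun_apply, Finsupp.sub_apply, Finsupp.sup_apply, Finsupp.coe_zero,
        Pi.zero_apply, P.ord_inv]
      omega
    rw [h3, map_sub, h1, h2, sub_self]

theorem degree_nonneg_of_mem_rrSpace (hK : IsFunctionFieldOneVar F K) {D : Divisor F K} {f : K}
    (hf : f ≠ 0) (hfD : f ∈ D.rrSpace) : 0 ≤ D.degree := by
  rw [mem_rrSpace_iff_nonneg hK hf] at hfD
  have := degree_nonneg hfD
  rwa [map_add, degree_ofFun, add_zero] at this

theorem mul_mem_rrSpace_iff (hK : IsFunctionFieldOneVar F K) {D : Divisor F K} {z f : K}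
    (hz : z ≠ 0) : z * f ∈ (D - ofFun hK z).rrSpace ↔ f ∈ D.rrSpace := by
  by_cases hf : f = 0
  · simp [hf]
  rw [mem_rrSpace_iff_nonneg hK hf, mem_rrSpace_iff_nonneg hK (mul_ne_zero hz hf),
    ofFun_mul hK hz hf, ← add_assoc, sub_add_cancel]

theorem finrank_rrSpace_sub_ofFun (hK : IsFunctionFieldOneVar F K) (D : Divisor F K) {z : K}
    (hz : z ≠ 0) :
    Module.finrank F (D - ofFun hK z).rrSpace = Module.finrank F D.rrSpace := by
  refine (LinearEquiv.finrank_eq ?_).symm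
  have hmap : D.rrSpace.map (LinearMap.mulLeft F z) = (D - ofFun hK z).rrSpace := by
    ext g
    rw [Submodule.mem_map]
    constructor
    · rintro ⟨f, hf, rfl⟩
      exact (mul_mem_rrSpace_iff hK hz).2 hf
    · intro hg
      refine ⟨z⁻¹ * g, ?_, ?_⟩
      · rw [← mul_mem_rrSpace_iff hK hz, mul_inv_cancel_left₀ hz]
        exact hg
      · simp [hz]
  rw [← hmap]
  exact Submodule.equivMapOfInjective _ (mul_right_injective₀ hz) _

/-- Riemann's inequality. -/
theorem exists_degree_sub_finrank_le (hK : IsFunctionFieldOneVar F K) :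
    ∃ γ : ℤ, ∀ D : Divisor F K, D.degree - Module.finrank F D.rrSpace ≤ γ := by
  obtain ⟨x, hx, hfin⟩ := id hK
  obtain ⟨C, hC, h⟩ := exists_mul_le_finrank hK hx
  have hB := degree_poles hK hx
  have hB0 : (0 : Divisor F K) ≤ ofFun hK x⁻¹ ⊔ 0 := le_sup_right
  set B := ofFun hK x⁻¹ ⊔ 0
  have hn : 0 < Module.finrank F⟮x⟯ K := Module.finrank_pos
  set n := Module.finrank F⟮x⟯ K
  -- On multiples of B the bound holds with γ = deg C - n: dim L(rB + C) is at least n (r + 1), and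
  -- removing C costs at most deg C.
  have h1 : ∀ r : ℕ, (r • B).degree - Module.finrank F (r • B).rrSpace ≤ C.degree - n := by
    intro r
    have h2 := finrank_rrSpace_le_add hK (D := r • B) (E := r • B + C)
      (le_add_of_nonneg_right hC)
    rw [map_add] at h2
    have h3 : (n : ℤ) * (r + 1) ≤ Module.finrank F (r • B + C).rrSpace := by exact_mod_cast h r
    have h4 : (r • B).degree = r * n := by rw [map_nsmul, hB, nsmul_eq_mul]
    linarith
  refine ⟨C.degree - n, fun A => ?_⟩
  set A₁ := A ⊔ 0 with hA₁
  have h2 := finrank_rrSpace_le_add hK (D := A) (E := A₁) le_sup_left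
  suffices h : A₁.degree - Module.finrank F A₁.rrSpace ≤ C.degree - n by linarith
  have hA₁0 : 0 ≤ A₁ := le_sup_right
  have hdA := degree_nonneg hA₁0
  set r := (C.degree + A₁.degree).toNat with hr
  have hr' : (r : ℤ) = C.degree + A₁.degree :=
    Int.toNat_of_nonneg (add_nonneg (degree_nonneg hC) hdA)
  have h3 := finrank_rrSpace_le_add hK (D := r • B - A₁) (E := r • B) (sub_le_self _ hA₁0)
  -- The choice of r makes L(rB - A₁) nonzero. A nonzero z in it gives A₁ - div z ≤ rB, and deg -
  -- dim is monotone in the divisor and invariant under linear equivalence.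
  have h4 : 0 < Module.finrank F (r • B - A₁).rrSpace := by
    have h5 := h1 r
    have h6 : (r • B).degree = r * n := by rw [map_nsmul, hB, nsmul_eq_mul]
    rw [map_sub] at h3
    have h7 : (r : ℤ) ≤ r * n := le_mul_of_one_le_right (by omega) (by omega)
    zify
    linarith
  have := finite_rrSpace hK (r • B - A₁)
  have h5 : (r • B - A₁).rrSpace ≠ ⊥ := by
    intro h
    rw [h, finrank_bot] at h4
    omega
  obtain ⟨z, hz, hz0⟩ := Submodule.exists_mem_ne_zero_of_ne_bot h5
  rw [mem_rrSpace_iff_nonneg hK hz0] at hz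
  have h6 : A₁ - ofFun hK z ≤ r • B := by
    rw [← sub_nonneg]
    convert hz using 1
    abel
  have h7 := finrank_rrSpace_le_add hK h6
  rw [finrank_rrSpace_sub_ofFun hK _ hz0, map_sub, degree_ofFun] at h7
  have := h1 r
  linarith

end Divisor

end

noncomputable section

open IntermediateField Polynomial

variable {F K : Type*} [Field F] [Field K] [Algebra F K]

/-! ### Finiteness over a finite constant field -/

theorem Polynomial.finite_natDegree_le [Finite F] (d : ℕ) :
    {p : F[X] | p.natDegree ≤ d}.Finite := by
  have : Finite (degreeLT F (d + 1)) := Finite.of_equiv _ (degreeLTEquiv F (d + 1)).toEquiv.symm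
  refine (Set.toFinite (degreeLT F (d + 1) : Set F[X])).subset fun p hp => ?_
  rw [SetLike.mem_coe, mem_degreeLT]
  exact degree_le_natDegree.trans_lt (by exact_mod_cast Nat.lt_succ_of_le hp)

namespace Place

/-- Either P is a zero or pole of x, or the residue y of x at P is algebraic of degree at most d and
P is a zero of the minimal polynomial of y evaluated at x. Over a finite field there are finitely
many such polynomials. -/
theorem finite_degree_le [Finite F] (hK : IsFunctionFieldOneVar F K) (d : ℕ) :
    {P : Place F K | P.degree ≤ d}.Finite := by
  obtain ⟨x, hx, -⟩ := id hK
  have hx0 : x ≠ 0 := by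
    rintro rfl
    exact hx isAlgebraic_zero
  refine ((finite_ord_ne_zero hK x).union ((Polynomial.finite_natDegree_le (F := F) d).biUnion
    fun p _ => finite_ord_ne_zero hK (aeval x p))).subset fun P hP => ?_
  by_cases hxP : P.ord x = 0
  · right
    have hmem : x ∈ P.ring := (P.ord_nonneg_iff hx0).1 hxP.ge
    have := P.finite_residueField hK
    set y := IsLocalRing.residue P.ring ⟨x, hmem⟩ with hy
    have hint : IsIntegral F y := IsIntegral.of_finite F y
    refine Set.mem_biUnion (x := minpoly F y) ((minpoly.natDegree_le y).trans hP) ?_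
    have h1 : P.valuation (aeval x (minpoly F y)) < 1 := by
      have h2 : (aeval x (minpoly F y) : K) =
          ((aeval (⟨x, hmem⟩ : P.ring) (minpoly F y) : P.ring) : K) :=
        aeval_algebraMap_apply K (⟨x, hmem⟩ : P.ring) (minpoly F y)
      rw [h2, P.valuation_lt_one_iff_residue]
      have h3 := aeval_algebraMap_apply (IsLocalRing.ResidueField P.ring) (⟨x, hmem⟩ : P.ring)
        (minpoly F y)
      rw [IsLocalRing.ResidueField.algebraMap_eq] at h3
      rw [← h3, ← hy, minpoly.aeval]
    have h0 : aeval x (minpoly F y) ≠ 0 := fun h => hx ⟨_, minpoly.ne_zero hint, h⟩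
    rw [P.valuation_eq_exp h0, ← WithZero.exp_zero, WithZero.exp_lt_exp] at h1
    simp only [Function.mem_support]
    omega
  · exact Or.inl hxP

end Place

namespace Divisor

theorem single_le_of_nonneg {D : Divisor F K} (hD : 0 ≤ D) (P : Place F K) :
    Finsupp.single P (D P) ≤ D := by
  classical
  intro Q
  by_cases h : Q = P
  · simp [h]
  · rw [Finsupp.single_eq_of_ne h]
    exact hD Q

theorem finite_degree_le [Finite F] (hK : IsFunctionFieldOneVar F K) (m : ℕ) :
    {D : Divisor F K | 0 ≤ D ∧ D.degree ≤ m}.Finite := by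
  refine (Finset.finite_toSet ((Place.finite_degree_le hK m).toFinset.finsupp
    fun _ => Finset.Icc (0 : ℤ) m)).subset fun D hD => ?_
  have key : ∀ P : Place F K, D P * P.degree ≤ m := fun P => by
    rw [← degree_single]
    exact (degree_mono (single_le_of_nonneg hD.1 P)).trans hD.2
  have hdeg : ∀ P : Place F K, 1 ≤ (P.degree : ℤ) := fun P => by
    have := P.degree_pos hK
    omega
  rw [Finset.mem_coe, Finset.mem_finsupp_iff]
  refine ⟨fun P hP => ?_, fun P _ => ?_⟩
  · rw [Set.Finite.mem_toFinset]
    rw [Finsupp.mem_support_iff] at hP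
    have h1 : 0 ≤ D P := hD.1 P
    have h2 : 1 ≤ D P := by omega
    have h3 := key P
    have : (P.degree : ℤ) ≤ m := by nlinarith [hdeg P]
    change P.degree ≤ m
    exact_mod_cast this
  · have h1 : 0 ≤ D P := hD.1 P
    rw [Finset.mem_Icc]
    exact ⟨h1, by nlinarith [hdeg P, key P]⟩

variable (F K) in
/-- The effective divisors of degree `m`. -/
def effective (m : ℕ) : Set (Divisor F K) := {D | 0 ≤ D ∧ D.degree = m}

theorem finite_effective [Finite F] (hK : IsFunctionFieldOneVar F K) (m : ℕ) :
    (effective F K m).Finite :=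
  (finite_degree_le hK m).subset fun _ hD => ⟨hD.1, hD.2.le⟩

/-- By Riemann's inequality, shifting by a divisor D₀ of large degree gives every class an effective
representative, and effective divisors of fixed degree are finite in number. -/
theorem finite_Pic0 [Finite F] (hK : IsFunctionFieldOneVar F K) : Finite (Pic0 F K) := by
  obtain ⟨γ, hγ⟩ := exists_degree_sub_finrank_le hK
  obtain ⟨P⟩ := exists_place hK
  have hP := P.degree_pos hK
  set k := (γ + 1).toNat with hk
  set D₀ : Divisor F K := Finsupp.single P (k : ℤ) with hD₀
  have hdeg : D₀.degree = ((k * P.degree : ℕ) : ℤ) := by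
    rw [hD₀, degree_single]
    push_cast
    ring
  have hfin : Finite (effective F K (k * P.degree)) := finite_effective hK _
  let φ : effective F K (k * P.degree) → Pic0 F K := fun E =>
    QuotientAddGroup.mk ⟨E.1 - D₀, by
      rw [AddMonoidHom.mem_ker, map_sub, E.2.2, hdeg, sub_self]⟩
  refine Finite.of_surjective φ fun c => ?_
  obtain ⟨⟨D, hD⟩, rfl⟩ := QuotientAddGroup.mk_surjective c
  rw [AddMonoidHom.mem_ker] at hD
  have h1 := hγ (D + D₀)
  rw [map_add, hD, hdeg, zero_add] at h1
  have h2 : γ + 1 ≤ ((k * P.degree : ℕ) : ℤ) := by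
    have : k ≤ k * P.degree := Nat.le_mul_of_pos_right _ hP
    have := Int.self_le_toNat (γ + 1)
    omega
  have h3 : (D + D₀).rrSpace ≠ ⊥ := by
    intro h
    rw [h, finrank_bot] at h1
    push_cast at h1 h2
    omega
  obtain ⟨f, hf, hf0⟩ := Submodule.exists_mem_ne_zero_of_ne_bot h3
  rw [mem_rrSpace_iff_nonneg hK hf0] at hf
  refine ⟨⟨D + D₀ + ofFun hK f, hf, ?_⟩, ?_⟩
  · rw [map_add, map_add, hD, degree_ofFun, zero_add, add_zero, hdeg]
  · refine QuotientAddGroup.eq.2 ?_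
    rw [AddSubgroup.mem_addSubgroupOf, mem_principal_iff hK]
    refine ⟨f⁻¹, inv_ne_zero hf0, ?_⟩
    rw [ofFun_inv]
    simp only [AddSubgroup.coe_add, AddSubgroup.coe_neg]
    abel

/-! ### Counting effective divisors -/

theorem card_rrSpace [Finite F] (hK : IsFunctionFieldOneVar F K) (D : Divisor F K) :
    Nat.card D.rrSpace = Nat.card F ^ Module.finrank F D.rrSpace := by
  have := finite_rrSpace hK D
  exact Module.natCard_eq_pow_finrank

theorem finite_rrSpace_set [Finite F] (hK : IsFunctionFieldOneVar F K) (D : Divisor F K) :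
    Finite D.rrSpace := by
  have := finite_rrSpace hK D
  exact Module.finite_of_finite F

/-- There are `O(q ^ m)` effective divisors of degree `m`. -/
theorem exists_ncard_effective_le [Finite F] (hK : IsFunctionFieldOneVar F K) :
    ∃ C : ℕ, ∀ m : ℕ, (effective F K m).ncard ≤ C * Nat.card F ^ m := by
  classical
  have := finite_Pic0 hK
  have := Fintype.ofFinite (Pic0 F K)
  obtain ⟨P⟩ := exists_place hK
  refine ⟨Nat.card F ^ P.degree * Fintype.card (Pic0 F K), fun m => ?_⟩
  have hfin := finite_effective hK m
  rcases Set.eq_empty_or_nonempty (effective F K m) with h | ⟨D₀, hD₀⟩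
  · rw [h, Set.ncard_empty]
    exact Nat.zero_le _
  -- The value 0 outside degree m is a default and is never used on the set being counted.
  let φ : Divisor F K → Pic0 F K := fun E => if h : E.degree = m then
    QuotientAddGroup.mk ⟨E - D₀, by rw [AddMonoidHom.mem_ker, map_sub, h, hD₀.2, sub_self]⟩ else 0
  rw [Set.ncard_eq_toFinset_card _ hfin]
  have h1 := Finset.card_le_mul_card_image_of_maps_to (f := φ) (s := hfin.toFinset)
    (t := Finset.univ) (fun _ _ => Finset.mem_univ _) (Nat.card F ^ (m + P.degree)) ?_
  · refine h1.trans (le_of_eq ?_)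
    rw [Finset.card_univ, pow_add]
    ring
  · intro c _
    rcases Finset.eq_empty_or_nonempty {E ∈ hfin.toFinset | φ E = c} with h | ⟨D₁, hD₁⟩
    · rw [h]
      simp
    simp only [Finset.mem_filter, Set.Finite.mem_toFinset] at hD₁
    -- Effective divisors in the class of D₁ are D₁ + div f with f in L(D₁), so each fibre has at
    -- most |L(D₁)| elements.
    have hex : ∀ E ∈ ({E ∈ hfin.toFinset | φ E = c} : Finset _),
        ∃ f : K, f ≠ 0 ∧ E = D₁ + ofFun hK f := by
      intro E hE
      simp only [Finset.mem_filter, Set.Finite.mem_toFinset] at hE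
      have h2 : φ D₁ = φ E := hD₁.2.trans hE.2.symm
      simp only [φ, dif_pos hD₁.1.2, dif_pos hE.1.2] at h2
      have h3 := QuotientAddGroup.eq.1 h2
      rw [AddSubgroup.mem_addSubgroupOf, mem_principal_iff hK] at h3
      obtain ⟨f, hf, h4⟩ := h3
      refine ⟨f, hf, ?_⟩
      rw [← h4]
      simp only [AddSubgroup.coe_add, AddSubgroup.coe_neg]
      abel
    choose! f hf0 hf using hex
    have hfinL := finite_rrSpace_set hK D₁
    have hcard : Nat.card D₁.rrSpace ≤ Nat.card F ^ (m + P.degree) := by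
      rw [card_rrSpace hK]
      refine Nat.pow_le_pow_right Nat.card_pos ?_
      have := finrank_rrSpace_le_of_nonneg hK P hD₁.1.1
      rw [hD₁.1.2] at this
      exact_mod_cast this
    refine le_trans ?_ hcard
    rw [← Nat.card_eq_finsetCard]
    refine Nat.card_le_card_of_injective (fun E => (⟨f E.1, ?_⟩ : D₁.rrSpace)) ?_
    · rw [mem_rrSpace_iff_nonneg hK (hf0 _ E.2), ← hf _ E.2]
      have := E.2
      simp only [Finset.mem_filter, Set.Finite.mem_toFinset] at this
      exact this.1.1
    · intro E E' h
      have h2 : f E.1 = f E'.1 := congrArg Subtype.val h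
      apply Subtype.ext
      rw [hf _ E.2, hf _ E'.2, h2]

/-- In a degree where there are divisors, there are at least `c q ^ m` effective ones. -/
theorem exists_le_ncard_effective [Finite F] (hK : IsFunctionFieldOneVar F K) :
    ∃ C k m₀ : ℕ, ∀ m ≥ m₀, (∃ D : Divisor F K, D.degree = m) →
      Nat.card F ^ m ≤ Nat.card F ^ k * (C * (effective F K m).ncard) := by
  classical
  obtain ⟨γ, hγ⟩ := exists_degree_sub_finrank_le hK
  have hfin0 := finite_rrSpace_set hK (0 : Divisor F K)
  -- Two functions with the same divisor differ by a factor in L(0), so |L(0)| bounds the fibres of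
  -- f ↦ D + div f. The extra 1 accounts for f = 0.
  refine ⟨Nat.card (rrSpace (0 : Divisor F K)) + 1, γ.toNat, γ.toNat + 1, ?_⟩
  rintro m hm ⟨D, hD⟩
  have hfin := finite_effective hK m
  have hfinL := finite_rrSpace_set hK D
  have h1 := hγ D
  rw [hD] at h1
  have h2 : m ≤ γ.toNat + Module.finrank F D.rrSpace := by omega
  have h2' : 1 ≤ Module.finrank F D.rrSpace := by omega
  have h3 : Nat.card F ^ m ≤ Nat.card F ^ γ.toNat * Nat.card D.rrSpace := by
    rw [card_rrSpace hK, ← pow_add]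
    exact Nat.pow_le_pow_right Nat.card_pos h2
  refine h3.trans (Nat.mul_le_mul_left _ ?_)
  have := Fintype.ofFinite D.rrSpace
  let s : Finset D.rrSpace := {f | f ≠ 0}
  have hs : Nat.card D.rrSpace = s.card + 1 := by
    rw [Nat.card_eq_fintype_card, ← Finset.card_univ,
      ← Finset.card_filter_add_card_filter_not (s := Finset.univ) (fun f : D.rrSpace => f ≠ 0)]
    congr 1
    rw [Finset.card_eq_one]
    refine ⟨0, ?_⟩
    ext f
    simp
  have hmaps : ∀ f ∈ s, D + ofFun hK (f : K) ∈ hfin.toFinset := by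
    intro f hf
    have hf0 : (f : K) ≠ 0 := by simpa [s] using hf
    rw [Set.Finite.mem_toFinset]
    refine ⟨(mem_rrSpace_iff_nonneg hK hf0).1 f.2, ?_⟩
    rw [map_add, degree_ofFun, add_zero, hD]
  have h4 := Finset.card_le_mul_card_image_of_maps_to hmaps
    (Nat.card (rrSpace (0 : Divisor F K))) ?_
  · have h5 : 1 ≤ (effective F K m).ncard := by
      rw [Nat.one_le_iff_ne_zero, Ne, Set.ncard_eq_zero hfin]
      have h6 : D.rrSpace ≠ ⊥ := by
        intro h
        rw [h, finrank_bot] at h2'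
        omega
      obtain ⟨f, hf, hf0⟩ := Submodule.exists_mem_ne_zero_of_ne_bot h6
      have := hmaps ⟨f, hf⟩ (by simpa [s] using hf0)
      rw [Set.Finite.mem_toFinset] at this
      exact Set.Nonempty.ne_empty ⟨_, this⟩
    rw [← Set.ncard_eq_toFinset_card _ hfin] at h4
    rw [hs]
    nlinarith
  · intro E _
    set t : Finset D.rrSpace := s.filter fun f => D + ofFun hK (f : K) = E with ht
    rcases Finset.eq_empty_or_nonempty t with h | ⟨f₀, hf₀⟩
    · rw [h]
      simp
    have hprop : ∀ f ∈ t, (f : K) ≠ 0 ∧ D + ofFun hK (f : K) = E := by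
      intro f hf
      simpa [t, s] using hf
    obtain ⟨hf₀0, hf₀E⟩ := hprop f₀ hf₀
    rw [← Nat.card_eq_finsetCard]
    refine Nat.card_le_card_of_injective
      (fun f => (⟨(f.1 : K) * (f₀ : K)⁻¹, ?_⟩ : rrSpace (0 : Divisor F K))) ?_
    · obtain ⟨hf0, hfE⟩ := hprop f.1 f.2
      rw [mem_rrSpace_iff_nonneg hK (mul_ne_zero hf0 (inv_ne_zero hf₀0)),
        ofFun_mul hK hf0 (inv_ne_zero hf₀0), ofFun_inv]
      rw [add_left_cancel (hfE.trans hf₀E.symm)]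
      simp
    · intro f g h
      have h2 : (f.1 : K) * (f₀ : K)⁻¹ = (g.1 : K) * (f₀ : K)⁻¹ := congrArg Subtype.val h
      exact Subtype.ext (Subtype.ext (mul_right_cancel₀ (inv_ne_zero hf₀0) h2))

/-! ### The genus -/

theorem bddAbove_genus (hK : IsFunctionFieldOneVar F K) :
    BddAbove (Set.range fun D : Divisor F K =>
      D.degree + 1 - (Module.finrank F D.rrSpace : ℤ)) := by
  obtain ⟨γ, hγ⟩ := exists_degree_sub_finrank_le hK
  refine ⟨γ + 1, ?_⟩
  rintro _ ⟨D, rfl⟩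
  have := hγ D
  change D.degree + 1 - (Module.finrank F D.rrSpace : ℤ) ≤ γ + 1
  omega

theorem degree_add_one_sub_genus_le (hK : IsFunctionFieldOneVar F K) (D : Divisor F K) :
    D.degree + 1 - genus F K ≤ Module.finrank F D.rrSpace := by
  have := le_csSup (bddAbove_genus hK) ⟨D, rfl⟩
  change D.degree + 1 - (Module.finrank F D.rrSpace : ℤ) ≤ genus F K at this
  omega

/-- Riemann's theorem. -/
theorem exists_finrank_eq (hK : IsFunctionFieldOneVar F K) :
    ∃ N : ℤ, ∀ D : Divisor F K, N ≤ D.degree →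
      (Module.finrank F D.rrSpace : ℤ) = D.degree + 1 - genus F K := by
  -- Boundedness makes the supremum defining the genus a maximum, attained at some D₀.
  obtain ⟨D₀, hD₀⟩ := Int.csSup_mem (Set.range_nonempty _) (bddAbove_genus hK)
  change D₀.degree + 1 - (Module.finrank F D₀.rrSpace : ℤ) = genus F K at hD₀
  -- In this range L(D - D₀) contains some z ≠ 0, so D + div z ≥ D₀. As deg - dim is monotone, D
  -- attains the maximum as well.
  refine ⟨D₀.degree + genus F K, fun D hD => le_antisymm ?_ (degree_add_one_sub_genus_le hK D)⟩
  have h1 := degree_add_one_sub_genus_le hK (D - D₀)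
  rw [map_sub] at h1
  have h2 : (D - D₀).rrSpace ≠ ⊥ := by
    intro h
    rw [h, finrank_bot] at h1
    push_cast at h1
    omega
  obtain ⟨z, hz, hz0⟩ := Submodule.exists_mem_ne_zero_of_ne_bot h2
  rw [mem_rrSpace_iff_nonneg hK hz0] at hz
  have h3 : D₀ ≤ D - ofFun hK z⁻¹ := by
    rw [ofFun_inv, ← sub_nonneg]
    convert hz using 1
    abel
  have h4 := finrank_rrSpace_le_add hK h3
  rw [finrank_rrSpace_sub_ofFun hK _ (inv_ne_zero hz0), map_sub, degree_ofFun] at h4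
  omega

end Divisor

end

noncomputable section

open IntermediateField Polynomial

/-! ### Constant field extensions -/

/-- The image of k already supplies all |k| roots that X^|k| - X can have. -/
theorem FiniteField.mem_range_of_pow_card_eq {k L : Type*} [Field k] [Finite k] [Field L]
    (ψ : k →+* L) {y : L} (hy : y ^ Nat.card k = y) : y ∈ ψ.range := by
  classical
  have := Fintype.ofFinite k
  by_contra hne
  have hq : 1 < Nat.card k := Finite.one_lt_card
  have hdeg := FiniteField.X_pow_card_sub_X_natDegree_eq L hq
  have hp0 := FiniteField.X_pow_card_sub_X_ne_zero L hq
  have hsub : (insert y (Finset.univ.image ψ)).val ⊆ (X ^ Nat.card k - X : L[X]).roots := by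
    intro z hz
    rw [Finset.mem_val, Finset.mem_insert, Finset.mem_image] at hz
    rw [mem_roots hp0, IsRoot, eval_sub, eval_pow, eval_X, sub_eq_zero]
    rcases hz with rfl | ⟨a, -, rfl⟩
    · exact hy
    · rw [← map_pow, Nat.card_eq_fintype_card, FiniteField.pow_card]
  have h1 := Polynomial.card_le_degree_of_subset_roots hsub
  rw [hdeg, Finset.card_insert_of_notMem, Finset.card_image_of_injective _ ψ.injective,
    Finset.card_univ, Nat.card_eq_fintype_card] at h1
  · omega
  · intro h
    obtain ⟨a, -, ha⟩ := Finset.mem_image.1 h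
    exact hne ⟨a, ha⟩

/-! ### Places lying over one another -/

section LiesOver

variable {F K F' K' : Type*} [Field F] [Field K] [Algebra F K] [Field F'] [Field K']
  [Algebra F' K'] [Algebra K K']

theorem Place.valuation_lt_one_iff_inv_notMem (P : Place F K) {x : K} (hx : x ≠ 0) :
    P.valuation x < 1 ↔ x⁻¹ ∉ P.ring := by
  rw [← P.valuation_le_one_iff, not_le, map_inv₀, one_lt_inv₀ ((Valuation.pos_iff _).2 hx)]

theorem Place.card_residueField (hK : IsFunctionFieldOneVar F K) (P : Place F K) :
    Nat.card (IsLocalRing.ResidueField P.ring) = Nat.card F ^ P.degree := by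
  have := P.finite_residueField hK
  exact Module.natCard_eq_pow_finrank

/-- A place of `K'` lies over a place of `K`. -/
def Place.LiesOver (V : Place F' K') (P : Place F K) : Prop :=
  ∀ x : K, algebraMap K K' x ∈ V.ring ↔ x ∈ P.ring

theorem Place.LiesOver.eq {V : Place F' K'} {P Q : Place F K} (hP : V.LiesOver P)
    (hQ : V.LiesOver Q) : P = Q :=
  Place.ext_ring (SetLike.ext fun x => (hP x).symm.trans (hQ x))

theorem Place.LiesOver.valuation_lt_one_iff {V : Place F' K'} {P : Place F K} (h : V.LiesOver P)
    (x : K) : V.valuation (algebraMap K K' x) < 1 ↔ P.valuation x < 1 := by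
  by_cases hx : x = 0
  · simp [hx]
  rw [P.valuation_lt_one_iff_inv_notMem hx,
    V.valuation_lt_one_iff_inv_notMem ((_root_.map_ne_zero _).2 hx), ← map_inv₀, h x⁻¹]

/-- The inclusion of valuation rings. -/
def Place.LiesOver.ringHom {V : Place F' K'} {P : Place F K} (h : V.LiesOver P) :
    P.ring →+* V.ring where
  toFun x := ⟨algebraMap K K' x, (h x).2 x.2⟩
  map_one' := Subtype.ext (map_one _)
  map_mul' _ _ := Subtype.ext (map_mul _ _ _)
  map_zero' := Subtype.ext (map_zero _)
  map_add' _ _ := Subtype.ext (map_add _ _ _)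

/-- The reduction of the inclusion of valuation rings. -/
def Place.LiesOver.toResidue {V : Place F' K'} {P : Place F K} (h : V.LiesOver P) :
    P.ring →+* IsLocalRing.ResidueField V.ring :=
  (IsLocalRing.residue V.ring).comp h.ringHom

theorem Place.LiesOver.ker_toResidue {V : Place F' K'} {P : Place F K} (h : V.LiesOver P) :
    RingHom.ker h.toResidue = IsLocalRing.maximalIdeal P.ring := by
  ext x
  rw [RingHom.mem_ker, ← IsLocalRing.residue_eq_zero_iff, ← P.valuation_lt_one_iff_residue,
    ← h.valuation_lt_one_iff]
  exact (V.valuation_lt_one_iff_residue (h.ringHom x)).symm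

end LiesOver

theorem Finsupp.mapDomain_add_injective {α β M : Type*} [AddCommGroup M] {φ ψ : α → β}
    (hφ : Function.Injective φ) (hψ : Function.Injective ψ) (hne : ∀ a b, φ a ≠ ψ b) :
    Function.Injective fun p : (α →₀ M) × (α →₀ M) =>
      Finsupp.mapDomain φ p.1 + Finsupp.mapDomain ψ p.2 := by
  rintro ⟨a, b⟩ ⟨a', b'⟩ h
  refine Prod.ext (Finsupp.ext fun x => ?_) (Finsupp.ext fun x => ?_)
  · have := DFunLike.congr_fun h (φ x)
    simp only [Finsupp.add_apply, Finsupp.mapDomain_apply hφ] at this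
    rwa [Finsupp.mapDomain_of_notMem_range _ _ (by rintro ⟨y, hy⟩; exact hne x y hy.symm),
      Finsupp.mapDomain_of_notMem_range _ _ (by rintro ⟨y, hy⟩; exact hne x y hy.symm),
      add_zero, add_zero] at this
  · have := DFunLike.congr_fun h (ψ x)
    simp only [Finsupp.add_apply, Finsupp.mapDomain_apply hψ] at this
    rwa [Finsupp.mapDomain_of_notMem_range _ _ (by rintro ⟨y, hy⟩; exact hne y x hy),
      Finsupp.mapDomain_of_notMem_range _ _ (by rintro ⟨y, hy⟩; exact hne y x hy),
      zero_add, zero_add] at this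

theorem Divisor.degree_mapDomain {F K F' K' : Type*} [Field F] [Field K] [Algebra F K] [Field F']
    [Field K'] [Algebra F' K'] (φ : Place F K → Place F' K') (d : ℕ)
    (hφ : ∀ P, d * (φ P).degree = P.degree) (D : Divisor F K) :
    (d : ℤ) * Divisor.degree (Finsupp.mapDomain φ D : Divisor F' K') = D.degree := by
  rw [Divisor.degree_eq_sum, Divisor.degree_eq_sum, Finsupp.sum_mapDomain_index (by simp)
    (by intros; ring), Finsupp.mul_sum]
  refine Finsupp.sum_congr fun P _ => ?_
  rw [← hφ P]
  push_cast
  ring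

set_option linter.unusedSectionVars false

/-! ### Places in constant field extensions -/

section ConstantExtension

variable {F K F' K' : Type*} [Field F] [Field K] [Algebra F K] [Field F'] [Field K']
  [Algebra F F'] [Algebra F' K'] [Algebra K K'] [Algebra F K'] [IsScalarTower F K K']
  [IsScalarTower F F' K']

/-- The valuation ring `V` of `K'` gives a place over `P` if it restricts to the ring of `P`. -/
theorem Place.exists_eq_of_restrict [Algebra.IsAlgebraic F F'] (hK' : IsFunctionFieldOneVar F' K')
    (P : Place F K) (V : ValuationSubring K')
    (hV : ∀ x : K, algebraMap K K' x ∈ V ↔ x ∈ P.ring) :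
    ∃ W : Place F' K', W.ring = V ∧ W.LiesOver P := by
  have hF : ∀ a : F, algebraMap F K' a ∈ V := fun a => by
    rw [IsScalarTower.algebraMap_apply F K K', hV]
    exact P.algebraMap_mem a
  have hF' : ∀ a : F', algebraMap F' K' a ∈ V := fun a =>
    V.mem_of_isAlgebraic hF ((Algebra.IsAlgebraic.isAlgebraic (R := F) a).algebraMap)
  have hdvr : IsDiscreteValuationRing V := by
    refine V.isDiscreteValuationRing hK' hF' ?_
    rintro rfl
    obtain ⟨π, h0, hπ⟩ := P.exists_ord_eq_one
    have h1 := (P.ord_nonneg_iff (inv_ne_zero h0)).2 ((hV π⁻¹).1 trivial)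
    rw [P.ord_inv] at h1
    omega
  exact ⟨⟨V, hF', hdvr⟩, rfl, hV⟩

/-- Chevalley's theorem, applied to the image of the ring of P, gives V in which a uniformizer π is
a nonunit. If x in V came from outside the ring of P, then x⁻¹ π⁻¹ would lie in that ring and π⁻¹
would be in V. -/
theorem Place.exists_liesOver [Algebra.IsAlgebraic F F'] (hK' : IsFunctionFieldOneVar F' K')
    (P : Place F K) : ∃ V : Place F' K', V.LiesOver P := by
  obtain ⟨π, h0, hπ⟩ := P.exists_ord_eq_one
  have hmem : π ∈ P.ring := (P.ord_nonneg_iff h0).1 (by omega)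
  have hinv : π⁻¹ ∉ P.ring := by
    rw [← P.ord_nonneg_iff (inv_ne_zero h0), P.ord_inv]
    omega
  let A : Subring K' := P.ring.toSubring.map (algebraMap K K')
  let y : A := ⟨algebraMap K K' π, π, hmem, rfl⟩
  have hI : Ideal.span {y} ≠ ⊤ := by
    rw [Ne, Ideal.span_singleton_eq_top]
    intro hu
    obtain ⟨⟨_, z, hz, rfl⟩, h⟩ := hu.exists_right_inv
    have h1 : algebraMap K K' π * algebraMap K K' z = 1 := congrArg Subtype.val h
    rw [← map_mul, ← map_one (algebraMap K K')] at h1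
    have h2 := (algebraMap K K').injective h1
    rw [eq_inv_of_mul_eq_one_right h2] at hz
    exact hinv hz
  obtain ⟨V, hAV, hV⟩ := Ideal.image_subset_nonunits_valuationSubring _ hI
  have hyV : algebraMap K K' π ∈ V.nonunits := hV ⟨y, Ideal.mem_span_singleton_self y, rfl⟩
  have hyinv : (algebraMap K K' π)⁻¹ ∉ V := by
    rw [ValuationSubring.mem_nonunits_iff] at hyV
    rw [← ValuationSubring.valuation_le_one_iff, map_inv₀, not_le]
    exact one_lt_inv_iff₀.2 ⟨(Valuation.pos_iff _).2 ((_root_.map_ne_zero _).2 h0), hyV⟩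
  have hle : ∀ x ∈ P.ring, algebraMap K K' x ∈ V := fun x hx => hAV ⟨x, hx, rfl⟩
  obtain ⟨W, -, hW⟩ := Place.exists_eq_of_restrict (F' := F') hK' P V fun x => ⟨fun hx => by
    by_contra hxP
    have hx0 : x ≠ 0 := by
      rintro rfl
      exact hxP P.ring.zero_mem
    rw [← P.ord_nonneg_iff hx0, not_le] at hxP
    have h1 : x⁻¹ * π⁻¹ ∈ P.ring := by
      rw [← P.ord_nonneg_iff (mul_ne_zero (inv_ne_zero hx0) (inv_ne_zero h0)),
        P.ord_mul (inv_ne_zero hx0) (inv_ne_zero h0), P.ord_inv, P.ord_inv]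
      omega
    apply hyinv
    have h2 : (algebraMap K K' π)⁻¹ = algebraMap K K' x * algebraMap K K' (x⁻¹ * π⁻¹) := by
      rw [← map_mul, mul_inv_cancel_left₀ hx0, map_inv₀]
    rw [h2]
    exact V.mul_mem _ _ hx (hle _ h1), hle x⟩
  exact ⟨W, hW⟩

variable [Finite F] [Finite F']

/-- The residue field has q^(deg P) elements, a power of |F'| when [F' : F] divides deg P. -/
theorem pow_card_residueField_eq (hK : IsFunctionFieldOneVar F K) {P : Place F K}
    (hdvd : Module.finrank F F' ∣ P.degree) (α : F') :
    α ^ Nat.card (IsLocalRing.ResidueField P.ring) = α := by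
  obtain ⟨k, hk⟩ := hdvd
  have := Fintype.ofFinite F'
  have : Module.Finite F F' := Module.Finite.of_finite
  rw [P.card_residueField hK, hk, pow_mul, ← Module.natCard_eq_pow_finrank,
    Nat.card_eq_fintype_card]
  exact FiniteField.pow_card_pow k α

/-- The residue of α satisfies the equation y^Q = y, whose roots are exhausted by the residue field
of P, of order Q. -/
theorem Place.LiesOver.exists_valuation_sub_lt_one (hK : IsFunctionFieldOneVar F K)
    {V : Place F' K'} {P : Place F K} (h : V.LiesOver P)
    (hdvd : Module.finrank F F' ∣ P.degree) (α : F') :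
    ∃ a : K, V.valuation (algebraMap F' K' α - algebraMap K K' a) < 1 := by
  have := P.finite_residueField hK
  have : Finite (IsLocalRing.ResidueField P.ring) := Module.finite_of_finite F
  let ψ : IsLocalRing.ResidueField P.ring →+* IsLocalRing.ResidueField V.ring :=
    Ideal.Quotient.lift _ h.toResidue fun x hx => by
      rwa [← h.ker_toResidue, RingHom.mem_ker] at hx
  set y : V.ring := ⟨algebraMap F' K' α, V.algebraMap_mem α⟩ with hy
  have hpow : IsLocalRing.residue V.ring y ^ Nat.card (IsLocalRing.ResidueField P.ring) =
      IsLocalRing.residue V.ring y := by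
    rw [← map_pow]
    congr 1
    apply Subtype.ext
    change algebraMap F' K' α ^ _ = _
    rw [← map_pow, pow_card_residueField_eq hK hdvd]
  obtain ⟨b, hb⟩ := FiniteField.mem_range_of_pow_card_eq ψ hpow
  obtain ⟨a, rfl⟩ := IsLocalRing.residue_surjective b
  refine ⟨a, ?_⟩
  have h1 : IsLocalRing.residue V.ring (y - h.ringHom a) = 0 := by
    rw [map_sub, ← hb, sub_eq_zero]
    rfl
  exact (V.valuation_lt_one_iff_residue (y - h.ringHom a)).2 h1

/-- Teichmüller iteration: raising to the power Q is additive and fixes α, so α - a^(Q^k) = (α -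
a)^(Q^k) tends to 0. -/
theorem Place.LiesOver.exists_approx_constant (hK : IsFunctionFieldOneVar F K)
    {V : Place F' K'} {P : Place F K} (h : V.LiesOver P)
    (hdvd : Module.finrank F F' ∣ P.degree) (α : F') (N : ℤ) :
    ∃ a : K, V.valuation (algebraMap F' K' α - algebraMap K K' a) ≤ WithZero.exp N := by
  obtain ⟨a, ha⟩ := h.exists_valuation_sub_lt_one hK hdvd α
  set Q := Nat.card (IsLocalRing.ResidueField P.ring) with hQ
  have hQ1 : 1 < Q := by
    rw [hQ, P.card_residueField hK]
    exact Nat.one_lt_pow (P.degree_pos hK).ne' Finite.one_lt_card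
  have hfrob : ∀ x y : K', (x - y) ^ Q = x ^ Q - y ^ Q := by
    have := Fintype.ofFinite F
    obtain ⟨p, hp⟩ := CharP.exists F
    obtain ⟨n, hprime, hcard⟩ := FiniteField.card F p
    have : Fact p.Prime := ⟨hprime⟩
    have : CharP K' p := charP_of_injective_algebraMap (algebraMap F K').injective p
    intro x y
    rw [hQ, P.card_residueField hK, Nat.card_eq_fintype_card, hcard, ← pow_mul]
    exact sub_pow_expChar_pow x y _
  have hiter : ∀ k : ℕ, (algebraMap F' K' α - algebraMap K K' a) ^ Q ^ k =
      algebraMap F' K' α - algebraMap K K' (a ^ Q ^ k) := by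
    intro k
    induction k with
    | zero => simp
    | succ k ih =>
      rw [pow_succ, pow_mul, ih, hfrob, ← map_pow, ← map_pow, hQ,
        pow_card_residueField_eq hK hdvd, ← pow_mul]
  obtain ⟨k, hk⟩ := Place.exists_pow_mul_le ha 1 N
  refine ⟨a ^ Q ^ k, ?_⟩
  rw [← hiter, map_pow]
  simpa using hk (Q ^ k) (Nat.lt_pow_self hQ1).le

/-- K is dense in K' at V: constants of F' are limits of elements of K, limits are stable under sums
and products, and K' is generated by K and F'. -/
theorem Place.LiesOver.exists_approx (hK : IsFunctionFieldOneVar F K)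
    {V : Place F' K'} {P : Place F K} (h : V.LiesOver P)
    (hdvd : Module.finrank F F' ∣ P.degree)
    (hgen : Algebra.adjoin K (Set.range (algebraMap F' K')) = ⊤) (y : K') :
    ∀ N : ℤ, ∃ a : K, V.valuation (y - algebraMap K K' a) ≤ WithZero.exp N := by
  have hy : y ∈ Algebra.adjoin K (Set.range (algebraMap F' K')) := by
    rw [hgen]
    trivial
  induction hy using Algebra.adjoin_induction with
  | mem x hx =>
    obtain ⟨α, rfl⟩ := hx
    exact h.exists_approx_constant hK hdvd α
  | algebraMap r => exact fun N => ⟨r, by simp⟩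
  | add x y _ _ hx hy =>
    intro N
    obtain ⟨a, ha⟩ := hx N
    obtain ⟨b, hb⟩ := hy N
    refine ⟨a + b, ?_⟩
    rw [map_add, add_sub_add_comm]
    exact (Valuation.map_add _ _ _).trans (max_le ha hb)
  | mul x y _ _ hx hy =>
    intro N
    have hbd : ∀ z : K', ∃ B : ℤ, V.valuation z ≤ WithZero.exp B := fun z =>
      ⟨_, WithZero.le_exp_log⟩
    obtain ⟨B, hB⟩ := hbd x
    -- The approximation b comes first, because the precision required of a depends on the size of
    -- b.
    obtain ⟨b, hb⟩ := hy (N - B)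
    obtain ⟨B', hB'⟩ := hbd (algebraMap K K' b)
    obtain ⟨a, ha⟩ := hx (N - B')
    refine ⟨a * b, ?_⟩
    have h1 : x * y - algebraMap K K' (a * b) =
        x * (y - algebraMap K K' b) + (x - algebraMap K K' a) * algebraMap K K' b := by
      rw [map_mul]
      ring
    rw [h1]
    refine (Valuation.map_add _ _ _).trans (max_le ?_ ?_)
    · rw [map_mul]
      refine (mul_le_mul' hB hb).trans_eq ?_
      rw [← WithZero.exp_add]
      congr 1
      ring
    · rw [map_mul]
      refine (mul_le_mul' ha hB').trans_eq ?_
      rw [← WithZero.exp_add]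
      congr 1
      ring

/-- In a constant field extension of degree dividing the degree of `P`, all places over `P` have
residue degree one over `P`. -/
theorem Place.LiesOver.degree_eq (hK : IsFunctionFieldOneVar F K)
    (hK' : IsFunctionFieldOneVar F' K') {V : Place F' K'} {P : Place F K} (h : V.LiesOver P)
    (hdvd : Module.finrank F F' ∣ P.degree)
    (hgen : Algebra.adjoin K (Set.range (algebraMap F' K')) = ⊤) :
    Module.finrank F F' * V.degree = P.degree := by
  -- By density the two residue fields coincide; comparing their orders q^(deg P) and (q^d)^(deg V)
  -- gives the claim.
  have hsurj : Function.Surjective h.toResidue := by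
    intro b
    obtain ⟨y, rfl⟩ := IsLocalRing.residue_surjective b
    obtain ⟨a, ha⟩ := h.exists_approx hK hdvd hgen y (-1)
    have ha1 : V.valuation ((y : K') - algebraMap K K' a) < 1 := by
      refine ha.trans_lt ?_
      rw [← WithZero.exp_zero, WithZero.exp_lt_exp]
      omega
    have haP : a ∈ P.ring := by
      rw [← h a, ← V.valuation_le_one_iff]
      have h1 : algebraMap K K' a = y - (y - algebraMap K K' a) := by ring
      rw [h1]
      exact (Valuation.map_sub _ _ _).trans (max_le (V.valuation_le_one_iff.2 y.2) ha1.le)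
    refine ⟨⟨a, haP⟩, ?_⟩
    have h2 := (V.valuation_lt_one_iff_residue (y - h.ringHom ⟨a, haP⟩)).1 ha1
    rw [map_sub, sub_eq_zero] at h2
    exact h2.symm
  have h1 : Nat.card (IsLocalRing.ResidueField P.ring) =
      Nat.card (IsLocalRing.ResidueField V.ring) := Nat.card_congr
        ((Ideal.quotEquivOfEq h.ker_toResidue.symm).trans
          (RingHom.quotientKerEquivOfSurjective hsurj)).toEquiv
  have : Module.Finite F F' := Module.Finite.of_finite
  rw [P.card_residueField hK, V.card_residueField hK', Module.natCard_eq_pow_finrank (K := F)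
    (V := F'), ← pow_mul] at h1
  exact (Nat.pow_right_injective (Finite.one_lt_card (α := F)) h1).symm

/-- If V equals its pullback under τ, then τ preserves the maximal ideal of V. An element a of K
congruent to α then gives that τ α - α has positive order, although it is a nonzero algebraic
element. -/
theorem Place.exists_two_liesOver (hK : IsFunctionFieldOneVar F K)
    (hK' : IsFunctionFieldOneVar F' K') (P : Place F K) (hdvd : Module.finrank F F' ∣ P.degree)
    (τ : K' ≃ₐ[K] K') (α : F') (hτ : τ (algebraMap F' K' α) ≠ algebraMap F' K' α) :
    ∃ V W : Place F' K', V ≠ W ∧ V.LiesOver P ∧ W.LiesOver P := by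
  have : Module.Finite F F' := Module.Finite.of_finite
  obtain ⟨V, hV⟩ := P.exists_liesOver hK'
  obtain ⟨W, hWV, hW⟩ := Place.exists_eq_of_restrict (F' := F') hK' P
    (V.ring.comap (τ : K' →+* K')) fun x => by
      rw [← hV x]
      change τ (algebraMap K K' x) ∈ V.ring ↔ _
      rw [τ.commutes]
  refine ⟨V, W, ?_, hV, hW⟩
  intro hVW
  have hmem : ∀ x : K', τ x ∈ V.ring ↔ x ∈ V.ring := fun x => by
    conv_rhs => rw [hVW, hWV]
    rfl
  have hlt : ∀ x : K', V.valuation x < 1 → V.valuation (τ x) < 1 := by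
    intro x hx
    by_cases hx0 : x = 0
    · simp [hx0]
    rw [V.valuation_lt_one_iff_inv_notMem ((_root_.map_ne_zero τ).2 hx0), ← map_inv₀, hmem,
      ← V.valuation_lt_one_iff_inv_notMem hx0]
    exact hx
  obtain ⟨a, ha⟩ := hV.exists_valuation_sub_lt_one hK hdvd α
  have ha' := hlt _ ha
  rw [map_sub, τ.commutes] at ha'
  have hαalg : IsAlgebraic F (algebraMap F' K' α) :=
    (Algebra.IsAlgebraic.isAlgebraic (R := F) α).algebraMap
  have hταalg : IsAlgebraic F (τ (algebraMap F' K' α)) :=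
    hαalg.algHom (τ.toAlgHom.restrictScalars F)
  have h1 : V.valuation (τ (algebraMap F' K' α) - algebraMap F' K' α) = 1 :=
    V.valuation_eq_one_of_isAlgebraic ((hταalg.sub hαalg).tower_top F') (sub_ne_zero.2 hτ)
  have h2 : V.valuation (τ (algebraMap F' K' α) - algebraMap F' K' α) < 1 := by
    rw [← sub_sub_sub_cancel_right _ _ (algebraMap K K' a)]
    exact (Valuation.map_sub _ _ _).trans_lt (max_lt ha' ha)
  exact h2.ne h1

/-- Choosing two distinct places φ P and ψ P over each P, the map (D, E) ↦ φ_* D + ψ_* E is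
injective because the images of φ and ψ are disjoint. It divides degrees by d, and j is recovered
from deg D. -/
theorem Divisor.sum_ncard_mul_ncard_le (hK : IsFunctionFieldOneVar F K)
    (hK' : IsFunctionFieldOneVar F' K') (hdvd : ∀ P : Place F K, Module.finrank F F' ∣ P.degree)
    (hgen : Algebra.adjoin K (Set.range (algebraMap F' K')) = ⊤)
    (τ : K' ≃ₐ[K] K') (α : F') (hτ : τ (algebraMap F' K' α) ≠ algebraMap F' K' α)
    (m : ℕ) (J : Finset ℕ) (hJ : ∀ j ∈ J, j ≤ m) :
    ∑ j ∈ J, (Divisor.effective F K (Module.finrank F F' * j)).ncard *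
      (Divisor.effective F K (Module.finrank F F' * (m - j))).ncard ≤
        (Divisor.effective F' K' m).ncard := by
  classical
  have : Module.Finite F F' := Module.Finite.of_finite
  choose φ ψ hne hφ hψ using fun P : Place F K => P.exists_two_liesOver hK hK' (hdvd P) τ α hτ
  have hφi : Function.Injective φ := fun P Q h => (hφ P).eq (h ▸ hφ Q)
  have hψi : Function.Injective ψ := fun P Q h => (hψ P).eq (h ▸ hψ Q)
  have hφψ : ∀ P Q, φ P ≠ ψ Q := by
    intro P Q h
    obtain rfl : P = Q := (hφ P).eq (h ▸ hψ Q)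
    exact hne P h
  have hdpos : 0 < Module.finrank F F' := Module.finrank_pos
  have hfin := fun k => Divisor.finite_effective hK k
  have hfin' := Divisor.finite_effective hK' m
  have hdegφ := Divisor.degree_mapDomain φ _ fun P => (hφ P).degree_eq hK hK' (hdvd P) hgen
  have hdegψ := Divisor.degree_mapDomain ψ _ fun P => (hψ P).degree_eq hK hK' (hdvd P) hgen
  set d := Module.finrank F F' with hd
  let T : Finset (Σ _ : ℕ, Divisor F K × Divisor F K) :=
    J.sigma fun j => (hfin (d * j)).toFinset ×ˢ (hfin (d * (m - j))).toFinset
  have hT : T.card = ∑ j ∈ J, (Divisor.effective F K (d * j)).ncard *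
      (Divisor.effective F K (d * (m - j))).ncard := by
    rw [Finset.card_sigma]
    refine Finset.sum_congr rfl fun j _ => ?_
    rw [Finset.card_product, Set.ncard_eq_toFinset_card _ (hfin _),
      Set.ncard_eq_toFinset_card _ (hfin _)]
  rw [← hT, Set.ncard_eq_toFinset_card _ hfin']
  refine Finset.card_le_card_of_injOn
    (fun t => Finsupp.mapDomain φ t.2.1 + Finsupp.mapDomain ψ t.2.2) ?_ ?_
  · rintro ⟨j, D, E⟩ ht
    simp only [T, Finset.coe_sigma, Set.mem_sigma_iff, Finset.mem_coe, Finset.mem_product,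
      Set.Finite.mem_toFinset] at ht
    obtain ⟨hj, hD, hE⟩ := ht
    rw [Finset.mem_coe, Set.Finite.mem_toFinset]
    have hnonneg : ∀ (χ : Place F K → Place F' K') (D : Divisor F K), 0 ≤ D →
        0 ≤ (Finsupp.mapDomain χ D : Divisor F' K') := by
      intro χ D hD
      rw [Finsupp.mapDomain]
      exact Finset.sum_nonneg fun P _ => Finsupp.single_nonneg.2 (hD P)
    refine ⟨add_nonneg (hnonneg φ D hD.1) (hnonneg ψ E hE.1), ?_⟩
    have h1 := hdegφ D
    have h2 := hdegψ E
    rw [hD.2] at h1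
    rw [hE.2] at h2
    push_cast [hJ j hj] at h1 h2
    have h3 := mul_left_cancel₀ (by exact_mod_cast hdpos.ne') h1
    have h4 := mul_left_cancel₀ (by exact_mod_cast hdpos.ne') h2
    rw [map_add]
    exact (congrArg₂ (· + ·) h3 h4).trans (by ring)
  · rintro ⟨j, D, E⟩ ht ⟨j', D', E'⟩ ht' h
    have hDE := Finsupp.mapDomain_add_injective hφi hψi hφψ (a₁ := (D, E)) (a₂ := (D', E')) h
    simp only [Prod.mk.injEq] at hDE
    obtain ⟨rfl, rfl⟩ := hDE
    simp only [T, Finset.coe_sigma, Set.mem_sigma_iff, Finset.mem_coe, Finset.mem_product,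
      Set.Finite.mem_toFinset] at ht ht'
    have h1 := ht.2.1.2.symm.trans ht'.2.1.2
    have h2 : d * j = d * j' := by exact_mod_cast h1
    obtain rfl := Nat.eq_of_mul_eq_mul_left hdpos h2
    rfl

end ConstantExtension

end

noncomputable section

open IntermediateField Polynomial

/-! ### Existence of a divisor of degree one -/

theorem IsFunctionFieldOneVar.constantExtension {F K F' K' : Type*} [Field F] [Field K]
    [Algebra F K] [Field F'] [Field K'] [Algebra F F'] [Algebra F' K'] [Algebra K K'] [Algebra F K']
    [IsScalarTower F K K'] [IsScalarTower F F' K'] [Algebra.IsAlgebraic F F'] [Module.Finite K K']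
    (hK : IsFunctionFieldOneVar F K) : IsFunctionFieldOneVar F' K' := by
  obtain ⟨x, hx, hfin⟩ := hK
  refine ⟨algebraMap K K' x, fun h => hx ?_, ?_⟩
  · have h1 : IsAlgebraic F (algebraMap K K' x) := h.restrictScalars F
    exact (isAlgebraic_algebraMap_iff (algebraMap K K').injective).1 h1
  · have : Module.Finite F⟮x⟯ K' := Module.Finite.trans K K'
    refine Module.Finite.of_range_algebraMap_le F⟮x⟯ F'⟮algebraMap K K' x⟯ ?_
    rintro _ ⟨a, rfl⟩
    have h1 : F⟮x⟯ ≤ ((F'⟮algebraMap K K' x⟯).restrictScalars F).comap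
        (IsScalarTower.toAlgHom F K K') := by
      rw [adjoin_simple_le_iff]
      exact mem_adjoin_simple_self F' (algebraMap K K' x)
    exact ⟨⟨algebraMap K K' a, h1 a.2⟩, rfl⟩

variable {F K : Type*} [Field F] [Finite F] [Field K] [Algebra F K]

/-- Over a degree `d > 1` extension `F'` of the full constant field, the effective divisors of the
constant field extension outnumber pairs of effective divisors, if `d` divides all degrees. -/
theorem IsFunctionFieldOfCurve.exists_sum_ncard_mul_ncard_le (hK : IsFunctionFieldOfCurve F K)
    {d : ℕ} (hd : 1 < d) (hdvd : ∀ P : Place F K, d ∣ P.degree) :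
    ∃ C : ℕ, ∀ (m : ℕ) (J : Finset ℕ), (∀ j ∈ J, j ≤ m) →
      ∑ j ∈ J, (Divisor.effective F K (d * j)).ncard *
        (Divisor.effective F K (d * (m - j))).ncard ≤ C * Nat.card F ^ (d * m) := by
  have hK₁ : IsFunctionFieldOneVar F K := hK.exists_transcendental
  have := Fintype.ofFinite F
  obtain ⟨p, hp⟩ := CharP.exists F
  obtain ⟨n, hprime, hcard⟩ := FiniteField.card F p
  have : Fact p.Prime := ⟨hprime⟩
  have : NeZero d := ⟨by omega⟩
  let F' := FiniteField.Extension F p d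
  have hfr : Module.finrank F F' = d := FiniteField.finrank_extension F p d
  have hcard' : Nat.card F' = Nat.card F ^ d := FiniteField.natCard_extension F p d
  let g : F[X] := X ^ Nat.card F' - X
  -- This splitting field plays the role of the compositum of K and F': the roots of g form the
  -- image of F', and separability makes it Galois over K.
  let K' := (g.map (algebraMap F K)).SplittingField
  have hgmap : g.map (algebraMap F K) = X ^ Nat.card F' - X := by simp [g]
  have hsplit : (g.map (algebraMap F K')).Splits := by
    rw [IsScalarTower.algebraMap_eq F K K', ← Polynomial.map_map]
    exact SplittingField.splits _
  have := Fintype.ofFinite F'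
  have hF'split : IsSplittingField F F' g := by
    have := FiniteField.isSplittingField_sub F' F
    rwa [← Nat.card_eq_fintype_card] at this
  let ι : F' →ₐ[F] K' := IsSplittingField.lift F' g hsplit
  let : Algebra F' K' := ι.toRingHom.toAlgebra
  have : IsScalarTower F F' K' := IsScalarTower.of_algebraMap_eq fun a => (ι.commutes a).symm
  have hgal : IsGalois K K' := by
    have : CharP K p := charP_of_injective_algebraMap (algebraMap F K).injective p
    refine IsGalois.of_separable_splitting_field (p := g.map (algebraMap F K)) ?_
    rw [hgmap]
    refine galois_poly_separable p _ ?_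
    rw [hcard', Nat.card_eq_fintype_card, hcard, ← pow_mul]
    exact dvd_pow_self p (mul_ne_zero n.ne_zero (by omega))
  have hfinK' : Module.Finite K K' := inferInstance
  have hgen : Algebra.adjoin K (Set.range (algebraMap F' K')) = ⊤ := by
    rw [eq_top_iff, ← SplittingField.adjoin_rootSet (g.map (algebraMap F K))]
    refine Algebra.adjoin_mono fun y hy => ?_
    rw [mem_rootSet'] at hy
    have h1 := hy.2
    rw [aeval_map_algebraMap, map_sub, map_pow, aeval_X, sub_eq_zero] at h1
    exact FiniteField.mem_range_of_pow_card_eq (algebraMap F' K') h1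
  have hK' : IsFunctionFieldOneVar F' K' := hK₁.constantExtension
  obtain ⟨α, hα⟩ : ∃ α : F', α ∉ (algebraMap F F').range := by
    by_contra! hall
    have h1 : Nat.card F' ≤ Nat.card F :=
      Nat.card_le_card_of_surjective (algebraMap F F') fun α => hall α
    rw [hcard'] at h1
    have h2 : Nat.card F ^ 1 < Nat.card F ^ d := Nat.pow_lt_pow_right Finite.one_lt_card hd
    rw [pow_one] at h2
    omega
  -- If every automorphism fixed α, it would lie in K and be algebraic over F, hence lie in F since
  -- F is the full constant field.
  obtain ⟨τ, hτ⟩ : ∃ τ : K' ≃ₐ[K] K', τ (algebraMap F' K' α) ≠ algebraMap F' K' α := by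
    by_contra! hall
    rw [← IsGalois.mem_bot_iff_fixed, IntermediateField.mem_bot] at hall
    obtain ⟨y, hy⟩ := hall
    have hyalg : IsAlgebraic F y := by
      have : IsAlgebraic F (algebraMap F' K' α) :=
        (Algebra.IsAlgebraic.isAlgebraic (R := F) α).algebraMap
      rw [← hy] at this
      exact (isAlgebraic_algebraMap_iff (algebraMap K K').injective).1 this
    obtain ⟨a, rfl⟩ := hK.full_constants y hyalg
    refine hα ⟨a, (algebraMap F' K').injective ?_⟩
    rw [← hy, ← IsScalarTower.algebraMap_apply, ← IsScalarTower.algebraMap_apply]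
  obtain ⟨C, hC⟩ := Divisor.exists_ncard_effective_le hK'
  refine ⟨C, fun m J hJ => ?_⟩
  have h1 := Divisor.sum_ncard_mul_ncard_le hK₁ hK' (by rwa [hfr]) hgen τ α hτ m J hJ
  rw [hfr] at h1
  refine h1.trans ((hC m).trans_eq ?_)
  rw [hcard', ← pow_mul]

/-- F. K. Schmidt's theorem: there is a divisor of degree one. -/
theorem IsFunctionFieldOfCurve.exists_degree_eq_one (hK : IsFunctionFieldOfCurve F K) :
    ∃ D : Divisor F K, D.degree = 1 := by
  have hK₁ : IsFunctionFieldOneVar F K := hK.exists_transcendental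
  obtain ⟨P₀⟩ := Divisor.exists_place hK₁
  obtain ⟨a, ha⟩ := Int.subgroup_cyclic (Divisor.degree (F := F) (K := K)).range
  -- The degrees of divisors form the subgroup generated by a, so the claim is that a divides 1.
  rw [← AddSubgroup.zmultiples_eq_closure] at ha
  have hmem : ∀ k : ℤ, (∃ D : Divisor F K, D.degree = k) ↔ a ∣ k := by
    intro k
    rw [← Int.mem_zmultiples_iff, ← ha]
    rfl
  have hdvd : ∀ P : Place F K, a.natAbs ∣ P.degree := by
    intro P
    rw [← Int.natCast_dvd_natCast, Int.natCast_natAbs, abs_dvd, ← hmem]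
    exact ⟨Finsupp.single P 1, by simp⟩
  have ha0 : a.natAbs ≠ 0 := by
    intro h
    have h1 := hdvd P₀
    rw [h, zero_dvd_iff] at h1
    have := P₀.degree_pos hK₁
    omega
  rw [hmem]
  by_contra hne
  have hd : 1 < a.natAbs := by
    rcases Nat.lt_or_ge 1 a.natAbs with h | h
    · exact h
    · refine absurd ?_ hne
      rw [← Int.natAbs_dvd, show a.natAbs = 1 by omega]
      simp
  set d := a.natAbs with hd'
  obtain ⟨C, hC⟩ := hK.exists_sum_ncard_mul_ncard_le hd hdvd
  obtain ⟨C₁, k, m₀, hlow⟩ := Divisor.exists_le_ncard_effective hK₁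
  set q := Nat.card F with hq
  have hq0 : 0 < q := Nat.card_pos
  set A := fun m => (Divisor.effective F K m).ncard with hA
  have hlow' : ∀ j ≥ m₀, q ^ (d * j) ≤ q ^ k * (C₁ * A (d * j)) := by
    intro j hj
    refine hlow (d * j) (le_trans hj (Nat.le_mul_of_pos_left _ (by omega))) ((hmem _).2 ?_)
    rw [← Int.natAbs_dvd, ← hd']
    push_cast
    exact dvd_mul_right _ _
  -- Each product of counts is at least q^(dm) / (q^k C₁)^2. There are B + 1 indices j, so the sum
  -- exceeds C q^(dm). The choice m = 2 m₀ + B keeps both j and m - j at least m₀.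
  set B := (q ^ k * C₁) ^ 2 * C with hB
  set m := 2 * m₀ + B with hm
  have hJ : ∀ j ∈ Finset.Icc m₀ (m₀ + B), j ≤ m := by
    intro j hj
    rw [Finset.mem_Icc] at hj
    omega
  have h1 := hC m (Finset.Icc m₀ (m₀ + B)) hJ
  have h2 : ∀ j ∈ Finset.Icc m₀ (m₀ + B),
      q ^ (d * m) ≤ (q ^ k * C₁) ^ 2 * (A (d * j) * A (d * (m - j))) := by
    intro j hj
    have hjm := hJ j hj
    rw [Finset.mem_Icc] at hj
    have h3 := Nat.mul_le_mul (hlow' j hj.1) (hlow' (m - j) (by omega))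
    rw [← pow_add, ← mul_add, Nat.add_sub_cancel' hjm] at h3
    refine h3.trans_eq ?_
    ring
  have h4 := Finset.sum_le_sum h2
  rw [Finset.sum_const, Nat.card_Icc, ← Finset.mul_sum, smul_eq_mul] at h4
  have h5 : (B + 1) * q ^ (d * m) ≤ B * q ^ (d * m) := by
    calc (B + 1) * q ^ (d * m) = (m₀ + B + 1 - m₀) * q ^ (d * m) := by
          congr 1
          omega
      _ ≤ _ := h4
      _ ≤ (q ^ k * C₁) ^ 2 * (C * q ^ (d * m)) := Nat.mul_le_mul_left _ h1
      _ = B * q ^ (d * m) := by rw [hB]; ring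
  have h6 : 0 < q ^ (d * m) := pow_pos hq0 _
  nlinarith

end

noncomputable section

variable {F K : Type*} [Field F] [Field K] [Algebra F K]

/-! ### The divisor of a coordinate vector -/

section VectorDivisor

variable {ι : Type*} [Finite ι]

/-- Since x ≠ 0 and the index type is finite, the infimum is a true minimum and not the default
value of an empty or unbounded one. -/
theorem Place.le_minOrd_iff (P : Place F K) {x : ι → K} (hx : x ≠ 0) {k : ℤ} :
    k ≤ P.minOrd x ↔ ∀ i, x i ≠ 0 → k ≤ P.ord (x i) := by
  obtain ⟨i, hi⟩ := Function.ne_iff.1 hx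
  have : Nonempty {i // x i ≠ 0} := ⟨⟨i, hi⟩⟩
  rw [Place.minOrd, le_ciInf_iff (Set.finite_range _).bddBelow]
  exact Subtype.forall

theorem Place.minOrd_smul (P : Place F K) {x : ι → K} (hx : x ≠ 0) {c : K} (hc : c ≠ 0) :
    P.minOrd (c • x) = P.ord c + P.minOrd x := by
  refine eq_of_forall_le_iff fun k => ?_
  rw [P.le_minOrd_iff (smul_ne_zero hc hx), ← sub_le_iff_le_add', P.le_minOrd_iff hx]
  refine forall_congr' fun i => ?_
  rw [Pi.smul_apply, smul_eq_mul, mul_ne_zero_iff]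
  constructor
  · intro h hi
    have := h ⟨hc, hi⟩
    rw [P.ord_mul hc hi] at this
    omega
  · intro h hi
    have := h hi.2
    rw [P.ord_mul hc hi.2]
    omega

theorem Place.finite_minOrd_ne_zero (hK : IsFunctionFieldOneVar F K) {x : ι → K} (hx : x ≠ 0) :
    (Function.support fun P : Place F K => P.minOrd x).Finite := by
  refine (Set.finite_iUnion fun i => Place.finite_ord_ne_zero hK (x i)).subset fun P hP => ?_
  by_contra hne
  simp only [Set.mem_iUnion, Function.mem_support, not_exists, not_not] at hne
  refine hP (eq_of_forall_le_iff fun k => ?_)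
  rw [P.le_minOrd_iff hx]
  obtain ⟨i, hi⟩ := Function.ne_iff.1 hx
  exact ⟨fun h => hne i ▸ h i hi, fun h j _ => hne j ▸ h⟩

namespace Divisor

/-- The infimum of the divisors of the coordinates of a nonzero vector. -/
def ofVec (hK : IsFunctionFieldOneVar F K) (x : ι → K) (hx : x ≠ 0) : Divisor F K :=
  Finsupp.ofSupportFinite (fun P => P.minOrd x) (Place.finite_minOrd_ne_zero hK hx)

@[simp] theorem ofVec_apply (hK : IsFunctionFieldOneVar F K) {x : ι → K} (hx : x ≠ 0)
    (P : Place F K) : ofVec hK x hx P = P.minOrd x := rfl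

theorem ofVec_smul (hK : IsFunctionFieldOneVar F K) {x : ι → K} (hx : x ≠ 0) {c : K} (hc : c ≠ 0) :
    ofVec hK (c • x) (smul_ne_zero hc hx) = ofFun hK c + ofVec hK x hx := by
  ext P
  simp [P.minOrd_smul hx hc]

theorem vecHeight_eq (hK : IsFunctionFieldOneVar F K) {x : ι → K} (hx : x ≠ 0) :
    vecHeight F x = -(ofVec hK x hx).degree := by
  rw [vecHeight, degree_eq_sum, Finsupp.sum, finsum_eq_sum_of_support_subset]
  · rfl
  · intro P hP
    rw [Function.mem_support] at hP
    rw [Finset.mem_coe, Finsupp.mem_support_iff]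
    exact left_ne_zero_of_mul hP

theorem forall_mem_rrSpace_iff (hK : IsFunctionFieldOneVar F K) {x : ι → K} (hx : x ≠ 0)
    (D : Divisor F K) : (∀ i, x i ∈ D.rrSpace) ↔ -D ≤ ofVec hK x hx := by
  constructor
  · intro h P
    refine (P.le_minOrd_iff hx).2 fun i hi => ?_
    exact (mem_rrSpace_iff hi).1 (h i) P
  · intro h i
    by_cases hi : x i = 0
    · rw [hi]
      exact zero_mem _
    · rw [mem_rrSpace_iff hi]
      intro P
      exact (P.le_minOrd_iff hx).1 (h P) i hi

/-- The vectors whose divisor is `-D`. -/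
def primitiveVec (ι : Type*) [Finite ι] (hK : IsFunctionFieldOneVar F K) (D : Divisor F K) :
    Set (ι → K) :=
  {x | ∃ hx : x ≠ 0, ofVec hK x hx = -D}

/-- The vectors with coordinates in `L(D)`. -/
def rrVec (ι : Type*) (D : Divisor F K) : Set (ι → K) := {x | ∀ i, x i ∈ D.rrSpace}

/-- Vectors with coordinates in `L(D)` as families of elements of `L(D)`. -/
def rrVecEquiv (ι : Type*) (D : Divisor F K) : rrVec ι D ≃ (ι → D.rrSpace) where
  toFun x i := ⟨x.1 i, x.2 i⟩
  invFun y := ⟨fun i => y i, fun i => (y i).2⟩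
  left_inv _ := rfl
  right_inv _ := rfl

theorem card_rrVec [Finite F] (hK : IsFunctionFieldOneVar F K) (D : Divisor F K) :
    Nat.card (rrVec ι D) = Nat.card F ^ (Nat.card ι * Module.finrank F D.rrSpace) := by
  have := Fintype.ofFinite ι
  rw [Nat.card_congr (rrVecEquiv ι D), Nat.card_fun, card_rrSpace hK, ← pow_mul, mul_comm]

theorem finite_rrVec [Finite F] (hK : IsFunctionFieldOneVar F K) (D : Divisor F K) :
    (rrVec ι D).Finite := by
  have := finite_rrSpace_set hK D
  exact Finite.of_equiv _ (rrVecEquiv ι D).symm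

theorem primitiveVec_subset (hK : IsFunctionFieldOneVar F K) (D : Divisor F K) :
    primitiveVec ι hK D ⊆ rrVec ι D := by
  rintro x ⟨hx, h⟩
  exact (forall_mem_rrSpace_iff hK hx D).2 h.ge

theorem finite_primitiveVec [Finite F] (hK : IsFunctionFieldOneVar F K) (D : Divisor F K) :
    (primitiveVec ι hK D).Finite := (finite_rrVec hK D).subset (primitiveVec_subset hK D)

/-! ### Möbius inversion over reduced effective divisors -/

/-- The reduced effective divisor with given support. -/
def ofFinset (S : Finset (Place F K)) : Divisor F K := ∑ P ∈ S, Finsupp.single P 1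

open scoped Classical in
theorem ofFinset_apply (S : Finset (Place F K)) (P : Place F K) :
    ofFinset S P = if P ∈ S then 1 else 0 := by
  simp [ofFinset, Finsupp.finsetSum_apply, Finsupp.single_apply]

theorem ofFinset_nonneg (S : Finset (Place F K)) : 0 ≤ ofFinset S :=
  Finset.sum_nonneg fun P _ => by simp

theorem ofFinset_injective : Function.Injective (ofFinset (F := F) (K := K)) := by
  classical
  intro S T h
  ext P
  have := DFunLike.congr_fun h P
  rw [ofFinset_apply, ofFinset_apply] at this
  by_cases h1 : P ∈ S <;> by_cases h2 : P ∈ T <;> simp_all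

/-- The degree of the reduced effective divisor with given support. -/
def finsetDegree (S : Finset (Place F K)) : ℕ := ∑ P ∈ S, P.degree

theorem degree_ofFinset (S : Finset (Place F K)) : (ofFinset S).degree = finsetDegree S := by
  simp [ofFinset, finsetDegree]

theorem ofFinset_le_iff {S : Finset (Place F K)} {G : Divisor F K} (hG : 0 ≤ G) :
    ofFinset S ≤ G ↔ S ⊆ G.support := by
  classical
  constructor
  · intro h P hP
    have := h P
    rw [ofFinset_apply, if_pos hP] at this
    rw [Finsupp.mem_support_iff]
    omega
  · intro h P
    have h0 : 0 ≤ G P := hG P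
    rw [ofFinset_apply]
    split_ifs with hP
    · have := Finsupp.mem_support_iff.1 (h hP)
      omega
    · exact h0

theorem finite_finsetDegree_le [Finite F] (hK : IsFunctionFieldOneVar F K) (r : ℕ) :
    {S : Finset (Place F K) | finsetDegree S ≤ r}.Finite := by
  refine Set.Finite.of_finite_image (f := ofFinset) ((finite_degree_le hK r).subset ?_)
    ofFinset_injective.injOn
  rintro _ ⟨S, hS, rfl⟩
  refine ⟨ofFinset_nonneg S, ?_⟩
  rw [degree_ofFinset]
  exact_mod_cast hS

theorem ncard_finsetDegree_eq_le [Finite F] (hK : IsFunctionFieldOneVar F K) (m : ℕ) :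
    {S : Finset (Place F K) | finsetDegree S = m}.ncard ≤ (effective F K m).ncard := by
  refine Set.ncard_le_ncard_of_injOn ofFinset ?_ ofFinset_injective.injOn (finite_effective hK m)
  intro S hS
  refine ⟨ofFinset_nonneg S, ?_⟩
  rw [degree_ofFinset]
  exact_mod_cast hS

/-- For nonzero x in L(D)^ι put G = div x + D ≥ 0. Then x has coordinates in L(D - S) exactly when S
⊆ supp G, and the alternating sum over such S is 1 if G = 0 and 0 otherwise. It remains to exchange
the sums. The -1 discards the zero vector; sets S of degree above deg D have L(D - S) = 0 and
contribute nothing, so any finite family containing the others may be used. -/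
theorem ncard_primitiveVec [Finite F] (hK : IsFunctionFieldOneVar F K)
    (D : Divisor F K) (𝒮 : Finset (Finset (Place F K)))
    (h𝒮 : ∀ S, (finsetDegree S : ℤ) ≤ D.degree → S ∈ 𝒮) :
    ((primitiveVec ι hK D).ncard : ℤ) = ∑ S ∈ 𝒮, (-1) ^ S.card *
      ((Nat.card F : ℤ) ^ (Nat.card ι * Module.finrank F (D - ofFinset S).rrSpace) - 1) := by
  classical
  set X : Finset (ι → K) := (finite_rrVec hK D).toFinset.erase 0 with hX
  have hXmem : ∀ x, x ∈ X ↔ x ≠ 0 ∧ ∀ i, x i ∈ D.rrSpace := fun x => by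
    rw [hX, Finset.mem_erase, Set.Finite.mem_toFinset]
    rfl
  have hcount : ∀ S ∈ 𝒮, ((Nat.card F : ℤ) ^
      (Nat.card ι * Module.finrank F (D - ofFinset S).rrSpace) - 1) =
        ∑ x ∈ X, if ∀ i, x i ∈ (D - ofFinset S).rrSpace then 1 else 0 := by
    intro S _
    have hset : X.filter (fun x => ∀ i, x i ∈ (D - ofFinset S).rrSpace) =
        (finite_rrVec hK (D - ofFinset S)).toFinset.erase 0 := by
      ext x
      rw [Finset.mem_filter, hXmem, Finset.mem_erase, Set.Finite.mem_toFinset]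
      constructor
      · rintro ⟨⟨h0, -⟩, h⟩
        exact ⟨h0, h⟩
      · rintro ⟨h0, h⟩
        exact ⟨⟨h0, fun i => rrSpace_mono (sub_le_self _ (ofFinset_nonneg S)) (h i)⟩, h⟩
    rw [Finset.sum_boole, hset, Finset.card_erase_of_mem,
      ← Set.ncard_eq_toFinset_card _ (finite_rrVec hK _), ← Nat.card_coe_set_eq, card_rrVec hK,
      Nat.cast_sub (Nat.one_le_pow _ _ Nat.card_pos)]
    · push_cast
      rfl
    · rw [Set.Finite.mem_toFinset]
      exact fun i => zero_mem _
  rw [Finset.sum_congr rfl fun S hS => by rw [hcount S hS, Finset.mul_sum], Finset.sum_comm]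
  have hinner : ∀ x ∈ X, (∑ S ∈ 𝒮, (-1) ^ S.card *
      if ∀ i, x i ∈ (D - ofFinset S).rrSpace then (1 : ℤ) else 0) =
        if x ∈ primitiveVec ι hK D then 1 else 0 := by
    intro x hx
    obtain ⟨hx0, hxD⟩ := (hXmem x).1 hx
    set G := ofVec hK x hx0 + D with hG
    have hG0 : 0 ≤ G := by
      have := (forall_mem_rrSpace_iff hK hx0 D).1 hxD
      rw [hG, ← neg_le_iff_add_nonneg]
      exact this
    have hiff : ∀ S, (∀ i, x i ∈ (D - ofFinset S).rrSpace) ↔ S ⊆ G.support := by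
      intro S
      rw [forall_mem_rrSpace_iff hK hx0, ← ofFinset_le_iff hG0, hG, neg_sub, sub_le_iff_le_add]
    have h𝒮' : 𝒮.filter (fun S => ∀ i, x i ∈ (D - ofFinset S).rrSpace) = G.support.powerset := by
      ext S
      rw [Finset.mem_filter, Finset.mem_powerset, hiff]
      refine ⟨fun h => h.2, fun h => ⟨h𝒮 S ?_, h⟩⟩
      obtain ⟨i, hi⟩ := Function.ne_iff.1 hx0
      have := degree_nonneg_of_mem_rrSpace hK hi ((hiff S).2 h i)
      rw [map_sub, degree_ofFinset] at this
      omega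
    simp_rw [mul_ite, mul_one, mul_zero]
    rw [← Finset.sum_filter, h𝒮', Finset.sum_powerset_neg_one_pow_card]
    refine if_congr ?_ rfl rfl
    rw [Finsupp.support_eq_empty, hG, add_eq_zero_iff_eq_neg]
    exact ⟨fun h => ⟨hx0, h⟩, fun ⟨_, h⟩ => h⟩
  rw [Finset.sum_congr rfl hinner, Finset.sum_boole, ← Set.ncard_coe_finset]
  congr 2
  ext x
  rw [Finset.mem_coe, Finset.mem_filter, hXmem]
  refine ⟨fun h => ⟨⟨h.choose, primitiveVec_subset hK D h⟩, h⟩, fun h => h.2⟩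

end Divisor

end VectorDivisor

/-! ### Points of given height -/

namespace Divisor

theorem exists_eq_algebraMap_of_ofFun_eq_zero (hK : IsFunctionFieldOfCurve F K)
    (hK₁ : IsFunctionFieldOneVar F K) {f : K} (h : ofFun hK₁ f = 0) :
    ∃ a : F, algebraMap F K a = f := by
  refine hK.full_constants f ?_
  by_contra hf
  obtain ⟨P, hP⟩ := Place.exists_ord_neg hK₁ hf
  have := DFunLike.congr_fun h P
  rw [ofFun_apply, Finsupp.zero_apply] at this
  omega

/-- A divisor of degree `r` in the class of degree `r` that corresponds to `c`. -/
def classRep (D₁ : Divisor F K) (r : ℤ) (c : Pic0 F K) : Divisor F K :=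
  (Quotient.out c : (degree (F := F) (K := K)).ker).1 + r • D₁

theorem degree_classRep {D₁ : Divisor F K} (hD₁ : D₁.degree = 1) (r : ℤ) (c : Pic0 F K) :
    (classRep D₁ r c).degree = r := by
  rw [classRep, map_add, AddMonoidHom.mem_ker.1 (Quotient.out c).2, map_zsmul, hD₁]
  simp

theorem exists_classRep_sub_mem (hK₁ : IsFunctionFieldOneVar F K) {D₁ : Divisor F K}
    (hD₁ : D₁.degree = 1) {r : ℤ} {D : Divisor F K} (hD : D.degree = r) :
    ∃ c : Pic0 F K, ∃ f : K, f ≠ 0 ∧ D = classRep D₁ r c + ofFun hK₁ f := by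
  have hker : D - r • D₁ ∈ (degree (F := F) (K := K)).ker := by
    rw [AddMonoidHom.mem_ker, map_sub, map_zsmul, hD, hD₁]
    simp
  set c : Pic0 F K := QuotientAddGroup.mk ⟨_, hker⟩ with hc
  have h1 : QuotientAddGroup.mk (Quotient.out c) = c := Quotient.out_eq c
  rw [hc, QuotientAddGroup.eq, AddSubgroup.mem_addSubgroupOf, mem_principal_iff hK₁] at h1
  obtain ⟨f, hf, h2⟩ := h1
  refine ⟨c, f, hf, ?_⟩
  rw [← h2, classRep]
  simp only [AddSubgroup.coe_add, AddSubgroup.coe_neg, hc]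
  abel

theorem classRep_eq_of_eq_add (hK₁ : IsFunctionFieldOneVar F K) {D₁ : Divisor F K}
    {r : ℤ} {c c' : Pic0 F K} {f : K} (hf : f ≠ 0)
    (h : classRep D₁ r c = classRep D₁ r c' + ofFun hK₁ f) : c = c' := by
  rw [← Quotient.out_eq c, ← Quotient.out_eq c']
  refine (QuotientAddGroup.eq.2 ?_).symm
  rw [AddSubgroup.mem_addSubgroupOf, mem_principal_iff hK₁]
  refine ⟨f, hf, ?_⟩
  simp only [AddSubgroup.coe_add, AddSubgroup.coe_neg]
  rw [classRep, classRep] at h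
  rw [neg_add_eq_iff_eq_add]
  have h2 := add_right_cancel (b := r • D₁) (h.trans (add_right_comm _ _ _))
  exact h2

/-- Rescaling by a function moves the divisor of a coordinate vector within its class, so it can be
made minus the chosen representative. The remaining freedom is a function with trivial divisor, that
is, an element of F^×. -/
theorem exists_bijective_primitiveVec (hK : IsFunctionFieldOfCurve F K)
    (hK₁ : IsFunctionFieldOneVar F K)
    {D₁ : Divisor F K} (hD₁ : D₁.degree = 1) (n : ℕ) (r : ℤ) :
    ∃ φ : Fˣ × pointsOfHeight F K n r →
      Σ c : Pic0 F K, primitiveVec (Fin (n + 1)) hK₁ (classRep D₁ r c), Function.Bijective φ := by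
  have hdeg : ∀ p : pointsOfHeight F K n r, (-ofVec hK₁ p.1.rep p.1.rep_nonzero).degree = r := by
    intro p
    have := p.2
    rw [map_neg, ← vecHeight_eq]
    exact this
  choose c f hf hcf using fun p => exists_classRep_sub_mem hK₁ hD₁ (hdeg p)
  have hu0 : ∀ u : Fˣ, algebraMap F K u ≠ 0 := fun u => by simp
  have hufun : ∀ u : Fˣ, ofFun hK₁ (algebraMap F K u) = 0 := fun u => by
    ext P
    simp [P.ord_eq_zero_of_isAlgebraic (isAlgebraic_algebraMap (u : F))]
  have hmem : ∀ (u : Fˣ) (p : pointsOfHeight F K n r),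
      (algebraMap F K u * f p) • p.1.rep ∈
        primitiveVec (Fin (n + 1)) hK₁ (classRep D₁ r (c p)) := by
    intro u p
    have h0 := mul_ne_zero (hu0 u) (hf p)
    refine ⟨smul_ne_zero h0 p.1.rep_nonzero, ?_⟩
    rw [ofVec_smul hK₁ p.1.rep_nonzero h0, ofFun_mul hK₁ (hu0 u) (hf p), hufun, zero_add,
      ← neg_neg (ofVec hK₁ _ p.1.rep_nonzero), hcf p]
    abel
  refine ⟨fun up => ⟨c up.2, ⟨_, hmem up.1 up.2⟩⟩, ?_, ?_⟩
  · rintro ⟨u, p⟩ ⟨u', p'⟩ h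
    have hx : (algebraMap F K u * f p) • p.1.rep = (algebraMap F K u' * f p') • p'.1.rep :=
      congrArg (fun s : Σ c : Pic0 F K, primitiveVec (Fin (n + 1)) hK₁ (classRep D₁ r c) =>
        s.2.1) h
    have hp : p = p' := by
      apply Subtype.ext
      rw [← p.1.mk_rep, ← p'.1.mk_rep, Projectivization.mk_eq_mk_iff']
      refine ⟨(algebraMap F K u * f p)⁻¹ * (algebraMap F K u' * f p'), ?_⟩
      rw [mul_smul, ← hx, inv_smul_smul₀ (mul_ne_zero (hu0 u) (hf p))]
    subst hp
    have h1 := smul_left_injective K p.1.rep_nonzero hx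
    have h2 := mul_right_cancel₀ (hf p) h1
    rw [Units.ext ((algebraMap F K).injective h2)]
  · rintro ⟨c₀, x, hx0, hx⟩
    set p₀ := Projectivization.mk K x hx0 with hp₀
    obtain ⟨a, ha⟩ := Projectivization.exists_smul_eq_mk_rep K x hx0
    rw [← hp₀] at ha
    have ha' : (a : K) • x = p₀.rep := ha
    have hrep : ofVec hK₁ p₀.rep p₀.rep_nonzero = ofFun hK₁ (a : K) - classRep D₁ r c₀ := by
      have h1 := ofVec_smul hK₁ hx0 a.ne_zero
      rw [hx] at h1
      rw [sub_eq_add_neg, ← h1]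
      congr 1
      exact ha'.symm
    have hpr : vecHeight F p₀.rep = r := by
      rw [vecHeight_eq hK₁ p₀.rep_nonzero, hrep, map_sub, degree_ofFun, degree_classRep hD₁]
      ring
    set p : pointsOfHeight F K n r := ⟨p₀, hpr⟩ with hp
    have h1 := hcf p
    have h2 : classRep D₁ r c₀ = classRep D₁ r (c p) + ofFun hK₁ (f p * a) := by
      rw [ofFun_mul hK₁ (hf p) a.ne_zero, ← add_assoc, ← h1]
      change _ = -ofVec hK₁ p₀.rep p₀.rep_nonzero + _
      rw [hrep]
      abel
    obtain rfl := classRep_eq_of_eq_add hK₁ (mul_ne_zero (hf p) a.ne_zero) h2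
    -- The function `f p * a` is therefore a constant b, and the unit to be used is b⁻¹.
    have h3 : ofFun hK₁ (f p * a) = 0 := by
      rw [left_eq_add] at h2
      exact h2
    obtain ⟨b, hb⟩ := exists_eq_algebraMap_of_ofFun_eq_zero hK hK₁ h3
    have hb0 : b ≠ 0 := by
      rintro rfl
      rw [map_zero] at hb
      exact mul_ne_zero (hf p) a.ne_zero hb.symm
    refine ⟨((Units.mk0 b hb0)⁻¹, p), ?_⟩
    refine Sigma.ext rfl (heq_of_eq (Subtype.ext ?_))
    change (algebraMap F K ((Units.mk0 b hb0)⁻¹ : Fˣ) * f p) • p₀.rep = x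
    rw [← ha', smul_smul, Units.val_inv_eq_inv_val, Units.val_mk0, map_inv₀, hb, mul_assoc,
      inv_mul_cancel₀ (mul_ne_zero (hf p) a.ne_zero), one_smul]

theorem finite_pointsOfHeight [Finite F] (hK : IsFunctionFieldOfCurve F K) (n : ℕ) (r : ℤ) :
    (pointsOfHeight F K n r).Finite := by
  have hK₁ : IsFunctionFieldOneVar F K := hK.exists_transcendental
  obtain ⟨D₁, hD₁⟩ := hK.exists_degree_eq_one
  have := finite_Pic0 hK₁
  have : ∀ c, Finite (primitiveVec (Fin (n + 1)) hK₁ (classRep D₁ r c)) :=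
    fun c => finite_primitiveVec hK₁ _
  obtain ⟨φ, hφ⟩ := exists_bijective_primitiveVec hK hK₁ hD₁ n r
  exact Finite.of_injective (fun p => φ (1, p)) fun p p' h => (Prod.ext_iff.1 (hφ.1 h)).2

theorem card_sub_one_mul_ncard [Finite F] (hK : IsFunctionFieldOfCurve F K)
    (hK₁ : IsFunctionFieldOneVar F K)
    {D₁ : Divisor F K} (hD₁ : D₁.degree = 1) [Fintype (Pic0 F K)] (n : ℕ) (r : ℤ) :
    (Nat.card F - 1) * (pointsOfHeight F K n r).ncard =
      ∑ c, (primitiveVec (Fin (n + 1)) hK₁ (classRep D₁ r c)).ncard := by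
  have : ∀ c, Finite (primitiveVec (Fin (n + 1)) hK₁ (classRep D₁ r c)) :=
    fun c => finite_primitiveVec hK₁ _
  obtain ⟨φ, hφ⟩ := exists_bijective_primitiveVec hK hK₁ hD₁ n r
  have h := Nat.card_congr (Equiv.ofBijective φ hφ)
  rw [Nat.card_prod, Nat.card_units, Nat.card_sigma] at h
  exact h

end Divisor

end

noncomputable section

/-! ### Sums over sets graded by a degree -/

/-- Grouping by degree compares the sum with the tail from r of a geometric series of ratio q v. -/
theorem sum_pow_degree_le {α : Type*} (deg : α → ℕ) {C q v : ℝ} (hv : 0 ≤ v) (hq : 0 ≤ q)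
    (hqv : q * v < 1) (hC : 0 ≤ C) (hfin : ∀ m, {a | deg a = m}.Finite)
    (hcard : ∀ m, ({a | deg a = m}.ncard : ℝ) ≤ C * q ^ m) (r : ℕ) (s : Finset α)
    (hs : ∀ a ∈ s, r ≤ deg a) :
    ∑ a ∈ s, v ^ deg a ≤ C * ((q * v) ^ r / (1 - q * v)) := by
  classical
  have hmaps : ∀ a ∈ s, deg a ∈ Finset.Ico r (s.sup deg + 1) := fun a ha =>
    Finset.mem_Ico.2 ⟨hs a ha, Nat.lt_succ_of_le (Finset.le_sup ha)⟩
  rw [← Finset.sum_fiberwise_of_maps_to hmaps]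
  have h1 : ∀ m ∈ Finset.Ico r (s.sup deg + 1), ∑ a ∈ s with deg a = m, v ^ deg a ≤
      C * (q * v) ^ m := by
    intro m _
    have h2 : ∑ a ∈ s with deg a = m, v ^ deg a = (s.filter fun a => deg a = m).card * v ^ m := by
      rw [← nsmul_eq_mul, ← Finset.sum_const]
      exact Finset.sum_congr rfl fun a ha => by rw [(Finset.mem_filter.1 ha).2]
    have h3 : (s.filter fun a => deg a = m).card ≤ {a | deg a = m}.ncard := by
      rw [← Set.ncard_coe_finset]
      exact Set.ncard_le_ncard (fun a ha => (Finset.mem_filter.1 ha).2) (hfin m)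
    rw [h2, mul_pow, ← mul_assoc]
    exact mul_le_mul_of_nonneg_right ((Nat.cast_le.2 h3).trans (hcard m)) (pow_nonneg hv m)
  refine (Finset.sum_le_sum h1).trans ?_
  rw [← Finset.mul_sum]
  exact mul_le_mul_of_nonneg_left (geom_sum_Ico_le_of_lt_one (mul_nonneg hq hv) hqv) hC

theorem summable_pow_degree {α : Type*} (deg : α → ℕ) {C q v : ℝ} (hv : 0 ≤ v) (hq : 0 ≤ q)
    (hqv : q * v < 1) (hC : 0 ≤ C) (hfin : ∀ m, {a | deg a = m}.Finite)
    (hcard : ∀ m, ({a | deg a = m}.ncard : ℝ) ≤ C * q ^ m) :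
    Summable fun a => v ^ deg a :=
  summable_of_sum_le (fun _ => pow_nonneg hv _) fun s =>
    sum_pow_degree_le deg hv hq hqv hC hfin hcard 0 s fun _ _ => Nat.zero_le _

theorem abs_tsum_sub_sum_le {α : Type*} (deg : α → ℕ) {C q v : ℝ} (hv : 0 ≤ v) (hq : 0 ≤ q)
    (hqv : q * v < 1) (hC : 0 ≤ C) (hfin : ∀ m, {a | deg a = m}.Finite)
    (hcard : ∀ m, ({a | deg a = m}.ncard : ℝ) ≤ C * q ^ m) {W : α → ℝ} (hW : Summable W)
    (hWv : ∀ a, |W a| ≤ v ^ deg a) {r : ℕ} {T : Finset α} (hT : ∀ a, deg a < r → a ∈ T) :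
    |∑' a, W a - ∑ a ∈ T, W a| ≤ C * ((q * v) ^ r / (1 - q * v)) := by
  classical
  have h1 : Filter.Tendsto (fun s : Finset α => |∑ a ∈ s, W a - ∑ a ∈ T, W a|) Filter.atTop
      (nhds |∑' a, W a - ∑ a ∈ T, W a|) := (hW.hasSum.sub_const _).abs
  refine le_of_tendsto h1 (Filter.eventually_atTop.2 ⟨T, fun s hs => ?_⟩)
  rw [← Finset.sum_sdiff hs, add_sub_cancel_right]
  refine (Finset.abs_sum_le_sum_abs _ _).trans ((Finset.sum_le_sum fun a _ => hWv a).trans ?_)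
  refine sum_pow_degree_le deg hv hq hqv hC hfin hcard r _ fun a ha => ?_
  by_contra h
  exact (Finset.mem_sdiff.1 ha).2 (hT a (not_le.1 h))

theorem sum_range_succ_pow_le {q : ℝ} (hq : 2 ≤ q) (r : ℕ) :
    ∑ m ∈ Finset.range (r + 1), q ^ m ≤ 2 * q ^ r := by
  induction r with
  | zero => simp
  | succ r ih =>
    rw [Finset.sum_range_succ]
    have h1 : 2 * q ^ r ≤ q ^ (r + 1) := by
      rw [pow_succ']
      exact mul_le_mul_of_nonneg_right hq (by positivity)
    linarith

theorem card_degree_le {α : Type*} (deg : α → ℕ) {C q : ℝ} (hq : 2 ≤ q) (hC : 0 ≤ C)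
    (hfin : ∀ m, {a | deg a = m}.Finite)
    (hcard : ∀ m, ({a | deg a = m}.ncard : ℝ) ≤ C * q ^ m) {r : ℕ} {T : Finset α}
    (hT : ∀ a ∈ T, deg a ≤ r) : (T.card : ℝ) ≤ 2 * C * q ^ r := by
  classical
  have hmaps : ∀ a ∈ T, deg a ∈ Finset.range (r + 1) := fun a ha =>
    Finset.mem_range.2 (Nat.lt_succ_of_le (hT a ha))
  rw [Finset.card_eq_sum_card_fiberwise hmaps, Nat.cast_sum]
  have h1 : ∀ m ∈ Finset.range (r + 1), ((T.filter fun a => deg a = m).card : ℝ) ≤ C * q ^ m := by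
    intro m _
    refine le_trans (Nat.cast_le.2 ?_) (hcard m)
    rw [← Set.ncard_coe_finset]
    exact Set.ncard_le_ncard (fun a ha => (Finset.mem_filter.1 ha).2) (hfin m)
  refine (Finset.sum_le_sum h1).trans ?_
  rw [← Finset.mul_sum]
  have := mul_le_mul_of_nonneg_left (sum_range_succ_pow_le hq r) hC
  linarith

variable {F K : Type*} [Field F] [Field K] [Algebra F K]

namespace Divisor

/-! ### The zeta function -/

/-- The degree of an effective divisor, as a natural number. -/
def effDegree (D : {D : Divisor F K // 0 ≤ D}) : ℕ := D.1.degree.toNat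

theorem coe_effDegree (D : {D : Divisor F K // 0 ≤ D}) : (effDegree D : ℤ) = D.1.degree :=
  Int.toNat_of_nonneg (degree_nonneg D.2)

theorem zetaTerm_eq (n : ℕ) (D : {D : Divisor F K // 0 ≤ D}) :
    zetaTerm F K ((n : ℝ) + 1) D = (((Nat.card F : ℝ) ^ (n + 1))⁻¹) ^ effDegree D := by
  have h1 : (D.1.degree : ℝ) = (effDegree D : ℝ) := by
    rw [← coe_effDegree D]
    simp
  have h2 : -((n : ℝ) + 1) * (effDegree D : ℝ) = -(((n + 1) * effDegree D : ℕ) : ℝ) := by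
    push_cast
    ring
  rw [zetaTerm, h1, h2, Real.rpow_neg (by positivity), Real.rpow_natCast, pow_mul, inv_pow]

theorem exists_card_effDegree_le [Finite F] (hK : IsFunctionFieldOneVar F K) :
    ∃ C : ℝ, 0 ≤ C ∧
      (∀ m, {D : {D : Divisor F K // 0 ≤ D} | effDegree D = m}.Finite ∧
        ({D : {D : Divisor F K // 0 ≤ D} | effDegree D = m}.ncard : ℝ) ≤
          C * (Nat.card F : ℝ) ^ m) ∧
      (∀ m, {S : Finset (Place F K) | finsetDegree S = m}.Finite ∧
        ({S : Finset (Place F K) | finsetDegree S = m}.ncard : ℝ) ≤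
          C * (Nat.card F : ℝ) ^ m) := by
  obtain ⟨C, hC⟩ := exists_ncard_effective_le hK
  have hC' : ∀ m, ((effective F K m).ncard : ℝ) ≤ (C : ℝ) * (Nat.card F : ℝ) ^ m := fun m => by
    exact_mod_cast hC m
  refine ⟨C, by positivity, fun m => ?_, fun m => ⟨?_, ?_⟩⟩
  · have hmaps : ∀ D ∈ {D : {D : Divisor F K // 0 ≤ D} | effDegree D = m},
        D.1 ∈ effective F K m := fun D hD => ⟨D.2, by
      rw [← coe_effDegree]
      exact_mod_cast hD⟩
    refine ⟨Set.Finite.of_finite_image ((finite_effective hK m).subset ?_)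
      Subtype.val_injective.injOn, le_trans (Nat.cast_le.2 ?_) (hC' m)⟩
    · rintro _ ⟨D, hD, rfl⟩
      exact hmaps D hD
    · exact Set.ncard_le_ncard_of_injOn _ hmaps Subtype.val_injective.injOn (finite_effective hK m)
  · exact (finite_finsetDegree_le hK m).subset fun S hS => le_of_eq hS
  · exact le_trans (Nat.cast_le.2 (ncard_finsetDegree_eq_le hK m)) (hC' m)

/-- The reciprocal of the zeta function as a sum over reduced effective divisors. -/
theorem tsum_pow_mul_tsum_eq_one {u : ℝ}
    (hZ : Summable fun D : {D : Divisor F K // 0 ≤ D} => u ^ effDegree D)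
    (hW : Summable fun S : Finset (Place F K) => |u| ^ finsetDegree S) (hu : 0 ≤ u) :
    (∑' D : {D : Divisor F K // 0 ≤ D}, u ^ effDegree D) *
      (∑' S : Finset (Place F K), (-1) ^ S.card * u ^ finsetDegree S) = 1 := by
  classical
  let Eff := {D : Divisor F K // 0 ≤ D}
  let Z : Eff → ℝ := fun D => u ^ effDegree D
  let W : Finset (Place F K) → ℝ := fun S => (-1) ^ S.card * u ^ finsetDegree S
  have hZn : Summable fun D => ‖Z D‖ := by
    refine hZ.congr fun D => ?_
    rw [Real.norm_of_nonneg (pow_nonneg hu _)]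
  have hWn : Summable fun S => ‖W S‖ := by
    refine hW.congr fun S => ?_
    simp [W]
  -- The map (D, S) ↦ (D + S, S) identifies all pairs with the pairs (G, S) such that S ⊆ supp G.
  -- Summing over S first then leaves only G = 0.
  let φ : Eff × Finset (Place F K) → Eff × Finset (Place F K) := fun x =>
    (⟨x.1.1 + ofFinset x.2, add_nonneg x.1.2 (ofFinset_nonneg _)⟩, x.2)
  have hφ : Function.Injective φ := by
    rintro ⟨⟨D, hD⟩, S⟩ ⟨⟨E, hE⟩, T⟩ h
    obtain ⟨h1, h2⟩ := Prod.ext_iff.1 h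
    change S = T at h2
    subst h2
    have h3 : D + ofFinset S = E + ofFinset S := congrArg Subtype.val h1
    simp only [add_right_cancel h3]
  let f : Eff × Finset (Place F K) → ℝ := fun x =>
    if x.2 ⊆ x.1.1.support then (-1) ^ x.2.card * u ^ effDegree x.1 else 0
  have hfφ : ∀ x, f (φ x) = Z x.1 * W x.2 := by
    rintro ⟨D, S⟩
    have h1 : S ⊆ (D.1 + ofFinset S).support :=
      (ofFinset_le_iff (add_nonneg D.2 (ofFinset_nonneg S))).1 (le_add_of_nonneg_left D.2)
    have h2 : effDegree ⟨D.1 + ofFinset S, add_nonneg D.2 (ofFinset_nonneg S)⟩ =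
        effDegree D + finsetDegree S := by
      zify
      rw [coe_effDegree, coe_effDegree, map_add, degree_ofFinset]
    change (if S ⊆ (D.1 + ofFinset S).support then _ else _) = _
    rw [if_pos h1]
    change (-1) ^ S.card * u ^ effDegree ⟨D.1 + ofFinset S, _⟩ =
      u ^ effDegree D * ((-1) ^ S.card * u ^ finsetDegree S)
    rw [h2, pow_add]
    ring
  have hrange : ∀ x ∉ Set.range φ, f x = 0 := by
    rintro ⟨G, S⟩ hx
    refine if_neg fun hS => hx ?_
    have hle : ofFinset S ≤ G.1 := (ofFinset_le_iff G.2).2 hS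
    exact ⟨(⟨G.1 - ofFinset S, sub_nonneg.2 hle⟩, S),
      Prod.ext (Subtype.ext (sub_add_cancel _ _)) rfl⟩
  have hfsum : Summable f := by
    rw [← hφ.summable_iff hrange]
    refine (summable_mul_of_summable_norm hZn hWn).congr fun x => ?_
    exact (hfφ x).symm
  rw [tsum_mul_tsum_of_summable_norm hZn hWn]
  have h1 : (∑' x : Eff × Finset (Place F K), Z x.1 * W x.2) = ∑' x, f x := by
    rw [← hφ.tsum_eq (f := f) (fun x hx => by
      by_contra h
      exact hx (hrange x h))]
    exact tsum_congr fun x => (hfφ x).symm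
  refine h1.trans ?_
  rw [hfsum.tsum_prod]
  have hinner : ∀ G : Eff, ∑' S, f (G, S) = if G = 0 then 1 else 0 := by
    intro G
    rw [tsum_eq_sum (s := G.1.support.powerset) fun S hS => if_neg fun h =>
      hS (Finset.mem_powerset.2 h)]
    have h2 : ∀ S ∈ G.1.support.powerset, f (G, S) = (-1) ^ S.card * u ^ effDegree G :=
      fun S hS => if_pos (Finset.mem_powerset.1 hS)
    rw [Finset.sum_congr rfl h2, ← Finset.sum_mul]
    have h3 := congrArg (Int.cast : ℤ → ℝ) (Finset.sum_powerset_neg_one_pow_card (x := G.1.support))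
    push_cast at h3
    rw [h3]
    by_cases hG : G = 0
    · subst hG
      have h4 : ((0 : Eff) : Divisor F K) = 0 := rfl
      rw [if_pos (by rw [h4, Finsupp.support_zero]), if_pos rfl]
      simp [effDegree]
    · rw [if_neg, if_neg hG, zero_mul]
      intro h
      exact hG (Subtype.ext (Finsupp.support_eq_empty.1 h))
  rw [tsum_congr hinner, tsum_ite_eq]

/-! ### The asymptotic formula -/

/-- If L(D) is nonzero, D is linearly equivalent to an effective divisor, for which the bound is
known. -/
theorem finrank_rrSpace_le_of_degree_nonneg (hK : IsFunctionFieldOneVar F K) (P : Place F K)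
    {D : Divisor F K} (hD : 0 ≤ D.degree) :
    (Module.finrank F D.rrSpace : ℤ) ≤ D.degree + P.degree := by
  by_cases h : D.rrSpace = ⊥
  · rw [h, finrank_bot]
    push_cast
    positivity
  · obtain ⟨z, hz, hz0⟩ := Submodule.exists_mem_ne_zero_of_ne_bot h
    rw [mem_rrSpace_iff_nonneg hK hz0] at hz
    have h1 := finrank_rrSpace_le_of_nonneg hK P hz
    rw [map_add, degree_ofFun, add_zero] at h1
    have h2 := finrank_rrSpace_sub_ofFun hK D (inv_ne_zero hz0)
    rw [ofFun_inv, sub_neg_eq_add] at h2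
    rwa [h2] at h1

/-- In large degree Riemann's theorem makes the difference exactly -1. In the remaining bounded
range of degrees both powers are bounded, uniformly in D. -/
theorem exists_abs_pow_finrank_sub_le [Finite F] (hK : IsFunctionFieldOneVar F K) (k : ℕ) :
    ∃ C : ℝ, 0 ≤ C ∧ ∀ D : Divisor F K, 0 ≤ D.degree →
      |(Nat.card F : ℝ) ^ (k * Module.finrank F D.rrSpace) - 1 -
        (Nat.card F : ℝ) ^ ((k : ℤ) * (D.degree + 1 - genus F K))| ≤ C := by
  obtain ⟨N, hN⟩ := exists_finrank_eq hK
  obtain ⟨P⟩ := exists_place hK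
  set q : ℝ := ((Nat.card F : ℕ) : ℝ) with hq
  have hq1 : 1 ≤ q := by
    rw [hq]
    exact_mod_cast (Nat.card_pos : 0 < Nat.card F)
  refine ⟨q ^ (k * (N + P.degree).toNat) + 1 + q ^ ((k : ℤ) * (N + 1 - genus F K)),
    by positivity, fun D hD => ?_⟩
  rcases le_or_gt N D.degree with h | h
  · have h1 : q ^ (k * Module.finrank F D.rrSpace) =
        q ^ ((k : ℤ) * (D.degree + 1 - genus F K)) := by
      rw [← hN D h, ← zpow_natCast]
      push_cast
      rfl
    rw [h1, sub_right_comm, sub_self, zero_sub, abs_neg, abs_one]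
    have h2 : 0 ≤ q ^ (k * (N + P.degree).toNat) := by positivity
    have h3 : 0 ≤ q ^ ((k : ℤ) * (N + 1 - genus F K)) := by positivity
    linarith
  · have h1 := finrank_rrSpace_le_of_degree_nonneg hK P hD
    have h2 : q ^ (k * Module.finrank F D.rrSpace) ≤ q ^ (k * (N + P.degree).toNat) :=
      pow_le_pow_right₀ hq1 (Nat.mul_le_mul_left _ (by omega))
    have h3 : q ^ ((k : ℤ) * (D.degree + 1 - genus F K)) ≤
        q ^ ((k : ℤ) * (N + 1 - genus F K)) :=
      zpow_le_zpow_right₀ hq1 (mul_le_mul_of_nonneg_left (by omega) (by positivity))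
    have h4 : 0 ≤ q ^ (k * Module.finrank F D.rrSpace) := by positivity
    have h5 : 0 ≤ q ^ ((k : ℤ) * (D.degree + 1 - genus F K)) := by positivity
    rw [abs_le]
    constructor <;> linarith

theorem exists_abs_ncard_sub_le [Finite F] (hK : IsFunctionFieldOfCurve F K) {n : ℕ} (hn : 1 ≤ n) :
    Summable (zetaTerm F K ((n : ℝ) + 1)) ∧ ∃ C : ℝ, 0 ≤ C ∧ ∀ r : ℕ,
      |((pointsOfHeight F K n r).ncard : ℝ) -
        leadingCoeff F K n * (Nat.card F : ℝ) ^ ((n + 1) * r)| ≤ C * (Nat.card F : ℝ) ^ r := by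
  have hK₁ : IsFunctionFieldOneVar F K := hK.exists_transcendental
  obtain ⟨D₁, hD₁⟩ := hK.exists_degree_eq_one
  have := finite_Pic0 hK₁
  have := Fintype.ofFinite (Pic0 F K)
  have hqN : 2 ≤ Nat.card F := Finite.one_lt_card
  have hclass : classNumber F K = Fintype.card (Pic0 F K) := Nat.card_eq_fintype_card
  obtain ⟨C₁, hC₁, hEff, hSet⟩ := exists_card_effDegree_le hK₁
  obtain ⟨C₀, hC₀, hest⟩ := exists_abs_pow_finrank_sub_le hK₁ (n + 1)
  have hzeta : ∀ D, zetaTerm F K ((n : ℝ) + 1) D =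
    (((Nat.card F : ℝ) ^ (n + 1))⁻¹) ^ effDegree D := zetaTerm_eq n
  have hcount := card_sub_one_mul_ncard hK hK₁ hD₁ n
  have hmoebius := fun (D : Divisor F K) => ncard_primitiveVec (ι := Fin (n + 1)) hK₁ D
  rw [Nat.card_fin] at hmoebius
  rw [leadingCoeff]
  set q : ℝ := ((Nat.card F : ℕ) : ℝ) with hq
  have hq2 : 2 ≤ q := by
    rw [hq]
    exact_mod_cast hqN
  have hq0 : 0 < q := by linarith
  set u : ℝ := (q ^ (n + 1))⁻¹ with hu
  have hu0 : 0 ≤ u := by positivity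
  have hqu : q * u = (q ^ n)⁻¹ := by
    rw [hu, pow_succ]
    field_simp
  -- Here n ≥ 1 is essential: the ratio is q^(-n).
  have hqu1 : q * u < 1 := by
    rw [hqu]
    exact inv_lt_one_of_one_lt₀ (one_lt_pow₀ (by linarith) (by omega))
  have hZ : Summable fun D : {D : Divisor F K // 0 ≤ D} => u ^ effDegree D :=
    summable_pow_degree effDegree hu0 hq0.le hqu1 hC₁ (fun m => (hEff m).1) fun m => (hEff m).2
  have hWabs : Summable fun S : Finset (Place F K) => u ^ finsetDegree S :=
    summable_pow_degree finsetDegree hu0 hq0.le hqu1 hC₁ (fun m => (hSet m).1) fun m => (hSet m).2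
  set W : Finset (Place F K) → ℝ := fun S => (-1) ^ S.card * u ^ finsetDegree S with hWdef
  have hWle : ∀ S, |W S| ≤ u ^ finsetDegree S := fun S => by
    simp [W, abs_mul, abs_of_nonneg hu0]
  have hW : Summable W := Summable.of_norm_bounded hWabs hWle
  refine ⟨hZ.congr fun D => (hzeta D).symm, ?_⟩
  have hzW : zeta F K ((n : ℝ) + 1) * ∑' S, W S = 1 := by
    rw [zeta, tsum_congr hzeta]
    exact tsum_pow_mul_tsum_eq_one hZ (by rwa [abs_of_nonneg hu0]) hu0
  set β : ℝ := q ^ (((n : ℤ) + 1) * (1 - genus F K)) with hβ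
  have hβ0 : 0 ≤ β := by positivity
  set h : ℝ := ((classNumber F K : ℕ) : ℝ) with hh
  have hh0 : 0 ≤ h := by positivity
  -- The first summand comes from at most 2 C₁ q^r sets S, each with error C₀, in each of h classes.
  -- The second comes from the tail of the series for 1/ζ_K(n+1).
  refine ⟨h * C₀ * (2 * C₁) + h * β * (C₁ / (1 - q * u)), ?_, fun r => ?_⟩
  · have : 0 < 1 - q * u := by linarith
    positivity
  set T : Finset (Finset (Place F K)) := (finite_finsetDegree_le hK₁ r).toFinset with hT
  have hTmem : ∀ S, S ∈ T ↔ finsetDegree S ≤ r := fun S => by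
    rw [hT, Set.Finite.mem_toFinset]
    rfl
  have hprim : ∀ c : Pic0 F K, |((primitiveVec (Fin (n + 1)) hK₁ (classRep D₁ r c)).ncard : ℝ) -
      β * q ^ ((n + 1) * r) * ∑ S ∈ T, W S| ≤ C₀ * (2 * C₁ * q ^ r) := by
    intro c
    have hdc := degree_classRep hD₁ (r : ℤ) c
    have h1 := hmoebius (classRep D₁ r c) T fun S hS => (hTmem S).2 (by
      rw [hdc] at hS
      exact_mod_cast hS)
    have h2 := congrArg (Int.cast : ℤ → ℝ) h1
    push_cast at h2
    rw [h2, Finset.mul_sum, ← Finset.sum_sub_distrib]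
    refine (Finset.abs_sum_le_sum_abs _ _).trans ?_
    have h3 : ∀ S ∈ T, |(-1) ^ S.card * (q ^ ((n + 1) *
        Module.finrank F (classRep D₁ r c - ofFinset S).rrSpace) - 1) -
          β * q ^ ((n + 1) * r) * W S| ≤ C₀ := by
      intro S hS
      have hS' := (hTmem S).1 hS
      have hdeg : (classRep D₁ r c - ofFinset S).degree = r - finsetDegree S := by
        rw [map_sub, hdc, degree_ofFinset]
      -- Truncating at deg S ≤ r keeps the degree nonnegative, which is where the uniform estimate
      -- applies.
      have h4 := hest (classRep D₁ r c - ofFinset S) (by rw [hdeg]; omega)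
      rw [hdeg] at h4
      have h5 : q ^ (((n + 1 : ℕ) : ℤ) * ((r : ℤ) - finsetDegree S + 1 - genus F K)) =
          β * q ^ ((n + 1) * r) * u ^ finsetDegree S := by
        rw [hβ, hu, inv_pow, ← pow_mul, ← zpow_natCast q ((n + 1) * r),
          ← zpow_natCast q ((n + 1) * finsetDegree S), ← zpow_neg, ← zpow_add₀ hq0.ne',
          ← zpow_add₀ hq0.ne']
        congr 1
        push_cast
        ring
      rw [h5] at h4
      have h6 : (-1) ^ S.card * (q ^ ((n + 1) *
          Module.finrank F (classRep D₁ r c - ofFinset S).rrSpace) - 1) -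
            β * q ^ ((n + 1) * r) * W S = (-1) ^ S.card * (q ^ ((n + 1) *
          Module.finrank F (classRep D₁ r c - ofFinset S).rrSpace) - 1 -
            β * q ^ ((n + 1) * r) * u ^ finsetDegree S) := by
        rw [hWdef]
        ring
      rw [h6, abs_mul, abs_pow, abs_neg, abs_one, one_pow, one_mul]
      exact h4
    refine (Finset.sum_le_sum h3).trans ?_
    rw [Finset.sum_const, nsmul_eq_mul, mul_comm]
    exact mul_le_mul_of_nonneg_left (card_degree_le finsetDegree hq2 hC₁ (fun m => (hSet m).1)
      (fun m => (hSet m).2) fun S hS => (hTmem S).1 hS) hC₀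
  have htail := abs_tsum_sub_sum_le finsetDegree hu0 hq0.le hqu1 hC₁ (fun m => (hSet m).1)
    (fun m => (hSet m).2) hW hWle (r := r) (T := T) fun S hS => (hTmem S).2 hS.le
  have hsum : (q - 1) * ((pointsOfHeight F K n r).ncard : ℝ) =
      ∑ c, ((primitiveVec (Fin (n + 1)) hK₁ (classRep D₁ r c)).ncard : ℝ) := by
    have := congrArg (Nat.cast : ℕ → ℝ) (hcount r)
    rw [Nat.cast_mul, Nat.cast_sub (by omega), Nat.cast_sum] at this
    simpa using this
  have hmain : |(q - 1) * ((pointsOfHeight F K n r).ncard : ℝ) -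
      h * (β * q ^ ((n + 1) * r) * ∑ S ∈ T, W S)| ≤ h * (C₀ * (2 * C₁ * q ^ r)) := by
    have h1 : h * (β * q ^ ((n + 1) * r) * ∑ S ∈ T, W S) =
        ∑ _c : Pic0 F K, (β * q ^ ((n + 1) * r) * ∑ S ∈ T, W S) := by
      rw [Finset.sum_const, Finset.card_univ, ← hclass, nsmul_eq_mul]
    have h2 : h * (C₀ * (2 * C₁ * q ^ r)) = ∑ _c : Pic0 F K, (C₀ * (2 * C₁ * q ^ r)) := by
      rw [Finset.sum_const, Finset.card_univ, ← hclass, nsmul_eq_mul]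
    rw [hsum, h1, h2, ← Finset.sum_sub_distrib]
    exact (Finset.abs_sum_le_sum_abs _ _).trans (Finset.sum_le_sum fun c _ => hprim c)
  have htail' : |h * (β * q ^ ((n + 1) * r) * ∑ S ∈ T, W S) -
      h * (β * q ^ ((n + 1) * r) * ∑' S, W S)| ≤ h * β * (C₁ / (1 - q * u)) * q ^ r := by
    rw [← mul_sub, ← mul_sub, abs_mul, abs_mul, abs_of_nonneg hh0, abs_of_nonneg
      (mul_nonneg hβ0 (pow_nonneg hq0.le _)), abs_sub_comm]
    have h1 : q ^ ((n + 1) * r) * (q * u) ^ r = q ^ r := by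
      rw [hqu, inv_pow, ← pow_mul, add_mul, one_mul, pow_add]
      field_simp
    calc h * (β * q ^ ((n + 1) * r) * |∑' S, W S - ∑ S ∈ T, W S|)
        ≤ h * (β * q ^ ((n + 1) * r) * (C₁ * ((q * u) ^ r / (1 - q * u)))) := by gcongr
      _ = h * β * (C₁ / (1 - q * u)) * (q ^ ((n + 1) * r) * (q * u) ^ r) := by ring
      _ = _ := by rw [h1]
  have hζ0 : zeta F K ((n : ℝ) + 1) ≠ 0 := left_ne_zero_of_mul_eq_one hzW
  have hWinv : ∑' S, W S = (zeta F K ((n : ℝ) + 1))⁻¹ := eq_inv_of_mul_eq_one_right hzW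
  -- Because q - 1 ≥ 1, dividing by it does not enlarge the error.
  have hq1 : 1 ≤ q - 1 := by linarith
  have hkey : (q - 1) * (((pointsOfHeight F K n r).ncard : ℝ) -
      h * β / (zeta F K ((n : ℝ) + 1) * (q - 1)) * q ^ ((n + 1) * r)) =
      (q - 1) * ((pointsOfHeight F K n r).ncard : ℝ) -
        h * (β * q ^ ((n + 1) * r) * ∑' S, W S) := by
    rw [hWinv]
    have : q - 1 ≠ 0 := by linarith
    field_simp
  have hfinal : |(q - 1) * (((pointsOfHeight F K n r).ncard : ℝ) -
      h * β / (zeta F K ((n : ℝ) + 1) * (q - 1)) * q ^ ((n + 1) * r))| ≤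
      (h * C₀ * (2 * C₁) + h * β * (C₁ / (1 - q * u))) * q ^ r := by
    rw [hkey]
    refine (abs_sub_le _ _ _).trans ((add_le_add hmain htail').trans_eq ?_)
    ring
  rw [abs_mul, abs_of_nonneg (by linarith)] at hfinal
  refine le_trans ?_ hfinal
  exact le_mul_of_one_le_left (abs_nonneg _) hq1

end Divisor

end

/-! ### The main theorem -/

theorem theorem4p1 (F K : Type*) [Field F] [Finite F] [Field K] [Algebra F K]
    (hK : IsFunctionFieldOfCurve F K) (infty : Place F K) (n : ℕ) (hn : 1 ≤ n) :
    -- the quantities in the formula are meaningful: the height does not depend on the coordinate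
    -- vector, the counts and the class number are finite, and the series for `ζ_K(n + 1)` converges
    (∀ x : Fin (n + 1) → K, x ≠ 0 → ∀ c : K, c ≠ 0 → vecHeight F (c • x) = vecHeight F x) ∧
    (∀ r : ℤ, (pointsOfHeight F K n r).Finite) ∧
    Finite (Divisor.Pic0 F K) ∧
    Summable (zetaTerm F K ((n : ℝ) + 1)) ∧
    -- the asymptotic formula
    ∃ C : ℝ, ∀ r : ℕ, 1 ≤ r →
      |((pointsOfHeight F K n r).ncard : ℝ)
          - leadingCoeff F K n * (Nat.card F : ℝ) ^ ((n + 1) * r)| ≤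
        C * (if n = 1 ∧ infty.degree = 1 then
            (Nat.card F : ℝ) ^ r * Real.log ((Nat.card F : ℝ) ^ r)
          else
            (Nat.card F : ℝ) ^ ((r : ℝ) * ((n : ℝ) + 1 - 1 / (infty.degree : ℝ)))) := by
  have hK₁ : IsFunctionFieldOneVar F K := hK.exists_transcendental
  obtain ⟨hsum, C, hC, hbound⟩ := Divisor.exists_abs_ncard_sub_le hK hn
  refine ⟨fun x hx c hc => ?_, Divisor.finite_pointsOfHeight hK n, Divisor.finite_Pic0 hK₁, hsum,
    ?_⟩
  · rw [Divisor.vecHeight_eq hK₁ hx, Divisor.vecHeight_eq hK₁ (smul_ne_zero hc hx),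
      Divisor.ofVec_smul hK₁ hx hc, map_add, Divisor.degree_ofFun, zero_add]
  · have hq2 : (2 : ℝ) ≤ Nat.card F := by
      exact_mod_cast (Finite.one_lt_card : 1 < Nat.card F)
    have hlog2 : 0 < Real.log 2 := Real.log_pos one_lt_two
    split_ifs
    · refine ⟨C / Real.log 2, fun r hr => (hbound r).trans ?_⟩
      -- As r ≥ 1, the logarithm stays away from 0, so O(q^r) is absorbed at the cost of the factor
      -- 1 / log 2.
      have h1 : Real.log 2 ≤ Real.log ((Nat.card F : ℝ) ^ r) := by
        refine Real.log_le_log two_pos (hq2.trans ?_)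
        exact le_self_pow₀ (by linarith) (by omega)
      calc C * (Nat.card F : ℝ) ^ r = C / Real.log 2 * ((Nat.card F : ℝ) ^ r * Real.log 2) := by
            field_simp
        _ ≤ _ := by gcongr
    · refine ⟨C, fun r _ => (hbound r).trans (mul_le_mul_of_nonneg_left ?_ hC)⟩
      rw [← Real.rpow_natCast]
      refine Real.rpow_le_rpow_of_exponent_le (by linarith) ?_
      -- The exponent is at least r because n ≥ 1 ≥ 1/d_∞.
      have h1 : (1 : ℝ) / infty.degree ≤ 1 := by
        have := infty.degree_pos hK₁
        rw [div_le_one (by positivity)]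
        exact_mod_cast this
      have h2 : (1 : ℝ) ≤ n := by exact_mod_cast hn
      exact le_mul_of_one_le_right (by positivity) (by linarith)
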